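/- Notation. Let $t=(t_1=x,t_3,t_5,\dots)$, $\partial=\partial_x$, $f^{(n)}=\partial_x^nf$, $\xi(t,\lambda)=\sum_{i\ge1}t_{2i-1}\lambda^{2i-1}$, $[\lambda^{-1}]=(\lambda^{-1},\tfrac13\lambda^{-3},\tfrac15\lambda^{-5},\dots)$ and $\mathrm{Res}_\lambda\sum_ia_i\lambda^i=a_{-1}$; $n$ denotes an odd positive integer. Functions of $t$ are understood as formal power series with complex coefficients at a base point $t_0$ (with finitely many non-zero entries), and functions of $\lambda$ are expanded at $\lambda=\infty$. For a function $\tau$ put $$\varphi(t,\lambda)=1+\lambda^{-1}\partial_x\log\frac{\tau(t-2[\lambda^{-1}])}{\tau(t)} .$$ Let $k\ge1$, $m\geq 0$, $P\ge0$, $N_1,\dots,N_m\ge0$ be integers, let $f_1,\dots,f_m$ satisfy $\partial_{t_n}f_i=f_i^{(n)}$ for all odd $n$, let $\varphi_j=e^{\xi(t,\lambda_j)}$ $(1\le j\le P)$ with $\lambda_j\in\mathbb C$, and let $$h=(h_1,\dots,h_M)=(f_1,f_1^{(k)},\dots,f_1^{(kN_1)},\dots,f_m,f_m^{(k)},\dots,f_m^{(kN_m)},\varphi_1,\dots,\varphi_P),\qquad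 M=m+P+\sum_{l=1}^mN_l .$$ Let $\Omega$ be a squared eigenfunction potential for the Lax operator $\partial$: a $\mathbb C$-bilinear operation such that for all $f,g$ with $f_{t_n}=f^{(n)}$, $g_{t_n}=g^{(n)}$ for all odd $n$, $$\Omega(f,g)_{t_n}=\mathrm{Res}_\partial(\partial^{-1}g\,\partial^nf\,\partial^{-1})=\sum_{l=0}^{n-1}(-1)^{n-1-l}f^{(l)}g^{(n-1-l)}\quad(n\text{ odd}),\qquad \Omega(f,g)=\Omega(g,f),$$ whose integration constants are such that, for all $f,g\in\{h_1,\dots,h_M\}$, the constant $$\Omega(f^{(k)},g)-(-1)^k\,\Omega(f,g^{(k)})-\mathrm{Res}_\partial(\partial^{-1}g\,\partial^kf\,\partial^{-1})$$ is zero. (This holds automatically whenever one of $f,g$ is a sum of exponentials $e^{\xi(t,\mu)}$ and $\Omega(f,e^{\xi(t,\mu)})=(\partial^{-1}\cdot f)(e^{\xi(t,\mu)})$.) For $N\le M$ let $$IW_{N,M}(g_1,\dots,g_N;f_1,\dots,f_M)=\begin{vmatrix}\Omega(f_1,g_1)&\dots&\Omega(f_M,g_1)\\ \vdots&&\vdots\\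 \Omega(f_1,g_N)&\dots&\Omega(f_M,g_N)\\ f_1&\dots&f_M\\ \vdots&&\vdots\\ f_1^{(M-N-1)}&\dots&f_M^{(M-N-1)}\end{vmatrix}.$$ Assume that $IW_{M,M}(h;h)$ does not vanish at $t_0$, and let $p(j)=j+\sum_{l=1}^jN_l$. Theorem 2. A square root $\tau=\sqrt{IW_{M,M}(h;h)}$ exists, and for either choice of it the functions $\tau$, $$\rho_{1,j}=\frac{IW_{M,M+1}(h_1,\dots,h_M;h_1,\dots,h_M,f_j^{(kN_j+k)})}{\sqrt{IW_{M,M}(h;h)}},\qquad \rho_{2,j}=\frac{(-1)^{M+p(j)}IW_{M-1,M}(h_1,\dots,\widehat{h_{p(j)}},\dots,h_M;h_1,\dots,h_M)}{\sqrt{IW_{M,M}(h;h)}}\qquad(1\le j\le m)$$ satisfy $$\mathrm{Res}_\lambda\,\lambda^k\sqrt{\varphi(t,\lambda)\varphi(t',-\lambda)}\,\tau(t-2[\lambda^{-1}])\,\tau(t'+2[\lambda^{-1}])\,e^{\xi(t-t',\lambda)}=\sum_{i=1}^m\big(\rho_{1,i}(t)\rho_{2,i}(t')-(-1)^k\rho_{2,i}(t)\rho_{1,i}(t')\big)$$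 and, for $a=1,2$ and $1\le j\le m$, $$\mathrm{Res}_\lambda\,\lambda^{-1}e^{\xi(t-t',\lambda)}\sqrt{\frac{\varphi(t,\lambda)}{\varphi(t',-\lambda)}}\,\tau(t-2[\lambda^{-1}])\big(\tau(t')\rho_{a,j}(t'+2[\lambda^{-1}])+\rho_{a,j}(t')\tau(t'+2[\lambda^{-1}])\big)=2\rho_{a,j}(t)\tau(t')^2 ,$$ where the square roots of series in $\lambda^{-1}$ are those with leading term $1$. Further, let $W=1+\sum_{i\ge1}w_i\partial^{-i}$ be given by $1+\sum_{i\ge1}w_i\lambda^{-i}=\sqrt{\varphi(t,\lambda)}\,\tau(t-2[\lambda^{-1}])/\tau(t)$. Then $W^*=W^{-1}$, the operator $L=W\partial W^{-1}$ has the form $\partial+\sum_{i\ge1}u_{i+1}\partial^{-i}$, satisfies $W_{t_n}=-(L^n)_{<0}W$, and $L$ together with $$q_{1,j}=\frac{IW_{M,M+1}(h_1,\dots,h_M;h_1,\dots,h_M,f_j^{(kN_j+k)})}{IW_{M,M}(h;h)},\qquad q_{2,j}=\frac{(-1)^{M+p(j)}IW_{M-1,M}(h_1,\dots,\widehat{h_{p(j)}},\dots,h_M;h_1,\dots,h_M)}{IW_{M,M}(h;h)}$$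 solves the $(k,m)$-constrained CKP hierarchy $$(L^k)_{<0}=\sum_{i=1}^m\big(q_{1,i}\partial^{-1}q_{2,i}-(-1)^kq_{2,i}\partial^{-1}q_{1,i}\big),\quad L_{t_n}=[(L^n)_{\ge0},L],\quad L^*=-L,\quad \partial_{t_n}q_{a,i}=(L^n)_{\ge0}(q_{a,i}).$$ -/

import Mathlib

noncomputable section

namespace CKP

open MvPowerSeries

/-! ### Functions of the times

The times are `t = (t₁, t₃, t₅, …)`; the index `n : ℕ` stands for the odd number `2 n + 1`, so the
variable `X n` is `t_{2n+1}` (measured from a base point `t₀`), and `X 0` is `x = t₁`. Functions of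
`t` are formal power series in these infinitely many variables (Taylor series at `t₀`). -/

/-- Functions of `t`, as formal power series at the base point. -/
abbrev Fn : Type := MvPowerSeries ℕ ℂ

/-- `∂/∂t_{2n+1}`. -/
def dt (n : ℕ) : Fn → Fn := fun f => pderiv ℂ n f

/-- `∂_x^l`, where `x = t₁`. -/
def dx (l : ℕ) : Fn → Fn := (dt 0)^[l]

/-- `f_{t_n} = ∂_x^n f` for all odd `n`: eigenfunctions of the Lax operator `∂`. -/
def IsEigen (f : Fn) : Prop := ∀ n : ℕ, dt n f = dx (2 * n + 1) f

/-- The Taylor series at `c = 0` of `exp (∑ i, c i * X i) = ∏ i, exp (c i * X i)`. -/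
def expLin {σ A : Type*} [CommRing A] [Algebra ℚ A] (c : σ → A) : MvPowerSeries σ A :=
  fun β => β.prod fun i b => algebraMap ℚ A (1 / (b.factorial : ℚ)) * c i ^ b

/-- The Taylor series of `e^{ξ(t,μ)}`, `ξ(t,μ) = ∑ t_{2i+1} μ^{2i+1}`, at the base point `t₀`. -/
def expXi (t₀ : ℕ →₀ ℂ) (μ : ℂ) : Fn :=
  C (Complex.exp (t₀.sum fun i a => a * μ ^ (2 * i + 1))) * expLin fun i => μ ^ (2 * i + 1)

/-! ### Pseudo-differential operators

`a : ℤ → Fn` stands for `∑ i, a i ∂^i`, where `a i = 0` for all large `i`. -/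

/-- Pseudo-differential operators, given by their coefficients. -/
abbrev PDO : Type := ℤ → Fn

/-- `(∑ a_i ∂^i)(∑ b_j ∂^j) = ∑ a_i binom(i,l) b_j^{(l)} ∂^{i+j-l}`. For operators of bounded order
only finitely many pairs `(i, l)` contribute to a given coefficient. -/
def pmul (a b : PDO) : PDO := fun n =>
  ∑ᶠ p : ℤ × ℕ, Ring.choose p.1 p.2 • (a p.1 * dx p.2 (b (n - p.1 + p.2)))

/-- `∂^i`. -/
def pd (i : ℤ) : PDO := Pi.single i 1

/-- The operator of multiplication by `f`. -/
def pfn (f : Fn) : PDO := Pi.single 0 f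

/-- Powers. -/
def ppow (a : PDO) : ℕ → PDO
  | 0 => pd 0
  | n + 1 => pmul (ppow a n) a

/-- The formal adjoint `∑ (-1)^i ∂^i a_i`: the coefficient of `∂^n` is
`∑_l (-1)^{n+l} binom(n+l,l) a_{n+l}^{(l)}`. -/
def padj (a : PDO) : PDO := fun n =>
  ∑ᶠ l : ℕ, (((n + l).negOnePow : ℤ) * Ring.choose (n + l) l) • dx l (a (n + l))

/-- The differential part `(·)_{≥ 0}`. -/
def ppos (a : PDO) : PDO := fun n => if 0 ≤ n then a n else 0

/-- The integral part `(·)_{< 0}`. -/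
def pneg (a : PDO) : PDO := fun n => if n < 0 then a n else 0

/-- The residue, the coefficient of `∂^{-1}`. -/
def pres (a : PDO) : Fn := a (-1)

/-- The function `A(f)` for a differential operator `A = ∑_{i ≥ 0} a_i ∂^i`. -/
def pact (a : PDO) (f : Fn) : Fn := ∑ᶠ i : ℕ, a i * dx i f

/-- `f ∂^{-1} g`. -/
def pint (f g : Fn) : PDO := pmul (pmul (pfn f) (pd (-1))) (pfn g)

/-- A Lax operator of the CKP hierarchy: `L = ∂ + ∑_{i ≥ 1} u_{i+1} ∂^{-i}`, `L* = -L` and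
`L_{t_n} = [(L^n)_{≥ 0}, L]` for all odd `n`. -/
structure IsCKPLax (L : PDO) : Prop where
  lead : L 1 = 1
  sub : L 0 = 0
  order : ∀ i : ℤ, 1 < i → L i = 0
  adj : padj L = -L
  lax : ∀ n : ℕ, (fun i => dt n (L i)) =
    pmul (ppos (ppow L (2 * n + 1))) L - pmul L (ppos (ppow L (2 * n + 1)))

/-- The `(k,m)`-constrained CKP hierarchy for `L` and `q_{1,i}`, `q_{2,i}`. -/
structure IsConstrainedCKP (k : ℕ) {m : ℕ} (L : PDO) (q₁ q₂ : Fin m → Fn) : Prop where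
  ckp : IsCKPLax L
  constraint : pneg (ppow L k) =
    ∑ i, (pint (q₁ i) (q₂ i) - (-1 : ℤ) ^ k • pint (q₂ i) (q₁ i))
  flow₁ : ∀ i n, dt n (q₁ i) = pact (ppos (ppow L (2 * n + 1))) (q₁ i)
  flow₂ : ∀ i n, dt n (q₂ i) = pact (ppos (ppow L (2 * n + 1))) (q₂ i)

/-- `W = 1 + ∑_{i ≥ 1} w_i ∂^{-i}` is a dressing operator of `L` for the CKP hierarchy:
`L = W ∂ W⁻¹`, `W* = W⁻¹` and `W_{t_n} = -(L^n)_{< 0} W` for all odd `n`. -/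
structure IsDressing (W L : PDO) : Prop where
  lead : W 0 = 1
  order : ∀ i : ℤ, 0 < i → W i = 0
  dress : pmul L W = pmul W (pd 1)
  adj_mul : pmul (padj W) W = pd 0
  mul_adj : pmul W (padj W) = pd 0
  sato : ∀ n : ℕ, (fun i => dt n (W i)) = -pmul (pneg (ppow L (2 * n + 1))) W

/-! ### Squared eigenfunction potentials and generalized Wronskians -/

/-- `Res_∂ (∂^{-1} g ∂^n f ∂^{-1})`. -/
def sepRes (n : ℕ) (f g : Fn) : Fn :=
  pres (pmul (pmul (pmul (pmul (pd (-1)) (pfn g)) (pd n)) (pfn f)) (pd (-1)))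

/-- `Ω` is a squared eigenfunction potential for the Lax operator `∂`: it is bilinear, and for any
two eigenfunctions `Ω(f,g)_{t_n} = Res_∂ (∂^{-1} g ∂^n f ∂^{-1})` for all odd `n`, and
`Ω(f,g) = Ω(g,f)`. -/
structure IsSEP (Ω : Fn →ₗ[ℂ] Fn →ₗ[ℂ] Fn) : Prop where
  flow : ∀ f g, IsEigen f → IsEigen g → ∀ n : ℕ, dt n (Ω f g) = sepRes (2 * n + 1) f g
  symm : ∀ f g, IsEigen f → IsEigen g → Ω f g = Ω g f

/-- The integration constants of `Ω` agree with the action of `∂^k` on the functions `h`: the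
quantity `Ω(f^{(k)},g) - (-1)^k Ω(f,g^{(k)}) - Res_∂ (∂^{-1} g ∂^k f ∂^{-1})`, which for
eigenfunctions is always a constant, vanishes for `f`, `g` in `h`. -/
def IsNormalized (k : ℕ) (Ω : Fn →ₗ[ℂ] Fn →ₗ[ℂ] Fn) (h : List Fn) : Prop :=
  ∀ f ∈ h, ∀ g ∈ h, Ω (dx k f) g - (-1 : ℤ) ^ k • Ω f (dx k g) = sepRes k f g

/-- The generalized Wronskian determinant `IW_{N,M}(g_1,…,g_N; f_1,…,f_M)`, `N ≤ M`: the first `N`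
rows are `Ω(f_c, g_r)`, followed by the rows `f_c`, `f_c'`, …, `f_c^{(M-N-1)}`. -/
def IW (Ω : Fn →ₗ[ℂ] Fn →ₗ[ℂ] Fn) (g f : List Fn) : Fn :=
  Matrix.det (Matrix.of fun r c : Fin f.length =>
    if hr : (r : ℕ) < g.length then Ω (f.get c) (g.get ⟨r, hr⟩)
    else dx (r - g.length) (f.get c))

/-- The list `f_1, f_1^{(k)}, …, f_1^{(k N_1)}, …, f_m, …, f_m^{(k N_m)}, φ_1, …, φ_P`. -/
def seeds (k : ℕ) {m P : ℕ} (N : Fin m → ℕ) (f : Fin m → Fn) (φ : Fin P → Fn) : List Fn :=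
  (List.ofFn fun i : Fin m =>
    List.ofFn fun l : Fin (N i + 1) => dx (k * (l : ℕ)) (f i)).flatten ++ List.ofFn φ

/-- The position `p(j) = j + ∑_{l ≤ j} N_l`, counted from `1`, of `f_j^{(k N_j)}` in the list
(the element `j : Fin m` is the `(j+1)`-st one). -/
def pos {m : ℕ} (N : Fin m → ℕ) (j : Fin m) : ℕ := (j : ℕ) + 1 + ∑ l ∈ Finset.Iic j, N l

/-- `IW_{M,M}(h; h)`. -/
def wronski₀ (Ω : Fn →ₗ[ℂ] Fn →ₗ[ℂ] Fn) (h : List Fn) : Fn := IW Ω h h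

/-- `IW_{M,M+1}(h; h, f_j^{(k N_j + k)})`. -/
def wronski₁ (Ω : Fn →ₗ[ℂ] Fn →ₗ[ℂ] Fn) (k : ℕ) {m : ℕ} (N : Fin m → ℕ) (f : Fin m → Fn)
    (h : List Fn) (j : Fin m) : Fn :=
  IW Ω h (h ++ [dx (k * N j + k) (f j)])

/-- `(-1)^{M+p(j)} IW_{M-1,M}(h_1, …, ĥ_{p(j)}, …, h_M; h)`. -/
def wronski₂ (Ω : Fn →ₗ[ℂ] Fn →ₗ[ℂ] Fn) {m : ℕ} (N : Fin m → ℕ)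
    (h : List Fn) (j : Fin m) : Fn :=
  (-1) ^ (h.length + pos N j) * IW Ω (h.eraseIdx (pos N j - 1)) h

/-! ### Functions of the times and of `z = λ^{-1}`

`σ` indexes the time variables: `σ = ℕ` for functions of `t`, and `σ = ℕ ⊕ ℕ` for functions of
`t` (left summand) and `t'` (right summand). The map `s : ℕ → σ` selects one set of times. -/

/-- Power series in the times and in `z = λ^{-1}`. -/
abbrev FnZ (σ : Type) : Type := MvPowerSeries (σ ⊕ Unit) ℂ

/-- The variable `z = λ^{-1}`. -/
def zvar (σ : Type) : FnZ σ := X (Sum.inr ())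

/-- `f(t + c [λ^{-1}])`, where `[λ^{-1}] = (λ^{-1}, λ^{-3}/3, λ^{-5}/5, …)`. -/
def shiftBy {σ : Type} (s : ℕ → σ) (c : ℂ) (f : Fn) : FnZ σ :=
  subst (fun n : ℕ =>
    (X (Sum.inl (s n)) + C (c / (2 * n + 1)) * zvar σ ^ (2 * n + 1) : FnZ σ)) f

/-- The square root with constant term `1` of a series with constant term `1`, by the binomial
series `∑ binom(1/2,n) (F-1)^n`. -/
def fsqrt {σ : Type} (F : FnZ σ) : FnZ σ :=
  (PowerSeries.binomialSeries ℂ (1 / 2 : ℚ)).subst (F - 1)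

/-- `φ(t, ελ) = 1 + (ελ)^{-1} ∂_x log (τ(t - 2[(ελ)^{-1}]) / τ(t))` for `ε = ±1`. -/
def phi {σ : Type} (s : ℕ → σ) (ε : ℂ) (τ : Fn) : FnZ σ :=
  1 + C ε * zvar σ *
    (pderiv ℂ (Sum.inl (s 0)) (shiftBy s (-2 * ε) τ * (shiftBy s 0 τ)⁻¹) *
      (shiftBy s (-2 * ε) τ * (shiftBy s 0 τ)⁻¹)⁻¹)

/-- The series `1 + ∑ w_i λ^{-i} = √φ(t,λ) τ(t - 2[λ^{-1}]) / τ(t)`, that is `e^{-ξ(t,λ)}` times the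
wave function `ψ(t,λ)` attached to the tau function `τ`. -/
def waveSeries (τ : Fn) : FnZ ℕ :=
  fsqrt (phi id 1 τ) * (shiftBy id (-2) τ * (shiftBy id 0 τ)⁻¹)

/-- The operator `W = 1 + ∑ w_i ∂^{-i}` attached to the tau function `τ`. -/
def dressing (τ : Fn) : PDO := fun n =>
  if n ≤ 0 then fun β => coeff (β.sumElim (Finsupp.single () (-n).toNat)) (waveSeries τ) else 0

/-! ### Residues in `λ`

All products below are taken in the ring of power series in `t`, `t'` whose coefficients are Laurent
series in `z = λ^{-1}`. -/

/-- Functions of two sets of times `t`, `t'`. -/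
abbrev Fn₂ : Type := MvPowerSeries (ℕ ⊕ ℕ) ℂ

/-- Functions of `t`, `t'` and `λ`. -/
abbrev FnL : Type := MvPowerSeries (ℕ ⊕ ℕ) (LaurentSeries ℂ)

/-- `f(t)` as a function of `t`, `t'`. -/
def left (f : Fn) : Fn₂ := subst (fun n : ℕ => (X (Sum.inl n) : Fn₂)) f

/-- `f(t')` as a function of `t`, `t'`. -/
def right (f : Fn) : Fn₂ := subst (fun n : ℕ => (X (Sum.inr n) : Fn₂)) f

/-- `λ^e`. -/
def lamPow (e : ℤ) : LaurentSeries ℂ := HahnSeries.single (-e) 1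

/-- A power series in `t`, `t'`, `z` as a series in `t`, `t'` with coefficients in `ℂ((z))`. -/
def toFnL (G : FnZ (ℕ ⊕ ℕ)) : FnL := fun β =>
  HahnSeries.ofPowerSeries ℤ ℂ
    (PowerSeries.mk fun w => coeff (β.sumElim (Finsupp.single () w)) G)

/-- `e^{ξ(t-t',λ)} = exp (∑ (t_{2n+1} - t'_{2n+1}) λ^{2n+1})`. -/
def expXiDiff : FnL :=
  expLin (Sum.elim (fun n : ℕ => lamPow (2 * n + 1)) (fun n : ℕ => -lamPow (2 * n + 1)))

/-- `Res_λ ∑ a_i λ^i = a_{-1}`. -/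
def resLam (F : FnL) : Fn₂ := fun β => (coeff β F).coeff 1

/-- The first bilinear equation
`Res_λ λ^k √(φ(t,λ) φ(t',-λ)) τ(t-2[λ^{-1}]) τ(t'+2[λ^{-1}]) e^{ξ(t-t',λ)}
  = ∑_i (ρ_{1,i}(t) ρ_{2,i}(t') - (-1)^k ρ_{2,i}(t) ρ_{1,i}(t'))`. -/
def Bilinear₁ (k : ℕ) {m : ℕ} (τ : Fn) (ρ₁ ρ₂ : Fin m → Fn) : Prop :=
  resLam (C (lamPow k) *
      toFnL (fsqrt (phi Sum.inl 1 τ * phi Sum.inr (-1) τ) *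
        shiftBy Sum.inl (-2) τ * shiftBy Sum.inr 2 τ) * expXiDiff) =
    ∑ i, (left (ρ₁ i) * right (ρ₂ i) - (-1) ^ k * left (ρ₂ i) * right (ρ₁ i))

/-- The second bilinear equation
`Res_λ λ^{-1} e^{ξ(t-t',λ)} √(φ(t,λ)/φ(t',-λ)) τ(t-2[λ^{-1}])
  (τ(t') ρ(t'+2[λ^{-1}]) + ρ(t') τ(t'+2[λ^{-1}])) = 2 ρ(t) τ(t')^2`. -/
def Bilinear₂ (τ ρ : Fn) : Prop :=
  resLam (C (lamPow (-1)) * expXiDiff *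
      toFnL (fsqrt (phi Sum.inl 1 τ * (phi Sum.inr (-1) τ)⁻¹) * shiftBy Sum.inl (-2) τ *
        (shiftBy Sum.inr 0 τ * shiftBy Sum.inr 2 ρ +
          shiftBy Sum.inr 0 ρ * shiftBy Sum.inr 2 τ))) =
    2 * left ρ * right τ ^ 2

/-! ### The definitions above are not degenerate -/

theorem fsqrt_sq {σ : Type} (F : FnZ σ) (hF : constantCoeff F = 1) : fsqrt F ^ 2 = F := by
  have hs : PowerSeries.HasSubst (F - 1) :=
    PowerSeries.HasSubst.of_constantCoeff_zero (by simp [hF])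
  have h1 : PowerSeries.binomialSeries ℂ (1 / 2 : ℚ) ^ 2 = 1 + PowerSeries.X := by
    rw [sq, ← PowerSeries.binomialSeries_add]
    have := PowerSeries.binomialSeries_nat (R := ℚ) (A := ℂ) 1
    norm_num at this ⊢
    exact this
  rw [fsqrt, ← PowerSeries.subst_pow hs, h1, PowerSeries.subst_add hs, PowerSeries.subst_X hs,
    ← PowerSeries.coe_substAlgHom hs, map_one]
  ring

theorem hasSubst_shift {σ : Type} (s : ℕ → σ) (hs : Function.Injective s) (c : ℂ) :
    HasSubst (fun n : ℕ =>
      (X (Sum.inl (s n)) + C (c / (2 * n + 1)) * zvar σ ^ (2 * n + 1) : FnZ σ)) where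
  const_coeff n := by simp [zvar]
  coeff_zero d := by
    classical
    have h1 : {n : ℕ | d = Finsupp.single (Sum.inl (s n)) 1}.Finite := by
      apply Set.Subsingleton.finite
      intro a ha b hb
      have := ha.symm.trans hb
      rw [Finsupp.single_eq_single_iff] at this
      simpa [hs.eq_iff] using this
    have h2 : {n : ℕ | d = Finsupp.single (Sum.inr ()) (2 * n + 1)}.Finite := by
      apply Set.Subsingleton.finite
      intro a ha b hb
      have := ha.symm.trans hb
      rw [Finsupp.single_eq_single_iff] at this
      simp at this; omega
    apply (h1.union h2).subset
    intro n hn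
    by_contra hc
    apply hn
    simp only [Set.mem_union, Set.mem_ofPred_eq, not_or] at hc
    rw [zvar, map_add, coeff_C_mul, coeff_X, X_pow_eq, coeff_monomial, if_neg hc.1, if_neg hc.2]
    simp

theorem hasSubst_left : HasSubst (fun n : ℕ => (X (Sum.inl n) : Fn₂)) where
  const_coeff n := by simp
  coeff_zero d := by
    classical
    apply Set.Subsingleton.finite
    intro a ha b hb
    simp only [coeff_X, ne_eq, ite_eq_right_iff, one_ne_zero, imp_false, not_not,
      Set.mem_ofPred_eq] at ha hb
    have := ha.symm.trans hb
    rw [Finsupp.single_eq_single_iff] at this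
    simpa using this

theorem dx_zero (l : ℕ) : dx l 0 = 0 := by
  induction l with
  | zero => rfl
  | succ l ih => rw [dx, Function.iterate_succ_apply', ← dx, ih]; exact map_zero (pderiv ℂ 0)

theorem pmul_finite (a b : PDO) (A B : ℤ) (ha : ∀ i, A < i → a i = 0) (hb : ∀ i, B < i → b i = 0)
    (n : ℤ) : (Function.support fun p : ℤ × ℕ =>
      Ring.choose p.1 p.2 • (a p.1 * dx p.2 (b (n - p.1 + p.2)))).Finite := by
  apply ((Set.finite_Icc (n - B) A).prod (Set.finite_Iic (B - n + A).toNat)).subset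
  intro p hp
  have h1 : p.1 ≤ A := by
    by_contra h; exact hp (by simp [ha _ (not_le.mp h)])
  have h2 : n - p.1 + p.2 ≤ B := by
    by_contra h; exact hp (by simp [hb _ (not_le.mp h), dx_zero])
  simp only [Set.mem_prod, Set.mem_Icc, Set.mem_Iic]
  omega

theorem pmul_pd_right (a : PDO) (j n : ℤ) : pmul a (pd j) n = a (n - j) := by
  have hd : ∀ l : ℕ, 0 < l → dx l (1 : Fn) = 0 := by
    intro l hl
    obtain ⟨l, rfl⟩ := Nat.exists_eq_succ_of_ne_zero hl.ne'
    have : dt 0 (1 : Fn) = 0 := (pderiv ℂ 0).map_one_eq_zero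
    rw [dx, Function.iterate_succ_apply, this]; exact dx_zero l
  rw [pmul, finsum_eq_single _ (n - j, 0)]
  · simp [pd, dx]
  · rintro ⟨i, l⟩ hne
    by_cases hl : 0 < l
    · simp only [pd, Pi.single_apply]
      split_ifs <;> simp [hd l hl, dx_zero]
    · obtain rfl : l = 0 := by omega
      have : i ≠ n - j := by rintro rfl; exact hne rfl
      have h' : n - i ≠ j := by omega
      simp [pd, h', dx]

theorem pmul_pfn_right (a : PDO) (f : Fn) (n : ℤ) :
    pmul a (pfn f) n = ∑ᶠ l : ℕ, Ring.choose (n + l) l • (a (n + l) * dx l f) := by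
  have hz : ∀ p : ℤ × ℕ, p.1 ≠ n + p.2 → 
      Ring.choose p.1 p.2 • (a p.1 * dx p.2 (pfn f (n - p.1 + p.2))) = 0 := by
    intro p hp
    have : n - p.1 + p.2 ≠ 0 := by omega
    simp [pfn, this, dx_zero]
  have hinj : Function.Injective (fun l : ℕ => ((n + l, l) : ℤ × ℕ)) := by
    intro x y hxy; exact (Prod.ext_iff.mp hxy).2
  rw [pmul, ← finsum_mem_univ, finsum_mem_inter_support_eq' _ Set.univ
    (Set.range fun l : ℕ => ((n + l, l) : ℤ × ℕ)), finsum_mem_range hinj]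
  · refine finsum_congr fun l => ?_
    have : n - (n + (l : ℤ)) + l = 0 := by ring
    simp [pfn]
  · intro p hp
    simp only [Set.mem_univ, true_iff, Set.mem_range]
    refine ⟨p.2, Prod.ext ?_ rfl⟩
    by_contra h
    exact hp (hz p (fun h' => h h'.symm))

/-- Explicitly, `Res_∂ (∂^{-1} g ∂^n f ∂^{-1}) = ∑_{l < n} (-1)^{n-1-l} f^{(l)} g^{(n-1-l)}`. -/
theorem sepRes_eq (n : ℕ) (f g : Fn) : sepRes n f g =
    ∑ l ∈ Finset.range n, (-1) ^ (n - 1 - l) * (dx l f * dx (n - 1 - l) g) := by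
  have hc : ∀ i : ℤ, ∀ j : ℕ, i + j = -1 → pmul (pd (-1)) (pfn g) i = (-1) ^ j * dx j g := by
    intro i j hij
    rw [pmul_pfn_right, finsum_eq_single _ j]
    · have h1 : Ring.choose (-1 : ℤ) j = (-1) ^ j := by
        have h2 := Ring.choose_natCast (R := ℤ) j j
        rw [Ring.choose_neg, show (1 : ℤ) + j - 1 = j by ring, h2]
        simp [Int.negOnePow, Units.smul_def]
      rw [hij, h1]
      simp [pd]
    · intro l hl
      have : i + l ≠ -1 := by omega
      simp [pd, this]
  have hc' : ∀ i : ℤ, 0 ≤ i → pmul (pd (-1)) (pfn g) i = 0 := by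
    intro i hi
    rw [pmul_pfn_right]
    refine finsum_eq_zero_of_forall_eq_zero fun l => ?_
    have : i + l ≠ -1 := by omega
    simp [pd, this]
  rw [sepRes, pres, pmul_pd_right, pmul_pfn_right, finsum_eq_sum_of_support_subset (s := Finset.range n)]
  · refine Finset.sum_congr rfl fun l hl => ?_
    have hl' := Finset.mem_range.mp hl
    rw [pmul_pd_right, hc _ (n - 1 - l) (by omega)]
    have h2 := Ring.choose_natCast (R := ℤ) l l
    rw [Nat.choose_self] at h2
    rw [show -1 - -1 + (l : ℤ) = l by ring, h2]
    simp
    ring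
  · intro l hl
    by_contra hl'
    apply hl
    simp only [Finset.coe_range, Set.mem_Iio, not_lt] at hl'
    dsimp only
    rw [pmul_pd_right, hc' _ (by omega)]
    simp

end CKP

end

/-!
# Solutions of the constrained CKP hierarchy from squared eigenfunction potentials

Let `G = (Ω(h_i, h_j))` be the Gram matrix of the seed functions, `a = G⁻¹ h` and `z = λ⁻¹`.
Everything is expressed through `G`, `h` and `a`; that `τ² = det G` is invertible at the base point
makes `a` a vector of power series and provides the square root (`exists_sq_eq`).

*The wave function.* The flows `f_{t_n} = f^{(n)}` say that the shift `t ↦ t - 2[λ⁻¹]` acts on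
eigenfunctions as `(1 - z∂)(1 + z∂)⁻¹` (`zcoeff_shiftBy_eigen`), and the flows of `Ω` say that it
changes `G` by the rank one matrix `-2z F Fᵀ`, `F = (1 + z∂)⁻¹ h` (`shiftBy_potential`). Hence
`det G` is multiplied by `1 - 2z Fᵀ G⁻¹ F` (`shiftBy_det`), and a computation with this ratio and
its `x`-derivative shows that `√φ(t,λ) τ(t - 2[λ⁻¹]) / τ(t) = 1 - z ∑ a_i (1 + z∂)⁻¹ h_i`, because
both sides have the same square (`wave_sq`, `fsqrt_phi_mul`).

*The bilinear equations.* The residue of a resolvent `(1 + z∂)⁻¹ f` against `e^{ξ(t-t',λ)}` is given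
by Taylor's formula (`resExp_resolvent_inr`, `resExp_resolvent_inl`), and the residue of the product
of two resolvents at `(t, λ)` and `(t', -λ)` is a difference of potentials at `t` and at `t'`
(`resExp_resolvent_mul`): both sides satisfy the same differential equations, and the normalization
of the integration constants makes them agree at the base point. Inserting the formula for the wave
function gives a sum over all seed functions of products of `a_i` and of the transforms
`h_i^{(k)} - ∑_j a_j Ω(h_j, h_i^{(k)})` (`bilinear_one`), and likewise the second equation
(`bilinear_two`).

*The Lax operator.* In terms of operators the wave function is `W = 1 - ∑ a_j ∂⁻¹ h_j`
(`dressing_eq`). Integration by parts, `∂⁻¹ M_x ∂⁻¹ = M ∂⁻¹ - ∂⁻¹ M` (`parts`), applied to `G` and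
to `G⁻¹`, shows that `1 + ∑ h_j ∂⁻¹ a_j` is both the inverse and the adjoint of `W`
(`dress_mul_undress`, `adj_dress`). It also yields the integral part of `L^n = W ∂^n W⁻¹`
(`mdiff_sub_negMat`), which for `n = k` is the constraint, again with a sum over all seed functions
(`negLax_eq`), and for odd `n` equals `-W_{t_n} W⁻¹` (`dtp_dress_mul_undress`). The flows of `a` and
of the transforms are obtained from residues (`pact_row`, `dt_adjWave`, `dt_transform`).

*The Wronskians.* By the Schur complement and Cramer's rule the quotients of Wronskians by `det G`
are the transforms of the `f_j^{(kN_j + k)}` and the components of `a` at the `f_j^{(kN_j)}`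
(`det_bordered`, `det_updateRow`). The transform annihilates the seed functions, and `h_j^{(k)}`
is a multiple of a seed function unless `h_j` is one of the last derivatives `f_i^{(kN_i)}`; so of
the sums over all seed functions only the `m` terms in the theorem remain (`sum_seeds`).

A shift by `+2[λ⁻¹]` at `t'` is treated together with the shift by `-2[λ⁻¹]` at `t`, through a sign
`ε` with `ε² = 1` and an injection `s` of the times into the variables.
-/

noncomputable section

namespace CKP

section

open MvPowerSeries

/-! ### The chain rule for substitution into power series in infinitely many variables -/

/-- A functional on power series that depends on finitely many coefficients only. -/
def DependsFinitely {σ : Type*} (L : MvPowerSeries σ ℂ → ℂ) : Prop :=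
  ∃ T : Finset (σ →₀ ℕ), ∀ f g, (∀ d ∈ T, coeff d f = coeff d g) → L f = L g

theorem DependsFinitely.mul {σ : Type*} {L L' : MvPowerSeries σ ℂ → ℂ}
    (h : DependsFinitely L) (h' : DependsFinitely L') : DependsFinitely fun f => L f * L' f := by
  classical
  obtain ⟨T, hT⟩ := h
  obtain ⟨T', hT'⟩ := h'
  refine ⟨T ∪ T', fun f g hfg => ?_⟩
  beta_reduce
  rw [hT f g fun d hd => hfg d (Finset.mem_union_left _ hd),
    hT' f g fun d hd => hfg d (Finset.mem_union_right _ hd)]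

theorem DependsFinitely.const {σ : Type*} (c : ℂ) :
    DependsFinitely fun _ : MvPowerSeries σ ℂ => c :=
  ⟨∅, fun _ _ _ => rfl⟩

theorem DependsFinitely.sum {σ ι : Type*} (s : Finset ι) {L : ι → MvPowerSeries σ ℂ → ℂ}
    (h : ∀ i ∈ s, DependsFinitely (L i)) : DependsFinitely fun f => ∑ i ∈ s, L i f := by
  classical
  choose! T hT using h
  refine ⟨s.biUnion T, fun f g hfg => Finset.sum_congr rfl fun i hi => hT i hi f g fun d hd => ?_⟩
  exact hfg d (Finset.mem_biUnion.mpr ⟨i, hi, hd⟩)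

theorem DependsFinitely.comp_pderiv {σ : Type*} {L : MvPowerSeries σ ℂ → ℂ}
    (h : DependsFinitely L) (n : σ) : DependsFinitely fun f => L (pderiv ℂ n f) := by
  classical
  obtain ⟨T, hT⟩ := h
  refine ⟨T.image fun d => d + Finsupp.single n 1, fun f g hfg => hT _ _ fun d hd => ?_⟩
  rw [coeff_pderiv, coeff_pderiv, hfg _ (Finset.mem_image_of_mem _ hd)]

theorem DependsFinitely.coeff_subst {σ τ : Type*} {a : σ → MvPowerSeries τ ℂ} (ha : HasSubst a)
    (e : τ →₀ ℕ) : DependsFinitely fun f : MvPowerSeries σ ℂ => coeff e (subst a f) := by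
  have hfin := coeff_subst_finite (R := ℂ) ha (show MvPowerSeries σ ℂ from fun _ => 1) e
  refine ⟨hfin.toFinset, fun f g hfg => ?_⟩
  simp only [MvPowerSeries.coeff_subst ha]
  refine finsum_congr fun d => ?_
  by_cases hd : coeff e (d.prod fun s e => a s ^ e) = 0
  · rw [hd, smul_zero, smul_zero]
  · rw [hfg d]
    refine (Set.Finite.mem_toFinset hfin).mpr ?_
    have : coeff d (show MvPowerSeries σ ℂ from fun _ => 1) = 1 := rfl
    rwa [Function.mem_support, this, one_smul]

/-- Two functionals that depend on finitely many coefficients and agree on polynomials agree. -/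
theorem DependsFinitely.ext {σ : Type*} {L L' : MvPowerSeries σ ℂ → ℂ}
    (h : DependsFinitely L) (h' : DependsFinitely L')
    (hp : ∀ p : MvPolynomial σ ℂ, L p = L' p) (f : MvPowerSeries σ ℂ) : L f = L' f := by
  classical
  obtain ⟨T, hT⟩ := h
  obtain ⟨T', hT'⟩ := h'
  let p : MvPolynomial σ ℂ := ∑ d ∈ T ∪ T', MvPolynomial.monomial d (coeff d f)
  have hcoeff : ∀ d ∈ T ∪ T', coeff d f = coeff d (p : MvPowerSeries σ ℂ) := by
    intro d hd
    rw [MvPolynomial.coeff_coe, MvPolynomial.coeff_sum]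
    simp only [MvPolynomial.coeff_monomial]
    rw [Finset.sum_ite_eq' (T ∪ T') d, if_pos hd]
  rw [hT f p fun d hd => hcoeff d (Finset.mem_union_left _ hd),
    hT' f p fun d hd => hcoeff d (Finset.mem_union_right _ hd), hp]

theorem coeff_mul_eq_zero_of_le {τ : Type*} {e : τ →₀ ℕ} {g : MvPowerSeries τ ℂ}
    (hg : ∀ e' ≤ e, coeff e' g = 0) (h : MvPowerSeries τ ℂ) :
    ∀ e' ≤ e, coeff e' (g * h) = 0 := by
  classical
  intro e' he'
  rw [coeff_mul]
  refine Finset.sum_eq_zero fun p hp => ?_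
  rw [hg _ ((Finset.HasAntidiagonal.antidiagonal.fst_le hp).trans he'), zero_mul]

/-- The chain rule `∂_v (f ∘ a) = ∑_n ∂_v a_n · (∂_n f) ∘ a`, coefficient by coefficient: for a
given coefficient only finitely many `n` matter. -/
theorem coeff_pderiv_subst {σ τ : Type*} {a : σ → MvPowerSeries τ ℂ} (ha : HasSubst a) (v : τ)
    (e : τ →₀ ℕ) (S : Finset σ) (hS : ∀ n ∉ S, ∀ e' ≤ e, coeff e' (pderiv ℂ v (a n)) = 0)
    (f : MvPowerSeries σ ℂ) :
    coeff e (pderiv ℂ v (subst a f)) =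
      ∑ n ∈ S, coeff e (pderiv ℂ v (a n) * subst a (pderiv ℂ n f)) := by
  classical
  refine DependsFinitely.ext (L := fun f => coeff e (pderiv ℂ v (subst a f)))
    (L' := fun f => ∑ n ∈ S, coeff e (pderiv ℂ v (a n) * subst a (pderiv ℂ n f))) ?_ ?_ ?_ f
  · simp only [coeff_pderiv]
    exact (DependsFinitely.coeff_subst ha _).mul (.const _)
  · refine DependsFinitely.sum S fun n _ => ?_
    simp only [coeff_mul]
    refine DependsFinitely.sum _ fun p _ => (DependsFinitely.const _).mul ?_
    exact (DependsFinitely.coeff_subst ha p.2).comp_pderiv n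
  · intro p
    have key : ∀ p : MvPolynomial σ ℂ, ∀ e' ≤ e, coeff e' (pderiv ℂ v (MvPolynomial.aeval a p) -
        ∑ n ∈ S, pderiv ℂ v (a n) * MvPolynomial.aeval a (MvPolynomial.pderiv n p)) = 0 := by
      intro p
      induction p using MvPolynomial.induction_on with
      | C c =>
        intro e' _
        have : (MvPolynomial.aeval a (MvPolynomial.C c) : MvPowerSeries τ ℂ) = C c := by
          rw [MvPolynomial.aeval_C]; rfl
        rw [this, pderiv_C]
        simp
      | add p q hp hq =>
        intro e' he'
        have := congrArg₂ (· + ·) (hp e' he') (hq e' he')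
        simp only [← map_add, add_zero] at this
        rw [← this]
        congr 1
        simp only [map_add, mul_add, Finset.sum_add_distrib]
        ring
      | mul_X p m hp =>
        intro e' he'
        have h1 := coeff_mul_eq_zero_of_le hp (a m) e' he'
        have h2 : ∀ e' ≤ e, coeff e' (pderiv ℂ v (a m) - if m ∈ S then pderiv ℂ v (a m) else 0)
            = 0 := by
          intro e' he'
          split_ifs with hm
          · simp
          · simpa using hS m hm e' he'
        have h3 := coeff_mul_eq_zero_of_le h2 (MvPolynomial.aeval a p) e' he'
        have h4 : ∑ n ∈ S, pderiv ℂ v (a n) *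
              MvPolynomial.aeval a (MvPolynomial.pderiv n (p * MvPolynomial.X m)) =
            (∑ n ∈ S, pderiv ℂ v (a n) * MvPolynomial.aeval a (MvPolynomial.pderiv n p)) * a m +
              (if m ∈ S then pderiv ℂ v (a m) else 0) * MvPolynomial.aeval a p := by
          rw [Finset.sum_mul, ← Finset.sum_ite_eq' S m fun n => pderiv ℂ v (a n),
            Finset.sum_mul, ← Finset.sum_add_distrib]
          refine Finset.sum_congr rfl fun n _ => ?_
          rw [Derivation.leibniz, MvPolynomial.pderiv_X]
          by_cases hnm : n = m
          · subst hnm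
            simp
            ring
          · simp [hnm, Ne.symm hnm]
            ring
        rw [h4]
        have h5 : pderiv ℂ v (MvPolynomial.aeval a (p * MvPolynomial.X m)) =
            pderiv ℂ v (MvPolynomial.aeval a p) * a m +
              pderiv ℂ v (a m) * MvPolynomial.aeval a p := by
          rw [map_mul, MvPolynomial.aeval_X, Derivation.leibniz]
          simp only [smul_eq_mul]
          ring
        rw [h5]
        have := congrArg₂ (· + ·) h1 h3
        simp only [← map_add, add_zero] at this
        rw [← this]
        congr 1
        ring
    have := key p e le_rfl
    rw [map_sub, sub_eq_zero, map_sum] at this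
    simpa only [pderiv_coe, subst_coe] using this

/-! ### Expansion in powers of `z = λ⁻¹` -/

/-- A series in the times and `z`, as a power series in `z` whose coefficients are series in the
times. -/
def zexp (σ : Type) : FnZ σ ≃ₐ[ℂ] PowerSeries (MvPowerSeries σ ℂ) :=
  (renameEquiv ℂ (Equiv.optionEquivSumPUnit.{0} σ).symm).trans (optionEquivLeft σ ℂ)

variable {σ : Type}

theorem coeff_coeff_zexp (G : FnZ σ) (w : ℕ) (β : σ →₀ ℕ) :
    coeff β (PowerSeries.coeff w (zexp σ G)) = coeff (β.sumElim (Finsupp.single () w)) G := by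
  rw [zexp, AlgEquiv.trans_apply, coeff_coeff_optionEquivLeft]
  have h := coeff_embDomain_rename (Equiv.optionEquivSumPUnit.{0} σ).symm.toEmbedding G
    (β.sumElim (Finsupp.single () w))
  have h2 : (β.sumElim (Finsupp.single () w)).embDomain
      (Equiv.optionEquivSumPUnit.{0} σ).symm.toEmbedding = β.optionElim w := by
    ext i
    obtain ⟨j, rfl⟩ := (Equiv.optionEquivSumPUnit.{0} σ).symm.surjective i
    refine (Finsupp.embDomain_apply_self _ _ _).trans ?_
    rcases j with j | j <;> simp
  rw [h2] at h
  exact h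

theorem zexp_ext {G H : FnZ σ}
    (h : ∀ w, PowerSeries.coeff w (zexp σ G) = PowerSeries.coeff w (zexp σ H)) : G = H :=
  (zexp σ).injective (PowerSeries.ext h)

@[simp]
theorem zexp_zvar : zexp σ (zvar σ) = PowerSeries.X := by
  rw [zexp, AlgEquiv.trans_apply, zvar]
  have : renameEquiv ℂ (Equiv.optionEquivSumPUnit.{0} σ).symm (X (Sum.inr ())) = X none := by
    change rename _ _ = _
    rw [rename_X]; rfl
  rw [this, optionEquivLeft_X_none]

@[simp]
theorem zexp_C (c : ℂ) : zexp σ (C c) = PowerSeries.C (C c) := by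
  rw [zexp, AlgEquiv.trans_apply]
  have : renameEquiv ℂ (Equiv.optionEquivSumPUnit.{0} σ).symm (C c) = C c := by
    change rename _ _ = _
    rw [rename_C]
  rw [this, optionEquivLeft_C]

theorem zexp_X_inl (n : σ) : zexp σ (X (Sum.inl n)) = PowerSeries.C (X n) := by
  rw [zexp, AlgEquiv.trans_apply]
  have : renameEquiv ℂ (Equiv.optionEquivSumPUnit.{0} σ).symm (X (Sum.inl n)) = X (some n) := by
    change rename _ _ = _
    rw [rename_X]; rfl
  rw [this, optionEquivLeft_X_some]

theorem coeff_zexp_pderiv_inl (n : σ) (G : FnZ σ) (w : ℕ) :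
    PowerSeries.coeff w (zexp σ (pderiv ℂ (Sum.inl n) G)) =
      pderiv ℂ n (PowerSeries.coeff w (zexp σ G)) := by
  classical
  ext β
  rw [coeff_coeff_zexp, coeff_pderiv, coeff_pderiv, coeff_coeff_zexp]
  congr 2
  congr 1
  ext (i | i) <;> simp [Finsupp.single_apply]

theorem coeff_zexp_pderiv_inr (G : FnZ σ) (w : ℕ) :
    PowerSeries.coeff w (zexp σ (pderiv ℂ (Sum.inr ()) G)) =
      ((w : ℂ) + 1) • PowerSeries.coeff (w + 1) (zexp σ G) := by
  ext β
  rw [coeff_coeff_zexp, coeff_pderiv, map_smul, coeff_coeff_zexp, smul_eq_mul, mul_comm]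
  congr 2
  · simp
  · congr 1
    ext (i | i) <;> simp

/-! ### The shift `f ↦ f(t + c[λ⁻¹])` -/

/-- The substitution that defines `shiftBy`. -/
abbrev shiftVar (s : ℕ → σ) (c : ℂ) (n : ℕ) : FnZ σ :=
  X (Sum.inl (s n)) + C (c / (2 * n + 1)) * zvar σ ^ (2 * n + 1)

/-- The shift as an algebra homomorphism. -/
def shiftHom (s : ℕ → σ) (hs : Function.Injective s) (c : ℂ) : Fn →ₐ[ℂ] FnZ σ :=
  substAlgHom (hasSubst_shift s hs c)

theorem shiftHom_apply (s : ℕ → σ) (hs : Function.Injective s) (c : ℂ) (f : Fn) :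
    shiftHom s hs c f = shiftBy s c f := by
  rw [shiftHom, substAlgHom_apply]; rfl

theorem pderiv_inl_shiftVar (s : ℕ → σ) (hs : Function.Injective s) (c : ℂ) (m n : ℕ) :
    pderiv ℂ (Sum.inl (s m)) (shiftVar s c n) = if n = m then 1 else 0 := by
  classical
  have hz : pderiv ℂ (Sum.inl (s m)) (zvar σ) = 0 := pderiv_X_of_ne (by simp)
  rw [map_add, Derivation.leibniz, pderiv_C, Derivation.leibniz_pow, hz]
  split_ifs with h
  · subst h
    rw [pderiv_X_self]
    simp
  · rw [pderiv_X_of_ne (by simpa using fun h' => h (hs h'))]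
    simp

theorem pderiv_inr_shiftVar (s : ℕ → σ) (c : ℂ) (n : ℕ) :
    pderiv ℂ (Sum.inr ()) (shiftVar s c n) = C c * zvar σ ^ (2 * n) := by
  have hz : pderiv ℂ (Sum.inr ()) (zvar σ) = 1 := pderiv_X_self
  rw [map_add, Derivation.leibniz, pderiv_C, Derivation.leibniz_pow, hz,
    pderiv_X_of_ne (by simp)]
  simp only [smul_eq_mul, mul_one, mul_zero, zero_add, add_zero, add_tsub_cancel_right]
  have h0 : (2 * (n : ℂ) + 1) ≠ 0 := by
    exact_mod_cast (show (2 * n + 1 : ℕ) ≠ 0 by omega)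
  have : (C (c / (2 * n + 1)) : FnZ σ) * (2 * (n : FnZ σ) + 1) = C c := by
    rw [show (2 * (n : FnZ σ) + 1) = C (2 * (n : ℂ) + 1) by
        rw [map_add, map_mul, map_natCast, map_one, map_ofNat], ← map_mul,
      div_mul_cancel₀ _ h0]
  rw [← this, nsmul_eq_mul]
  push_cast
  ring

theorem pderiv_inl_shiftBy (s : ℕ → σ) (hs : Function.Injective s) (c : ℂ) (m : ℕ) (f : Fn) :
    pderiv ℂ (Sum.inl (s m)) (shiftBy s c f) = shiftBy s c (dt m f) := by
  ext e
  rw [shiftBy, coeff_pderiv_subst (hasSubst_shift s hs c) _ e {m}]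
  · rw [Finset.sum_singleton, pderiv_inl_shiftVar s hs, if_pos rfl, one_mul]
    rfl
  · intro n hn e' _
    rw [pderiv_inl_shiftVar s hs, if_neg (by simpa using hn), map_zero]

theorem pderiv_inl_shiftBy_of_ne (s : ℕ → σ) (hs : Function.Injective s) (c : ℂ) (v : σ)
    (hv : ∀ n, s n ≠ v) (f : Fn) :
    pderiv ℂ (Sum.inl v) (shiftBy s c f) = 0 := by
  ext e
  rw [shiftBy, coeff_pderiv_subst (hasSubst_shift s hs c) _ e ∅]
  · simp
  · intro n _ e' _
    have hz : pderiv ℂ (Sum.inl v) (zvar σ) = 0 := pderiv_X_of_ne (by simp)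
    rw [map_add, Derivation.leibniz, pderiv_C, Derivation.leibniz_pow, hz,
      pderiv_X_of_ne (by simpa using hv n)]
    simp

/-- The recursion for the coefficients of `f(t + c[λ⁻¹])` in powers of `z = λ⁻¹`; it comes from
`∂_z f(t + c[λ⁻¹]) = c ∑ z^{2n} f_{t_{2n+1}}(t + c[λ⁻¹])`. -/
theorem coeff_zexp_shiftBy_succ (s : ℕ → σ) (hs : Function.Injective s) (c : ℂ) (f : Fn) (w : ℕ) :
    ((w : ℂ) + 1) • PowerSeries.coeff (w + 1) (zexp σ (shiftBy s c f)) =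
      c • ∑ n ∈ Finset.range (w / 2 + 1),
        PowerSeries.coeff (w - 2 * n) (zexp σ (shiftBy s c (dt n f))) := by
  rw [← coeff_zexp_pderiv_inr]
  ext β
  rw [coeff_coeff_zexp, shiftBy, coeff_pderiv_subst (hasSubst_shift s hs c) _ _
    (Finset.range (w / 2 + 1)), map_smul, map_sum, Finset.smul_sum]
  · refine Finset.sum_congr rfl fun n hn => ?_
    have hn' : 2 * n ≤ w := by
      have := Finset.mem_range.mp hn
      omega
    rw [pderiv_inr_shiftVar, ← coeff_coeff_zexp, map_mul (zexp σ), map_mul (zexp σ), zexp_C,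
      map_pow, zexp_zvar,
      mul_assoc, PowerSeries.coeff_C_mul, PowerSeries.coeff_X_pow_mul', if_pos hn', coeff_C_mul]
    rfl
  · intro n hn e' he'
    classical
    rw [pderiv_inr_shiftVar, coeff_C_mul, zvar, X_pow_eq, coeff_monomial, if_neg, mul_zero]
    rintro rfl
    have := he' (Sum.inr ())
    simp at this hn
    omega

/-- A function of one set of times, as a function of the times `σ`. -/
def emb (s : ℕ → σ) (f : Fn) : MvPowerSeries σ ℂ := subst (fun n => (X (s n) : MvPowerSeries σ ℂ)) f

theorem hasSubst_emb (s : ℕ → σ) (hs : Function.Injective s) :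
    HasSubst (fun n => (X (s n) : MvPowerSeries σ ℂ)) where
  const_coeff n := by simp
  coeff_zero d := by
    classical
    apply Set.Subsingleton.finite
    intro a ha b hb
    simp only [coeff_X, ne_eq, ite_eq_right_iff, one_ne_zero, imp_false, not_not,
      Set.mem_ofPred_eq] at ha hb
    have := ha.symm.trans hb
    rw [Finsupp.single_eq_single_iff] at this
    simpa [hs.eq_iff] using this

/-- `emb` as an algebra homomorphism. -/
def embHom (s : ℕ → σ) (hs : Function.Injective s) : Fn →ₐ[ℂ] MvPowerSeries σ ℂ :=
  substAlgHom (hasSubst_emb s hs)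

theorem embHom_apply (s : ℕ → σ) (hs : Function.Injective s) (f : Fn) :
    embHom s hs f = emb s f := by
  rw [embHom, substAlgHom_apply]; rfl

theorem pderiv_emb (s : ℕ → σ) (hs : Function.Injective s) (m : ℕ) (f : Fn) :
    pderiv ℂ (s m) (emb s f) = emb s (dt m f) := by
  classical
  ext e
  rw [emb, coeff_pderiv_subst (hasSubst_emb s hs) _ e {m}]
  · rw [Finset.sum_singleton, pderiv_X_self, one_mul]
    rfl
  · intro n hn e' _
    rw [pderiv_X_of_ne, map_zero]
    exact fun h => hn (by simpa using hs h)

theorem pderiv_emb_of_ne (s : ℕ → σ) (hs : Function.Injective s) (v : σ) (hv : ∀ n, s n ≠ v)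
    (f : Fn) : pderiv ℂ v (emb s f) = 0 := by
  ext e
  rw [emb, coeff_pderiv_subst (hasSubst_emb s hs) _ e ∅]
  · simp
  · intro n _ e' _
    rw [pderiv_X_of_ne (hv n), map_zero]

theorem emb_id (f : Fn) : emb id f = f := congrFun subst_self f

theorem coeff_zero_zexp_shiftBy (s : ℕ → σ) (hs : Function.Injective s) (c : ℂ) (f : Fn) :
    PowerSeries.coeff 0 (zexp σ (shiftBy s c f)) = emb s f := by
  ext β
  rw [coeff_coeff_zexp]
  refine DependsFinitely.ext (L := fun f => coeff _ (subst (shiftVar s c) f))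
    (L' := fun f => coeff β (emb s f))
    (DependsFinitely.coeff_subst (hasSubst_shift s hs c) _)
    (DependsFinitely.coeff_subst (hasSubst_emb s hs) _) (fun p => ?_) f
  rw [← coeff_coeff_zexp, emb, subst_coe, subst_coe, PowerSeries.coeff_zero_eq_constantCoeff_apply]
  congr 1
  induction p using MvPolynomial.induction_on with
  | C a =>
    rw [MvPolynomial.aeval_C, MvPolynomial.aeval_C]
    change PowerSeries.constantCoeff (zexp σ (C a)) = C a
    rw [zexp_C, PowerSeries.constantCoeff_C]
  | add p q hp hq => simp only [map_add, hp, hq]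
  | mul_X p n hp =>
    simp only [map_mul, hp, MvPolynomial.aeval_X, map_add, zexp_X_inl, PowerSeries.constantCoeff_C,
      zexp_zvar, map_pow, PowerSeries.constantCoeff_X]
    simp

/-! ### Derivatives and eigenfunctions -/

/-- `∂/∂t_{2n+1}` as a derivation. -/
abbrev dtDer (n : ℕ) : Derivation ℂ Fn Fn := pderiv ℂ n

theorem dt_eq (n : ℕ) (f : Fn) : dt n f = dtDer n f := rfl

@[simp]
theorem dt_add (n : ℕ) (f g : Fn) : dt n (f + g) = dt n f + dt n g := map_add (dtDer n) f g

@[simp]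
theorem dt_sub (n : ℕ) (f g : Fn) : dt n (f - g) = dt n f - dt n g := map_sub (dtDer n) f g

@[simp]
theorem dt_neg (n : ℕ) (f : Fn) : dt n (-f) = -dt n f := map_neg (dtDer n) f

theorem dt_sum (n : ℕ) {ι : Type*} (s : Finset ι) (f : ι → Fn) :
    dt n (∑ i ∈ s, f i) = ∑ i ∈ s, dt n (f i) := map_sum (dtDer n) f s

theorem dt_mul (n : ℕ) (f g : Fn) : dt n (f * g) = dt n f * g + f * dt n g := by
  rw [dt_eq, Derivation.leibniz, smul_eq_mul, smul_eq_mul, dt_eq, dt_eq]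
  ring

theorem dt_comm (m n : ℕ) (f : Fn) : dt m (dt n f) = dt n (dt m f) := by
  ext β
  rw [dt, dt, dt, dt, coeff_pderiv, coeff_pderiv, coeff_pderiv, coeff_pderiv, add_right_comm]
  rcases eq_or_ne m n with rfl | h
  · rfl
  · simp [h, h.symm]
    ring

theorem dx_succ (l : ℕ) (f : Fn) : dx (l + 1) f = dt 0 (dx l f) :=
  Function.iterate_succ_apply' _ _ _

@[simp]
theorem dx_zero_left (f : Fn) : dx 0 f = f := rfl

theorem dx_one_left (f : Fn) : dx 1 f = dt 0 f := rfl

theorem dx_dx (k l : ℕ) (f : Fn) : dx k (dx l f) = dx (k + l) f :=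
  (Function.iterate_add_apply _ _ _ _).symm

theorem dt_dx (n l : ℕ) (f : Fn) : dt n (dx l f) = dx l (dt n f) := by
  induction l with
  | zero => rfl
  | succ l ih => rw [dx_succ, dt_comm, ih, dx_succ]

/-- `∂_x^l` as a linear map. -/
def dxHom (l : ℕ) : Fn →ₗ[ℂ] Fn where
  toFun := dx l
  map_add' f g := by
    induction l with
    | zero => rfl
    | succ l ih => rw [dx_succ, ih, dt_add, dx_succ, dx_succ]
  map_smul' c f := by
    induction l with
    | zero => rfl
    | succ l ih => rw [dx_succ, ih, dx_succ]; exact (dtDer 0).map_smul c _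

theorem IsEigen.dx {f : Fn} (hf : IsEigen f) (l : ℕ) : IsEigen (dx l f) := by
  intro n
  rw [dt_dx, hf n, dx_dx, dx_dx, add_comm]

/-- The coefficient of `z^w`. -/
abbrev zcoeff (w : ℕ) (G : FnZ σ) : MvPowerSeries σ ℂ := PowerSeries.coeff w (zexp σ G)

theorem zexp_shiftBy_zero (s : ℕ → σ) (hs : Function.Injective s) (f : Fn) :
    zexp σ (shiftBy s 0 f) = PowerSeries.C (emb s f) := by
  ext1 w
  rw [PowerSeries.coeff_C]
  cases w with
  | zero => rw [if_pos rfl, coeff_zero_zexp_shiftBy s hs]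
  | succ w =>
    have h := coeff_zexp_shiftBy_succ s hs 0 f w
    rw [zero_smul] at h
    rw [if_neg w.succ_ne_zero]
    refine (smul_eq_zero.mp h).resolve_left ?_
    exact_mod_cast w.succ_ne_zero

/-- The coefficients `1, -2ε, 2, -2ε, …` of the expansion of `(1 - εz∂)(1 + εz∂)⁻¹` satisfy the
recursion `coeff_zexp_shiftBy_succ`. -/
theorem sum_shiftCoeff {ε : ℂ} (hε : ε ^ 2 = 1) (w : ℕ) :
    ∑ n ∈ Finset.range (w / 2 + 1), (if w - 2 * n = 0 then 1 else 2 * (-ε) ^ (w - 2 * n)) =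
      ((w : ℂ) + 1) * (-ε) ^ w := by
  induction w using Nat.twoStepInduction with
  | zero => simp
  | one => norm_num
  | more w ih _ =>
    rw [show (w + 2) / 2 + 1 = (w / 2 + 1) + 1 by omega, Finset.sum_range_succ']
    have : ∀ n, w + 2 - 2 * (n + 1) = w - 2 * n := by intro n; omega
    simp only [this, ih]
    rw [mul_zero, Nat.sub_zero, if_neg (by omega), pow_add, neg_sq, hε]
    push_cast
    ring

/-- The shift `t ↦ t - 2[z]` acts on eigenfunctions of `∂` as `(1 - z∂)(1 + z∂)⁻¹`. -/
theorem zcoeff_shiftBy_eigen (s : ℕ → σ) (hs : Function.Injective s) {ε : ℂ} (hε : ε ^ 2 = 1)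
    (w : ℕ) : ∀ {f : Fn}, IsEigen f → zcoeff w (shiftBy s (-2 * ε) f) =
      (if w = 0 then (1 : ℂ) else 2 * (-ε) ^ w) • emb s (dx w f) := by
  induction w using Nat.strong_induction_on with
  | _ w ih =>
    intro f hf
    cases w with
    | zero => rw [if_pos rfl, one_smul]; exact coeff_zero_zexp_shiftBy s hs _ f
    | succ w =>
      have h := coeff_zexp_shiftBy_succ s hs (-2 * ε) f w
      have h2 : ∀ n ∈ Finset.range (w / 2 + 1),
          PowerSeries.coeff (w - 2 * n) (zexp σ (shiftBy s (-2 * ε) (dt n f))) =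
          (if w - 2 * n = 0 then (1 : ℂ) else 2 * (-ε) ^ (w - 2 * n)) • emb s (dx (w + 1) f) := by
        intro n hn
        have hn' := Finset.mem_range.mp hn
        rw [hf n]
        refine (ih (w - 2 * n) (by omega) (hf.dx _)).trans ?_
        rw [dx_dx, show w - 2 * n + (2 * n + 1) = w + 1 by omega]
      rw [Finset.sum_congr rfl h2, ← Finset.sum_smul, sum_shiftCoeff hε] at h
      have hw : ((w : ℂ) + 1) ≠ 0 := by exact_mod_cast w.succ_ne_zero
      rw [if_neg w.succ_ne_zero]
      apply (smul_right_injective _ hw)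
      refine h.trans ?_
      simp only [smul_smul]
      congr 1
      ring

/-- The series `(1 + εz∂)⁻¹ f = ∑ (-εz)^w f^{(w)}`, for an eigenfunction `f`; it is the mean of `f`
and its shift. -/
def resolvent (s : ℕ → σ) (ε : ℂ) (f : Fn) : FnZ σ :=
  C (1 / 2) * (shiftBy s (-2 * ε) f + shiftBy s 0 f)

theorem shiftBy_eq_resolvent (s : ℕ → σ) (ε : ℂ) (f : Fn) :
    shiftBy s (-2 * ε) f = 2 * resolvent s ε f - shiftBy s 0 f := by
  have : (2 : FnZ σ) * C (1 / 2) = 1 := by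
    rw [← map_ofNat (C : ℂ →+* FnZ σ) 2, ← map_mul]
    norm_num
  rw [resolvent, ← mul_assoc, this]
  ring

theorem zcoeff_resolvent (s : ℕ → σ) (hs : Function.Injective s) {ε : ℂ} (hε : ε ^ 2 = 1)
    {f : Fn} (hf : IsEigen f) (w : ℕ) :
    zcoeff w (resolvent s ε f) = (-ε) ^ w • emb s (dx w f) := by
  rw [resolvent, zcoeff, map_mul (zexp σ), zexp_C, PowerSeries.coeff_C_mul, map_add, map_add,
    zexp_shiftBy_zero s hs, PowerSeries.coeff_C]
  rw [show PowerSeries.coeff w (zexp σ (shiftBy s (-2 * ε) f)) = _ from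
    zcoeff_shiftBy_eigen s hs hε w hf, ← smul_eq_C_mul, smul_add, smul_smul]
  split_ifs with h
  · subst h
    rw [dx_zero_left, ← add_smul]
    norm_num
  · rw [smul_zero, add_zero]
    congr 1
    ring

/-- `(1 + εz∂)` inverts the resolvent. -/
theorem resolvent_add_deriv (s : ℕ → σ) (hs : Function.Injective s) {ε : ℂ} (hε : ε ^ 2 = 1)
    {f : Fn} (hf : IsEigen f) :
    C ε * zvar σ * pderiv ℂ (Sum.inl (s 0)) (resolvent s ε f) =
      shiftBy s 0 f - resolvent s ε f := by
  apply zexp_ext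
  intro w
  rw [map_mul (zexp σ), map_mul (zexp σ), zexp_C, zexp_zvar, map_sub, map_sub,
    zexp_shiftBy_zero s hs, mul_assoc, PowerSeries.coeff_C_mul, PowerSeries.coeff_C, ← smul_eq_C_mul]
  rw [show PowerSeries.coeff w (zexp σ (resolvent s ε f)) = _ from zcoeff_resolvent s hs hε hf w]
  cases w with
  | zero => simp
  | succ w =>
    rw [PowerSeries.coeff_succ_X_mul, coeff_zexp_pderiv_inl, if_neg w.succ_ne_zero,
      show PowerSeries.coeff w (zexp σ (resolvent s ε f)) = _ from zcoeff_resolvent s hs hε hf w,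
      Derivation.map_smul, pderiv_emb s hs, ← dx_succ, smul_smul, zero_sub, ← neg_smul, pow_succ]
    congr 1
    ring

theorem sum_range_ite_le (m j : ℕ) (h : (j + 1) / 2 ≤ m) :
    ∑ n ∈ Finset.range m, (if 2 * n + 1 ≤ j then 1 else 0) = (j + 1) / 2 := by
  rw [Finset.sum_boole]
  have : (Finset.range m).filter (fun n => 2 * n + 1 ≤ j) = Finset.range ((j + 1) / 2) := by
    ext n
    simp only [Finset.mem_filter, Finset.mem_range]
    omega
  rw [this, Finset.card_range]
  rfl

/-- A flow applied to `∑ f^{(j)} g^{(v-1-j)}` in terms of the products `f^{(j)} g^{(v+2n-j)}`: the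
multiplicity of each is the number of ways in which it is reached from either factor. -/
theorem dt_sepRes_sum {f g : Fn} (hf : IsEigen f) (hg : IsEigen g) (n v : ℕ) :
    dt n (∑ j ∈ Finset.range v, dx j f * dx (v - 1 - j) g) =
      ∑ j ∈ Finset.range (v + 2 * n + 1),
        ((if 2 * n + 1 ≤ j then 1 else 0) + (if 2 * n + 1 ≤ v + 2 * n - j then 1 else 0) : ℕ) •
          (dx j f * dx (v + 2 * n - j) g) := by
  simp only [dt_sum, dt_mul, add_smul, Finset.sum_add_distrib]
  congr 1
  · rw [show v + 2 * n + 1 = (2 * n + 1) + v by ring, Finset.sum_range_add,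
      Finset.sum_eq_zero (s := Finset.range (2 * n + 1)), zero_add]
    · refine Finset.sum_congr rfl fun j hj => ?_
      have := Finset.mem_range.mp hj
      rw [if_pos (by omega), one_smul, dt_dx, hf n, dx_dx, add_comm j,
        show v + 2 * n - (2 * n + 1 + j) = v - 1 - j by omega]
    · intro j hj
      have := Finset.mem_range.mp hj
      rw [if_neg (by omega), zero_smul]
  · rw [show v + 2 * n + 1 = v + (2 * n + 1) by ring, Finset.sum_range_add,
      Finset.sum_eq_zero (s := Finset.range (2 * n + 1)), add_zero]
    · refine Finset.sum_congr rfl fun j hj => ?_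
      have := Finset.mem_range.mp hj
      rw [if_pos (by omega), one_smul, dt_dx, hg n, dx_dx,
        show v - 1 - j + (2 * n + 1) = v + 2 * n - j by omega]
    · intro j hj
      have := Finset.mem_range.mp hj
      rw [if_neg (by omega), zero_smul]

theorem sepRes_odd (n : ℕ) (f g : Fn) : sepRes (2 * n + 1) f g =
    ∑ l ∈ Finset.range (2 * n + 1), (-1 : ℤ) ^ l • (dx l f * dx (2 * n - l) g) := by
  rw [sepRes_eq]
  refine Finset.sum_congr rfl fun l hl => ?_
  have hl' := Finset.mem_range.mp hl
  rw [show 2 * n + 1 - 1 - l = 2 * n - l by omega, zsmul_eq_mul]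
  have : (-1 : Fn) ^ (2 * n - l) = (-1) ^ l := by
    rw [neg_one_pow_eq_pow_mod_two, neg_one_pow_eq_pow_mod_two (n := l)]
    congr 1
    omega
  rw [this]
  push_cast
  rfl

/-- The combinatorial identity behind the shift of a potential. -/
theorem sum_dt_potential {f g G : Fn} (hf : IsEigen f) (hg : IsEigen g)
    (hG : ∀ n, dt n G = sepRes (2 * n + 1) f g) (w : ℕ) :
    2 • ∑ n ∈ Finset.range ((w + 1) / 2),
        dt n (∑ j ∈ Finset.range (w - 2 * n), dx j f * dx (w - 2 * n - 1 - j) g) +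
      (if w % 2 = 0 then dt (w / 2) G else 0) =
    (w + 1) • ∑ j ∈ Finset.range (w + 1), dx j f * dx (w - j) g := by
  have h1 : ∀ n ∈ Finset.range ((w + 1) / 2),
      dt n (∑ j ∈ Finset.range (w - 2 * n), dx j f * dx (w - 2 * n - 1 - j) g) =
      ∑ j ∈ Finset.range (w + 1),
        ((if 2 * n + 1 ≤ j then 1 else 0) + (if 2 * n + 1 ≤ w - j then 1 else 0) : ℕ) •
          (dx j f * dx (w - j) g) := by
    intro n hn
    have hn' := Finset.mem_range.mp hn
    rw [dt_sepRes_sum hf hg, show w - 2 * n + 2 * n = w by omega]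
  have h2 : (if w % 2 = 0 then dt (w / 2) G else 0) =
      ∑ j ∈ Finset.range (w + 1),
        (if w % 2 = 0 then (-1 : ℤ) ^ j else 0) • (dx j f * dx (w - j) g) := by
    split_ifs with hw
    · rw [hG, sepRes_odd, show 2 * (w / 2) = w by omega]
    · simp
  rw [Finset.sum_congr rfl h1, Finset.sum_comm, h2, Finset.smul_sum, ← Finset.sum_add_distrib,
    Finset.smul_sum]
  refine Finset.sum_congr rfl fun j hj => ?_
  have hj' := Finset.mem_range.mp hj
  rw [← Finset.sum_smul, Finset.sum_add_distrib, sum_range_ite_le _ _ (by omega),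
    sum_range_ite_le _ _ (by omega), ← natCast_zsmul, ← natCast_zsmul, smul_smul, ← add_smul,
    ← natCast_zsmul]
  congr 1
  rcases Nat.even_or_odd' j with ⟨i, rfl | rfl⟩
  · rw [pow_mul, neg_one_sq, one_pow]
    split_ifs <;> omega
  · rw [pow_succ, pow_mul, neg_one_sq, one_pow]
    split_ifs <;> omega

/-- The coefficients in `z` of the shifted potential are those of `G - 2εz (1 + εz∂)⁻¹f · (1 +
εz∂)⁻¹g`. -/
theorem zcoeff_shiftBy_potential (s : ℕ → σ) (hs : Function.Injective s) {ε : ℂ} (hε : ε ^ 2 = 1)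
    {f g G : Fn} (hf : IsEigen f) (hg : IsEigen g)
    (hG : ∀ n, dt n G = sepRes (2 * n + 1) f g) (w : ℕ) :
    zcoeff (w + 1) (shiftBy s (-2 * ε) G) =
      (-2 * ε * (-ε) ^ w) • emb s (∑ j ∈ Finset.range (w + 1), dx j f * dx (w - j) g) := by
  induction w using Nat.strong_induction_on with
  | _ w ih =>
    have h := coeff_zexp_shiftBy_succ s hs (-2 * ε) G w
    have hw : ((w : ℂ) + 1) ≠ 0 := by exact_mod_cast w.succ_ne_zero
    have hS : ∀ n, PowerSeries.coeff (w - 2 * n) (zexp σ (shiftBy s (-2 * ε) (dt n G))) =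
        pderiv ℂ (s n) (zcoeff (w - 2 * n) (shiftBy s (-2 * ε) G)) := by
      intro n
      rw [← pderiv_inl_shiftBy s hs, coeff_zexp_pderiv_inl]
    have hmain : ∑ n ∈ Finset.range (w / 2 + 1),
        PowerSeries.coeff (w - 2 * n) (zexp σ (shiftBy s (-2 * ε) (dt n G))) =
        (-ε) ^ w • emb s ((w + 1) • ∑ j ∈ Finset.range (w + 1), dx j f * dx (w - j) g) := by
      have hodd : ∀ n ∈ Finset.range ((w + 1) / 2),
          PowerSeries.coeff (w - 2 * n) (zexp σ (shiftBy s (-2 * ε) (dt n G))) =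
          (-ε) ^ w • embHom s hs (2 • dt n (∑ j ∈ Finset.range (w - 2 * n),
            dx j f * dx (w - 2 * n - 1 - j) g)) := by
        intro n hn
        have hn' := Finset.mem_range.mp hn
        have hj : w - 2 * n = (w - 2 * n - 1) + 1 := by omega
        rw [hS, hj, ih _ (by omega), Derivation.map_smul, pderiv_emb s hs, map_nsmul, embHom_apply,
          ← Nat.cast_smul_eq_nsmul ℂ, smul_smul, add_tsub_cancel_right]
        congr 1
        have hε2 : (-ε) ^ w = (-ε) ^ (w - 2 * n - 1) * (-ε) := by
          rw [← pow_succ, ← hj]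
          conv_lhs => rw [show w = (w - 2 * n) + 2 * n by omega]
          rw [pow_add, pow_mul (-ε) 2 n, neg_sq, hε, one_pow, mul_one]
        rw [hε2]
        push_cast
        ring
      rw [← sum_dt_potential hf hg hG, ← embHom_apply s hs, map_add, smul_add,
        Finset.smul_sum, map_sum, Finset.smul_sum, ← Finset.sum_congr rfl hodd]
      split_ifs with hpar
      · rw [show w / 2 + 1 = (w + 1) / 2 + 1 by omega, Finset.sum_range_succ]
        congr 1
        rw [hS, show w - 2 * ((w + 1) / 2) = 0 by omega, embHom_apply, ← pderiv_emb s hs,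
          zcoeff, coeff_zero_zexp_shiftBy s hs, show (w + 1) / 2 = w / 2 by omega]
        have : (-ε) ^ w = 1 := by
          rw [show w = 2 * (w / 2) by omega, pow_mul, neg_sq, hε, one_pow]
        rw [this, one_smul]
      · rw [show w / 2 + 1 = (w + 1) / 2 by omega]
        simp
    apply smul_right_injective _ hw
    refine h.trans ?_
    rw [hmain, ← embHom_apply s hs, map_nsmul, embHom_apply, ← Nat.cast_smul_eq_nsmul ℂ,
      smul_smul, smul_smul]
    beta_reduce
    rw [smul_smul]
    congr 1
    push_cast
    ring

/-- The shift of the potential `Ω(f, g)`: it changes by `-2εz` times the product of the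
resolvents. -/
theorem shiftBy_potential (s : ℕ → σ) (hs : Function.Injective s) {ε : ℂ} (hε : ε ^ 2 = 1)
    {f g G : Fn} (hf : IsEigen f) (hg : IsEigen g)
    (hG : ∀ n, dt n G = sepRes (2 * n + 1) f g) :
    shiftBy s (-2 * ε) G =
      shiftBy s 0 G - 2 * C ε * zvar σ * (resolvent s ε f * resolvent s ε g) := by
  apply zexp_ext
  intro w
  have hC : (2 : FnZ σ) * C ε = C (2 * ε) := by rw [map_mul, map_ofNat]
  rw [hC, map_sub, map_sub, zexp_shiftBy_zero s hs, map_mul (zexp σ), map_mul (zexp σ), zexp_C,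
    zexp_zvar, mul_assoc, PowerSeries.coeff_C_mul, PowerSeries.coeff_C, ← smul_eq_C_mul]
  cases w with
  | zero => rw [coeff_zero_zexp_shiftBy s hs]; simp
  | succ w =>
    rw [PowerSeries.coeff_succ_X_mul, map_mul (zexp σ), PowerSeries.coeff_mul,
      show PowerSeries.coeff (w + 1) (zexp σ (shiftBy s (-2 * ε) G)) = _ from
        zcoeff_shiftBy_potential s hs hε hf hg hG w, if_neg w.succ_ne_zero, zero_sub,
      Finset.Nat.sum_antidiagonal_eq_sum_range_succ_mk, ← embHom_apply s hs, map_sum,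
      Finset.smul_sum, Finset.smul_sum, ← Finset.sum_neg_distrib]
    refine Finset.sum_congr rfl fun j hj => ?_
    have hj' := Finset.mem_range.mp hj
    rw [show PowerSeries.coeff _ (zexp σ (resolvent s ε f)) = _ from
      zcoeff_resolvent s hs hε hf _, show PowerSeries.coeff _ (zexp σ (resolvent s ε g)) = _ from
      zcoeff_resolvent s hs hε hg _, map_mul, embHom_apply, embHom_apply, smul_mul_smul_comm,
      smul_smul, ← neg_smul, ← pow_add, show j + (w - j) = w by omega]
    congr 1
    ring

end

section

open MvPowerSeries Matrix

/-! ### Square roots of power series -/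

section Sqrt

variable {σ : Type*}

theorem isUnit_of_constantCoeff {F : MvPowerSeries σ ℂ} (hF : constantCoeff F ≠ 0) : IsUnit F :=
  isUnit_iff_constantCoeff.mpr (isUnit_iff_ne_zero.mpr hF)

theorem eq_of_sq_eq {F G : MvPowerSeries σ ℂ} (h : F ^ 2 = G ^ 2) (hF : constantCoeff F = 1)
    (hG : constantCoeff G = 1) : F = G := by
  have hu : IsUnit (F + G) := isUnit_of_constantCoeff (by rw [map_add, hF, hG]; norm_num)
  have : (F + G) * (F - G) = 0 := by linear_combination h
  exact sub_eq_zero.mp (hu.mul_right_eq_zero.mp this)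

theorem constantCoeff_fsqrt {τ : Type} {F : FnZ τ} (hF : constantCoeff F = 1) :
    constantCoeff (fsqrt F) = 1 := by
  have h0 : constantCoeff (F - 1) = 0 := by simp [hF]
  have hs : PowerSeries.HasSubst (F - 1) := PowerSeries.HasSubst.of_constantCoeff_zero h0
  have := PowerSeries.constantCoeff_subst_eq_zero h0
    (PowerSeries.binomialSeries ℂ (1 / 2 : ℚ) - 1)
    (by rw [map_sub, PowerSeries.binomialSeries_constantCoeff, map_one, sub_self])
  rw [PowerSeries.subst_sub hs, map_sub, sub_eq_zero] at this
  rw [fsqrt, this, ← PowerSeries.coe_substAlgHom hs, map_one, map_one]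

theorem fsqrt_eq {τ : Type} {F G : FnZ τ} (h : G ^ 2 = F) (hG : constantCoeff G = 1) :
    fsqrt F = G := by
  have hF : constantCoeff F = 1 := by rw [← h, map_pow, hG, one_pow]
  exact eq_of_sq_eq ((fsqrt_sq F hF).trans h.symm) (constantCoeff_fsqrt hF) hG

/-- Over `ℂ`, a series that does not vanish at the base point is a square: the binomial series of
its normalization, times a square root of the constant term. -/
theorem exists_sq_eq {F : MvPowerSeries σ ℂ} (hF : constantCoeff F ≠ 0) :
    ∃ G : MvPowerSeries σ ℂ, G ^ 2 = F := by
  obtain ⟨c, hc⟩ := IsAlgClosed.exists_pow_nat_eq (constantCoeff F) (n := 2) (by norm_num)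
  set F₁ := C (constantCoeff F)⁻¹ * F with hF₁
  have h0 : constantCoeff (F₁ - 1) = 0 := by
    rw [map_sub, hF₁, map_mul, constantCoeff_C, inv_mul_cancel₀ hF, map_one, sub_self]
  have hs : PowerSeries.HasSubst (F₁ - 1) := PowerSeries.HasSubst.of_constantCoeff_zero h0
  have h1 : PowerSeries.binomialSeries ℂ (1 / 2 : ℚ) ^ 2 = 1 + PowerSeries.X := by
    rw [sq, ← PowerSeries.binomialSeries_add]
    have := PowerSeries.binomialSeries_nat (R := ℚ) (A := ℂ) 1
    norm_num at this ⊢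
    exact this
  have h2 : (PowerSeries.binomialSeries ℂ (1 / 2 : ℚ)).subst (F₁ - 1) ^ 2 = F₁ := by
    rw [← PowerSeries.subst_pow hs, h1, PowerSeries.subst_add hs, PowerSeries.subst_X hs,
      ← PowerSeries.coe_substAlgHom hs, map_one]
    ring
  refine ⟨C c * (PowerSeries.binomialSeries ℂ (1 / 2 : ℚ)).subst (F₁ - 1), ?_⟩
  rw [mul_pow, h2, ← map_pow, hc, hF₁, ← mul_assoc, ← map_mul, mul_inv_cancel₀ hF, map_one,
    one_mul]

end Sqrt

/-! ### Rank one perturbations of a symmetric matrix -/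

section RankOne

variable {R ι : Type*} [CommRing R] [Fintype ι] [DecidableEq ι]

theorem det_sub_rankOne {G A : Matrix ι ι R} (h : G * A = 1) (c : R) (F : ι → R) :
    (Matrix.of fun i j => G i j - c * (F i * F j)).det =
      G.det * (1 - c * (F ⬝ᵥ A *ᵥ F)) := by
  have : (Matrix.of fun i j => G i j - c * (F i * F j)) =
      G * (1 + replicateCol Unit ((-c) • A *ᵥ F) * replicateRow Unit F) := by
    have h2 : G *ᵥ ((-c) • A *ᵥ F) = (-c) • F := by
      rw [mulVec_smul, mulVec_mulVec, h, one_mulVec]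
    rw [mul_add, mul_one, ← Matrix.mul_assoc, ← replicateCol_mulVec, h2]
    ext i j
    simp [Matrix.mul_apply]
    ring
  rw [this, det_mul, det_one_add_replicateCol_mul_replicateRow, dotProduct_smul, smul_eq_mul]
  ring

/-- The linear system solved by the shift of `G⁻¹ H`, where `2F - H` is the shift of `H`. It is
stated without dividing by the ratio of determinants. -/
theorem rankOne_mulVec {G A : Matrix ι ι R} (h : G * A = 1) (ζ : R)
    (F H : ι → R) :
    (Matrix.of fun i j => G i j - 2 * ζ * (F i * F j)) *ᵥ
        ((2 * (1 - ζ * (F ⬝ᵥ A *ᵥ H))) • A *ᵥ F - (1 - 2 * ζ * (F ⬝ᵥ A *ᵥ F)) • A *ᵥ H) =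
      (1 - 2 * ζ * (F ⬝ᵥ A *ᵥ F)) • ((2 : R) • F - H) := by
  have h1 : ∀ v, (Matrix.of fun i j => G i j - 2 * ζ * (F i * F j)) *ᵥ v =
      G *ᵥ v - (2 * ζ * (F ⬝ᵥ v)) • F := by
    intro v
    ext i
    simp only [mulVec, dotProduct, of_apply, sub_mul, Finset.sum_sub_distrib, Pi.sub_apply,
      Pi.smul_apply, smul_eq_mul, Finset.mul_sum, Finset.sum_mul]
    congr 1
    exact Finset.sum_congr rfl fun j _ => by ring
  rw [h1, mulVec_sub, mulVec_smul, mulVec_smul, mulVec_mulVec, mulVec_mulVec, h, one_mulVec,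
    one_mulVec, dotProduct_sub, dotProduct_smul, dotProduct_smul]
  ext i
  simp only [Pi.sub_apply, Pi.smul_apply, smul_eq_mul]
  ring

end RankOne

theorem sepRes_one (f g : Fn) : sepRes 1 f g = f * g := by
  rw [sepRes_eq]; simp

/-- `G` is a Gram matrix of squared eigenfunction potentials of the eigenfunctions `H`:
`G i j` is a potential of `H i`, `H j`. It is required to be symmetric and to be invertible at the
base point. -/
structure IsGram {ι : Type*} [Fintype ι] [DecidableEq ι] (H : ι → Fn) (G : Matrix ι ι Fn) :
    Prop where
  eigen : ∀ i, IsEigen (H i)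
  flow : ∀ i j n, dt n (G i j) = sepRes (2 * n + 1) (H i) (H j)
  symm : G.IsSymm
  unit : constantCoeff G.det ≠ 0

namespace IsGram

variable {ι : Type*} [Fintype ι] [DecidableEq ι] {H : ι → Fn} {G : Matrix ι ι Fn}

theorem isUnit_det (hG : IsGram H G) : IsUnit G.det := isUnit_of_constantCoeff hG.unit

theorem mul_inv (hG : IsGram H G) : G * G⁻¹ = 1 := mul_nonsing_inv G hG.isUnit_det

theorem inv_mul (hG : IsGram H G) : G⁻¹ * G = 1 := nonsing_inv_mul G hG.isUnit_det

theorem inv_symm (hG : IsGram H G) : (G⁻¹).IsSymm := by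
  rw [IsSymm, transpose_nonsing_inv, hG.symm]

theorem dt_inv (hG : IsGram H G) (n : ℕ) (i j : ι) :
    dt n (G⁻¹ i j) = -∑ k, ∑ l, G⁻¹ i k * dt n (G k l) * G⁻¹ l j := by
  have h1 : ∀ i l, ∑ k, (dt n (G⁻¹ i k) * G k l + G⁻¹ i k * dt n (G k l)) = 0 := by
    intro i l
    have := congrArg (dt n) (congrFun (congrFun hG.inv_mul i) l)
    rw [Matrix.mul_apply, dt_sum] at this
    simp only [dt_mul] at this
    rw [this, Matrix.one_apply]
    split_ifs
    · exact (dtDer n).map_one_eq_zero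
    · exact map_zero (dtDer n)
  have h2 : ∑ l, (∑ k, (dt n (G⁻¹ i k) * G k l + G⁻¹ i k * dt n (G k l))) * G⁻¹ l j = 0 := by
    simp only [h1, zero_mul, Finset.sum_const_zero]
  have h3 : ∑ l, (∑ k, dt n (G⁻¹ i k) * G k l) * G⁻¹ l j = dt n (G⁻¹ i j) := by
    simp only [Finset.sum_mul]
    rw [Finset.sum_comm]
    simp only [mul_assoc, ← Finset.mul_sum]
    have : ∀ k, ∑ l, G k l * G⁻¹ l j = (1 : Matrix ι ι Fn) k j := by
      intro k
      rw [← Matrix.mul_apply, hG.mul_inv]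
    simp [this, Matrix.one_apply]
  simp only [Finset.sum_add_distrib, add_mul] at h2
  rw [h3] at h2
  rw [eq_neg_iff_add_eq_zero, ← h2]
  congr 1
  simp only [Finset.sum_mul]
  exact Finset.sum_comm

/-- The vector `G⁻¹ H`. -/
def adjWave (H : ι → Fn) (G : Matrix ι ι Fn) : ι → Fn := G⁻¹ *ᵥ H

theorem dt_zero_inv (hG : IsGram H G) (i j : ι) :
    dt 0 (G⁻¹ i j) = -(adjWave H G i * adjWave H G j) := by
  rw [hG.dt_inv, adjWave, mulVec, mulVec, dotProduct, dotProduct, Finset.sum_mul_sum]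
  refine congrArg _ (Finset.sum_congr rfl fun k _ => Finset.sum_congr rfl fun l _ => ?_)
  rw [hG.flow, sepRes_one, hG.inv_symm.apply j l]
  ring

end IsGram

/-! ### The wave function of a Gram determinant -/

theorem constantCoeff_zvar (σ : Type) : constantCoeff (zvar σ) = 0 := constantCoeff_X _

theorem constantCoeff_shiftBy {σ : Type} (s : ℕ → σ) (hs : Function.Injective s) (c : ℂ) (f : Fn) :
    constantCoeff (shiftBy s c f) = constantCoeff f := by
  have h : constantCoeff (f - C (constantCoeff f)) = 0 := by simp
  have h2 := MvPowerSeries.constantCoeff_subst_eq_zero (hasSubst_shift s hs c)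
    (fun n => (hasSubst_shift s hs c).const_coeff n |>.eq_zero) h
  have h3 : shiftHom s hs c (C (constantCoeff f)) = C (constantCoeff f) :=
    (shiftHom s hs c).commutes _
  have h4 : constantCoeff (shiftHom s hs c (f - C (constantCoeff f))) = 0 := by
    rw [shiftHom_apply]; exact h2
  rw [map_sub, h3, map_sub, constantCoeff_C, sub_eq_zero, shiftHom_apply] at h4
  exact h4

namespace IsGram

variable {ι : Type*} [Fintype ι] [DecidableEq ι] {H : ι → Fn} {G : Matrix ι ι Fn}
variable {σ : Type} (s : ℕ → σ) (ε : ℂ)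

/-- The series `1 - εz ∑ a_i(t) (1 + εz∂)⁻¹ H_i(t)` with `a = G⁻¹ H`. -/
def wave (H : ι → Fn) (G : Matrix ι ι Fn) : FnZ σ :=
  1 - C ε * zvar σ * (resolvent s ε ∘ H ⬝ᵥ shiftBy s 0 ∘ adjWave H G)

/-- The vector `G⁻¹ (1 + εz∂)⁻¹ H`. -/
def adjResolvent (H : ι → Fn) (G : Matrix ι ι Fn) : ι → FnZ σ :=
  G⁻¹.map (shiftBy s 0) *ᵥ (resolvent s ε ∘ H)

/-- The ratio `det G(t - 2ε[z]) / det G(t)`. -/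
def shiftRatio (H : ι → Fn) (G : Matrix ι ι Fn) : FnZ σ :=
  1 - 2 * (C ε * zvar σ) * (resolvent s ε ∘ H ⬝ᵥ adjResolvent s ε H G)

variable {s ε}

theorem map_adjWave (hs : Function.Injective s) (c : ℂ) :
    shiftBy s c ∘ adjWave H G = G⁻¹.map (shiftBy s c) *ᵥ (shiftBy s c ∘ H) := by
  have h : shiftBy s c = (shiftHom s hs c : Fn → FnZ σ) := by
    funext f; rw [shiftHom_apply]
  rw [h]
  funext i
  exact RingHom.map_mulVec (shiftHom s hs c : Fn →+* FnZ σ) G⁻¹ H i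

theorem map_shiftBy_mul_inv (hG : IsGram H G) (hs : Function.Injective s) (c : ℂ) :
    G.map (shiftBy s c) * G⁻¹.map (shiftBy s c) = 1 := by
  have h : shiftBy s c = (shiftHom s hs c : Fn → FnZ σ) := by
    funext f; rw [shiftHom_apply]
  rw [h]
  have : (G * G⁻¹).map (shiftHom s hs c : Fn →+* FnZ σ) = _ := Matrix.map_mul
  rw [hG.mul_inv] at this
  refine this.symm.trans ?_
  exact Matrix.map_one _ (map_zero _) (map_one _)

theorem map_shiftBy (hG : IsGram H G) (hs : Function.Injective s) (hε : ε ^ 2 = 1) :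
    G.map (shiftBy s (-2 * ε)) = Matrix.of fun i j => G.map (shiftBy s 0) i j -
      2 * (C ε * zvar σ) * ((resolvent s ε ∘ H) i * (resolvent s ε ∘ H) j) := by
  ext1 i j
  simp only [map_apply, of_apply, Function.comp]
  rw [shiftBy_potential s hs hε (hG.eigen i) (hG.eigen j) (hG.flow i j)]
  ring

/-- The shift changes `G` by a matrix of rank one, so it multiplies the determinant by a scalar
product (matrix determinant lemma). -/
theorem shiftBy_det (hG : IsGram H G) (hs : Function.Injective s) (hε : ε ^ 2 = 1) :
    shiftBy s (-2 * ε) G.det = shiftBy s 0 G.det * shiftRatio s ε H G := by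
  have h : ∀ c, shiftBy s c G.det = (G.map (shiftBy s c)).det := by
    intro c
    have h : shiftBy s c = (shiftHom s hs c : Fn → FnZ σ) := by
      funext f; rw [shiftHom_apply]
    rw [h]
    exact RingHom.map_det (shiftHom s hs c : Fn →+* FnZ σ) G
  rw [h, h, hG.map_shiftBy hs hε, det_sub_rankOne (hG.map_shiftBy_mul_inv hs 0)]
  rfl

/-- The Cauchy–Binet type identity that gives the square root in the wave function: the square of
the wave function is `D + (εz/2) ∂_x D` with `D = det G(t - 2ε[z]) / det G(t)`. -/
theorem wave_sq (hG : IsGram H G) (hs : Function.Injective s) (hε : ε ^ 2 = 1) :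
    2 * wave s ε H G ^ 2 = 2 * shiftRatio s ε H G +
      C ε * zvar σ * pderiv ℂ (Sum.inl (s 0)) (shiftRatio s ε H G) := by
  set F : ι → FnZ σ := resolvent s ε ∘ H with hF
  set ζ : FnZ σ := C ε * zvar σ with hζ
  set A : Matrix ι ι (FnZ σ) := G⁻¹.map (shiftBy s 0) with hA
  set a : ι → FnZ σ := shiftBy s 0 ∘ adjWave H G with ha
  set D := pderiv ℂ (Sum.inl (s 0) : σ ⊕ Unit)
  have hDζ : D ζ = 0 := by
    rw [hζ, Derivation.leibniz, pderiv_C, zvar, pderiv_X_of_ne (by simp)]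
    simp
  have hDF : ∀ i, ζ * D (F i) = shiftBy s 0 (H i) - F i := fun i =>
    resolvent_add_deriv s hs hε (hG.eigen i)
  have hDA : ∀ i j, D (A i j) = -(a i * a j) := by
    intro i j
    have h1 := pderiv_inl_shiftBy s hs 0 0 (G⁻¹ i j)
    rw [hG.dt_zero_inv, ← shiftHom_apply s hs, ← shiftHom_apply s hs, map_neg, map_mul,
      shiftHom_apply, shiftHom_apply, shiftHom_apply] at h1
    exact h1
  have hAs : ∀ i j, A i j = A j i := fun i j => by
    rw [hA, map_apply, map_apply, hG.inv_symm.apply i j]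
  have hAH : ∀ i, ∑ j, A i j * shiftBy s 0 (H j) = a i := fun i =>
    (congrFun (map_adjWave hs 0) i).symm
  have hα : F ⬝ᵥ A *ᵥ F = ∑ i, ∑ j, F i * A i j * F j := by
    simp only [dotProduct, mulVec, Finset.mul_sum, mul_assoc]
  set β := F ⬝ᵥ a with hβ
  set α := F ⬝ᵥ A *ᵥ F with hα'
  have hDα : ζ * D α = 2 * β - 2 * α - ζ * β ^ 2 := by
    have e1 : ζ * D α = ∑ i, ∑ j, ((shiftBy s 0 (H i) - F i) * A i j * F j -
        ζ * ((F i * a i) * (F j * a j)) + F i * A i j * (shiftBy s 0 (H j) - F j)) := by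
      rw [hα, map_sum, Finset.mul_sum]
      refine Finset.sum_congr rfl fun i _ => ?_
      rw [map_sum, Finset.mul_sum]
      refine Finset.sum_congr rfl fun j _ => ?_
      rw [Derivation.leibniz, Derivation.leibniz, hDA, ← hDF i, ← hDF j]
      simp only [smul_eq_mul]
      ring
    have e2 : ∑ i, ∑ j, F i * A i j * shiftBy s 0 (H j) = β := by
      rw [hβ, dotProduct]
      refine Finset.sum_congr rfl fun i _ => ?_
      rw [← hAH i, Finset.mul_sum]
      exact Finset.sum_congr rfl fun j _ => by ring
    have e3 : ∑ i, ∑ j, shiftBy s 0 (H i) * A i j * F j = β := by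
      rw [Finset.sum_comm, ← e2]
      refine Finset.sum_congr rfl fun j _ => Finset.sum_congr rfl fun i _ => ?_
      rw [hAs i j]
      ring
    have e4 : ∑ i, ∑ j, ζ * ((F i * a i) * (F j * a j)) = ζ * β ^ 2 := by
      rw [hβ, dotProduct, sq, Finset.sum_mul_sum]
      simp only [Finset.mul_sum]
    simp only [Finset.sum_add_distrib, Finset.sum_sub_distrib, sub_mul, mul_sub, e2, e3, e4,
      ← hα] at e1
    rw [e1]
    ring
  have hw : wave s ε H G = 1 - ζ * β := rfl
  have hr : shiftRatio s ε H G = 1 - 2 * ζ * α := rfl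
  have hDr : D (1 - 2 * ζ * α) = -2 * ζ * D α := by
    have h2 : D (2 : FnZ σ) = 0 := by
      rw [← map_ofNat (C : ℂ →+* FnZ σ) 2, pderiv_C]
    rw [map_sub, Derivation.leibniz, Derivation.leibniz, hDζ, h2, Derivation.map_one_eq_zero]
    simp only [smul_eq_mul]
    ring
  rw [hw, hr, hDr]
  linear_combination 2 * ζ * hDα

theorem constantCoeff_wave : constantCoeff (wave s ε H G) = 1 := by
  rw [wave, map_sub, map_mul, map_mul, constantCoeff_zvar, map_one]
  simp

theorem constantCoeff_tau {τ : Fn} (hG : IsGram H G) (hτ : τ ^ 2 = G.det) :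
    constantCoeff τ ≠ 0 := by
  intro h
  apply hG.unit
  rw [← hτ, map_pow, h]
  norm_num

/-- The shift ratio of a square root `τ` of `det G`. -/
theorem tauRatio_sq {τ : Fn} (hG : IsGram H G) (hs : Function.Injective s) (hε : ε ^ 2 = 1)
    (hτ : τ ^ 2 = G.det) :
    (shiftBy s (-2 * ε) τ * (shiftBy s 0 τ)⁻¹) ^ 2 = shiftRatio s ε H G := by
  have h0 : constantCoeff (shiftBy s 0 τ) ≠ 0 := by
    rw [constantCoeff_shiftBy s hs]; exact hG.constantCoeff_tau hτ
  have h1 := hG.shiftBy_det hs hε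
  rw [← hτ, ← shiftHom_apply s hs, ← shiftHom_apply s hs, map_pow, map_pow, shiftHom_apply,
    shiftHom_apply] at h1
  have h2 := MvPowerSeries.mul_inv_cancel _ h0
  rw [mul_pow, h1]
  linear_combination (shiftRatio s ε H G * (shiftBy s 0 τ * (shiftBy s 0 τ)⁻¹ + 1)) * h2

theorem constantCoeff_tauRatio {τ : Fn} (hG : IsGram H G) (hs : Function.Injective s)
    (hτ : τ ^ 2 = G.det) (c : ℂ) :
    constantCoeff (shiftBy s c τ * (shiftBy s 0 τ)⁻¹) = 1 := by
  rw [map_mul, constantCoeff_inv, constantCoeff_shiftBy s hs, constantCoeff_shiftBy s hs,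
    mul_inv_cancel₀ (hG.constantCoeff_tau hτ)]

theorem constantCoeff_phi (τ : Fn) : constantCoeff (phi s ε τ) = 1 := by
  rw [phi, map_add, map_mul, map_mul, constantCoeff_zvar, map_one]
  simp

/-- The wave function `√φ(t,λ) τ(t - 2[λ⁻¹]) / τ(t)` of `τ = √det G` is
`1 - z ∑ a_i (1 + z∂)⁻¹ H_i`. -/
theorem fsqrt_phi_mul {τ : Fn} (hG : IsGram H G) (hs : Function.Injective s) (hε : ε ^ 2 = 1)
    (hτ : τ ^ 2 = G.det) :
    fsqrt (phi s ε τ) * (shiftBy s (-2 * ε) τ * (shiftBy s 0 τ)⁻¹) = wave s ε H G := by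
  set r := shiftBy s (-2 * ε) τ * (shiftBy s 0 τ)⁻¹ with hr
  have hr1 : constantCoeff r = 1 := hG.constantCoeff_tauRatio hs hτ _
  have hrr : r * r⁻¹ = 1 := MvPowerSeries.mul_inv_cancel _ (by rw [hr1]; norm_num)
  have hr2 : r ^ 2 = shiftRatio s ε H G := hG.tauRatio_sq hs hε hτ
  have h2 : (2 : FnZ σ) ≠ 0 := by
    intro h
    have := congrArg constantCoeff h
    rw [map_ofNat, map_zero] at this
    norm_num at this
  have h2u : IsUnit (2 : FnZ σ) := isUnit_of_constantCoeff (by rw [map_ofNat]; norm_num)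
  refine eq_of_sq_eq ?_ ?_ constantCoeff_wave
  · have hw := hG.wave_sq hs hε
    rw [← hr2, Derivation.leibniz_pow] at hw
    rw [mul_pow, fsqrt_sq _ (constantCoeff_phi τ), phi, ← hr]
    apply h2u.mul_left_cancel
    rw [hw]
    simp only [smul_eq_mul, nsmul_eq_mul, Nat.cast_ofNat]
    linear_combination (2 * r * (C ε * zvar σ) * pderiv ℂ (Sum.inl (s 0)) r) * hrr
  · rw [map_mul, constantCoeff_fsqrt (constantCoeff_phi τ), hr1, one_mul]

/-- The shift of `a = G⁻¹ H`. -/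
theorem shiftRatio_smul_adjWave (hG : IsGram H G) (hs : Function.Injective s) (hε : ε ^ 2 = 1) :
    shiftRatio s ε H G • (shiftBy s (-2 * ε) ∘ adjWave H G) =
      (2 * wave s ε H G) • adjResolvent s ε H G -
        shiftRatio s ε H G • (shiftBy s 0 ∘ adjWave H G) := by
  have h1 := rankOne_mulVec (hG.map_shiftBy_mul_inv hs 0) (C ε * zvar σ) (resolvent s ε ∘ H)
    (shiftBy s 0 ∘ H)
  rw [← hG.map_shiftBy hs hε, ← map_adjWave hs 0] at h1
  have h2 : (2 : FnZ σ) • (resolvent s ε ∘ H) - shiftBy s 0 ∘ H = shiftBy s (-2 * ε) ∘ H := by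
    funext i
    exact (shiftBy_eq_resolvent s ε (H i)).symm
  rw [h2] at h1
  have h3 : G⁻¹.map (shiftBy s (-2 * ε)) * G.map (shiftBy s (-2 * ε)) = 1 :=
    mul_eq_one_comm.mp (hG.map_shiftBy_mul_inv hs _)
  have h4 := congrArg (G⁻¹.map (shiftBy s (-2 * ε)) *ᵥ ·) h1
  beta_reduce at h4
  rw [mulVec_mulVec, h3, one_mulVec, mulVec_smul, ← map_adjWave hs] at h4
  exact h4.symm

theorem shiftRatio_mul_adjWave (hG : IsGram H G) (hs : Function.Injective s) (hε : ε ^ 2 = 1)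
    (p : ι) :
    shiftRatio s ε H G * (shiftBy s (-2 * ε) (adjWave H G p) + shiftBy s 0 (adjWave H G p)) =
      2 * wave s ε H G * adjResolvent s ε H G p := by
  have := congrFun (hG.shiftRatio_smul_adjWave hs hε) p
  simp only [Pi.smul_apply, Pi.sub_apply, smul_eq_mul, Function.comp] at this
  rw [mul_add, this]
  ring

/-- The Darboux transform `u - ∑ a_i Ω(H_i, u)` of an eigenfunction `u`, where `v i` stands for the
potential `Ω(H_i, u)`. -/
def transform (H : ι → Fn) (G : Matrix ι ι Fn) (u : Fn) (v : ι → Fn) : Fn :=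
  u - adjWave H G ⬝ᵥ v

/-- The sum of a transform and its shift. Multiplying by the ratio of determinants avoids an
inverse. -/
theorem shiftRatio_mul_transform (hG : IsGram H G) (hs : Function.Injective s) (hε : ε ^ 2 = 1)
    {u : Fn} (hu : IsEigen u) {v : ι → Fn}
    (hv : ∀ i n, dt n (v i) = sepRes (2 * n + 1) (H i) u) :
    shiftRatio s ε H G * (shiftBy s (-2 * ε) (transform H G u v) +
        shiftBy s 0 (transform H G u v)) =
      2 * wave s ε H G *
        (resolvent s ε u - adjResolvent s ε H G ⬝ᵥ shiftBy s 0 ∘ v) := by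
  have hT : ∀ c, shiftBy s c (transform H G u v) = shiftBy s c u -
      (shiftBy s c ∘ adjWave H G) ⬝ᵥ (shiftBy s c ∘ v) := by
    intro c
    have h : shiftBy s c = (shiftHom s hs c : Fn → FnZ σ) := by
      funext f; rw [shiftHom_apply]
    rw [h, transform, map_sub]
    congr 1
    exact RingHom.map_dotProduct (shiftHom s hs c : Fn →+* FnZ σ) _ _
  set F : ι → FnZ σ := resolvent s ε ∘ H with hF
  set ζ : FnZ σ := C ε * zvar σ with hζ
  set U := resolvent s ε u with hU
  have hSv : shiftBy s (-2 * ε) ∘ v = shiftBy s 0 ∘ v - (2 * ζ * U) • F := by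
    funext i
    simp only [Function.comp, Pi.sub_apply, Pi.smul_apply, smul_eq_mul, hF]
    rw [shiftBy_potential s hs hε (hG.eigen i) hu (hv i)]
    ring
  have hSu := shiftBy_eq_resolvent s ε u
  have hkey : shiftRatio s ε H G * ((shiftBy s (-2 * ε) ∘ adjWave H G) ⬝ᵥ
      (shiftBy s (-2 * ε) ∘ v)) = ((2 * wave s ε H G) • adjResolvent s ε H G -
        shiftRatio s ε H G • (shiftBy s 0 ∘ adjWave H G)) ⬝ᵥ
          (shiftBy s 0 ∘ v - (2 * ζ * U) • F) := by
    rw [← hG.shiftRatio_smul_adjWave hs hε, smul_dotProduct, smul_eq_mul, hSv]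
  rw [hT, hT, hSu, mul_add, mul_sub, mul_sub, hkey]
  simp only [sub_dotProduct, dotProduct_sub, smul_dotProduct, dotProduct_smul, smul_eq_mul]
  have hw : wave s ε H G = 1 - ζ * (F ⬝ᵥ shiftBy s 0 ∘ adjWave H G) := rfl
  have hr : shiftRatio s ε H G = 1 - 2 * ζ * (F ⬝ᵥ adjResolvent s ε H G) := rfl
  rw [dotProduct_comm (shiftBy s 0 ∘ adjWave H G) F, dotProduct_comm (adjResolvent s ε H G) F]
  set w := wave s ε H G
  have e1 : 2 * ζ * (F ⬝ᵥ adjResolvent s ε H G) = 1 - shiftRatio s ε H G := by rw [hr]; ring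
  have e2 : ζ * (F ⬝ᵥ shiftBy s 0 ∘ adjWave H G) = 1 - w := by rw [hw]; ring
  linear_combination (2 * w * U) * e1 - (2 * U * shiftRatio s ε H G) * e2

/-- The combination of `τ` and `ρ = qτ` in the second bilinear equation. -/
theorem tau_mul_shift_add {τ : Fn} (hG : IsGram H G) (hs : Function.Injective s) (hε : ε ^ 2 = 1)
    (hτ : τ ^ 2 = G.det) {X Q : FnZ σ}
    (hX : shiftRatio s ε H G * X = 2 * wave s ε H G * Q) :
    (fsqrt (phi s ε τ))⁻¹ * (shiftBy s (-2 * ε) τ * X) = 2 * Q * shiftBy s 0 τ := by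
  set r := shiftBy s (-2 * ε) τ * (shiftBy s 0 τ)⁻¹ with hr
  have hr1 : constantCoeff r = 1 := hG.constantCoeff_tauRatio hs hτ _
  have hru : IsUnit r := isUnit_of_constantCoeff (by rw [hr1]; norm_num)
  have h0 : constantCoeff (shiftBy s 0 τ) ≠ 0 := by
    rw [constantCoeff_shiftBy s hs]; exact hG.constantCoeff_tau hτ
  have h1 : shiftBy s (-2 * ε) τ = r * shiftBy s 0 τ := by
    rw [hr, mul_assoc, MvPowerSeries.inv_mul_cancel _ h0, mul_one]
  have hφ : fsqrt (phi s ε τ) * (fsqrt (phi s ε τ))⁻¹ = 1 :=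
    MvPowerSeries.mul_inv_cancel _
      (by rw [constantCoeff_fsqrt (constantCoeff_phi τ)]; norm_num)
  have hr2 : r ^ 2 = shiftRatio s ε H G := hG.tauRatio_sq hs hε hτ
  rw [← hr2, ← hG.fsqrt_phi_mul hs hε hτ, ← hr] at hX
  apply hru.mul_left_cancel
  rw [h1]
  linear_combination ((fsqrt (phi s ε τ))⁻¹ * shiftBy s 0 τ) * hX +
    (2 * r * Q * shiftBy s 0 τ) * hφ

end IsGram

/-! ### Residues against `e^{ξ(t-t',λ)}` -/

theorem toFnL_apply (G : FnZ (ℕ ⊕ ℕ)) (β : ℕ ⊕ ℕ →₀ ℕ) : coeff β (toFnL G) =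
    HahnSeries.ofPowerSeries ℤ ℂ (PowerSeries.mk fun w => coeff β (zcoeff w G)) := by
  simp only [coeff_coeff_zexp]
  rfl

theorem toFnL_add (G H : FnZ (ℕ ⊕ ℕ)) : toFnL (G + H) = toFnL G + toFnL H := by
  ext1 β
  rw [map_add, toFnL_apply, toFnL_apply, toFnL_apply, ← map_add]
  congr 1
  ext w
  simp only [PowerSeries.coeff_mk, zcoeff, map_add]

theorem toFnL_mul (G H : FnZ (ℕ ⊕ ℕ)) : toFnL (G * H) = toFnL G * toFnL H := by
  classical
  ext1 β
  rw [coeff_mul, toFnL_apply]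
  simp only [toFnL_apply, ← map_mul, ← map_sum]
  congr 1
  ext w
  simp only [PowerSeries.coeff_mk, zcoeff, map_mul, PowerSeries.coeff_mul, map_sum, coeff_mul]
  exact Finset.sum_comm

/-- A function of `t`, `t'` as a series whose coefficients are constant in `λ`. -/
def constLam : Fn₂ →+* FnL := MvPowerSeries.map HahnSeries.C

theorem toFnL_of_zexp_C {G : FnZ (ℕ ⊕ ℕ)} {g : Fn₂} (h : zexp _ G = PowerSeries.C g) :
    toFnL G = constLam g := by
  ext1 β
  rw [toFnL_apply, constLam, coeff_map]
  have : (PowerSeries.mk fun w => coeff β (zcoeff w G)) = PowerSeries.C (coeff β g) := by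
    ext w
    rw [PowerSeries.coeff_mk, zcoeff, h, PowerSeries.coeff_C, PowerSeries.coeff_C]
    split_ifs <;> simp
  rw [this, HahnSeries.ofPowerSeries_C]

theorem toFnL_zvar : toFnL (zvar (ℕ ⊕ ℕ)) = C (lamPow (-1)) := by
  classical
  ext1 β
  rw [toFnL_apply, coeff_C]
  have : (PowerSeries.mk fun w => coeff β (zcoeff w (zvar (ℕ ⊕ ℕ)))) =
      if β = 0 then PowerSeries.X else 0 := by
    ext w
    rw [PowerSeries.coeff_mk, zcoeff, zexp_zvar, PowerSeries.coeff_X]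
    split_ifs with h1 h2 h2 <;> simp_all [coeff_one, PowerSeries.coeff_X]
  rw [this]
  split_ifs
  · rw [HahnSeries.ofPowerSeries_X]
    simp [lamPow]
  · rw [map_zero]

theorem lamPow_add (a b : ℤ) : lamPow (a + b) = lamPow a * lamPow b := by
  rw [lamPow, lamPow, lamPow, HahnSeries.single_mul_single, neg_add, one_mul]

theorem resLam_add (X Y : FnL) : resLam (X + Y) = resLam X + resLam Y := by
  ext β
  change (coeff β (X + Y)).coeff 1 = (coeff β X).coeff 1 + (coeff β Y).coeff 1
  rw [map_add, HahnSeries.coeff_add]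

/-- `resLam` as an additive homomorphism. -/
def resLamHom : FnL →+ Fn₂ :=
  AddMonoidHom.mk' resLam resLam_add

theorem coeff_resLam (X : FnL) (β : ℕ ⊕ ℕ →₀ ℕ) : coeff β (resLam X) = (coeff β X).coeff 1 := rfl

theorem resLam_constLam_mul (g : Fn₂) (X : FnL) : resLam (constLam g * X) = g * resLam X := by
  classical
  ext β
  rw [coeff_resLam, coeff_mul, coeff_mul, HahnSeries.coeff_sum]
  refine Finset.sum_congr rfl fun p _ => ?_
  rw [constLam, coeff_map, HahnSeries.C_mul_eq_smul, HahnSeries.coeff_smul, coeff_resLam,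
    smul_eq_mul]

theorem pderiv_resLam (v : ℕ ⊕ ℕ) (X : FnL) :
    pderiv ℂ v (resLam X) = resLam (pderiv (LaurentSeries ℂ) v X) := by
  ext β
  rw [coeff_pderiv, coeff_resLam, coeff_resLam, coeff_pderiv]
  rw [show ((β v : LaurentSeries ℂ) + 1) = ((β v + 1 : ℕ) : LaurentSeries ℂ) by push_cast; rfl,
    ← nsmul_eq_mul', HahnSeries.coeff_nsmul, nsmul_eq_mul']
  push_cast
  rfl

theorem pderiv_toFnL (v : ℕ ⊕ ℕ) (G : FnZ (ℕ ⊕ ℕ)) :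
    pderiv (LaurentSeries ℂ) v (toFnL G) = toFnL (pderiv ℂ (Sum.inl v) G) := by
  ext1 β
  rw [coeff_pderiv, toFnL_apply, toFnL_apply,
    show ((β v : LaurentSeries ℂ) + 1) =
      HahnSeries.ofPowerSeries ℤ ℂ ((β v + 1 : ℕ) : PowerSeries ℂ) by
        rw [map_natCast]; push_cast; rfl, ← map_mul]
  congr 1
  ext w
  rw [mul_comm, ← nsmul_eq_mul, map_nsmul, PowerSeries.coeff_mk, PowerSeries.coeff_mk,
    zcoeff, zcoeff, coeff_zexp_pderiv_inl, coeff_pderiv, nsmul_eq_mul']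
  push_cast
  rfl

theorem pderiv_expLin {τ A : Type*} [CommRing A] [Algebra ℚ A] (c : τ → A) (i : τ) :
    pderiv A i (expLin c) = C (c i) * expLin c := by
  classical
  ext β
  rw [coeff_pderiv, coeff_C_mul]
  set u : τ → ℕ → A := fun i b => algebraMap ℚ A (1 / (b.factorial : ℚ)) * c i ^ b with hu
  have hcoeff : ∀ γ, coeff γ (expLin c) = γ.prod u := fun γ => rfl
  rw [hcoeff, hcoeff]
  have hu0 : ∀ j, u j 0 = 1 := by intro j; simp [hu]
  have h1 : (β + Finsupp.single i 1).prod u =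
      u i (β i + 1) * (β.erase i).prod u := by
    have h2 : β + Finsupp.single i 1 = Finsupp.single i (β i + 1) + β.erase i := by
      conv_lhs => rw [← Finsupp.single_add_erase i β, add_right_comm, ← Finsupp.single_add]
    rw [h2, Finsupp.prod_add_index_of_disjoint, Finsupp.prod_single_index (hu0 i)]
    refine Finset.disjoint_of_subset_left Finsupp.support_single_subset ?_
    simp
  have h3 : β.prod u = u i (β i) * (β.erase i).prod u := by
    conv_lhs => rw [← Finsupp.single_add_erase i β]
    rw [Finsupp.prod_add_index_of_disjoint, Finsupp.prod_single_index (hu0 i)]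
    refine Finset.disjoint_of_subset_left Finsupp.support_single_subset ?_
    simp
  have h4 : u i (β i + 1) * (β i + 1 : A) = c i * u i (β i) := by
    have : algebraMap ℚ A (1 / ((β i + 1).factorial : ℚ)) * (β i + 1 : A) =
        algebraMap ℚ A (1 / ((β i).factorial : ℚ)) := by
      rw [show (β i + 1 : A) = algebraMap ℚ A ((β i : ℚ) + 1) by simp, ← map_mul]
      congr 1
      rw [Nat.factorial_succ]
      have : ((β i).factorial : ℚ) ≠ 0 := by exact_mod_cast Nat.factorial_ne_zero _
      push_cast
      field_simp
    simp only [hu]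
    rw [← this]
    ring
  rw [h1, h3]
  linear_combination ((β.erase i).prod u) * h4

theorem constantCoeff_expLin {τ A : Type*} [CommRing A] [Algebra ℚ A] (c : τ → A) :
    constantCoeff (expLin c) = 1 :=
  Finsupp.prod_zero_index (h := fun i b => algebraMap ℚ A (1 / (b.factorial : ℚ)) * c i ^ b)

theorem pderiv_C_mul_mul_expLin {τ A : Type*} [CommRing A] [Algebra ℚ A] (c : τ → A) (i : τ)
    (a : A) (X : MvPowerSeries τ A) : pderiv A i (C a * X * expLin c) =
      C a * pderiv A i X * expLin c + C (a * c i) * X * expLin c := by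
  rw [Derivation.leibniz, Derivation.leibniz, pderiv_C, pderiv_expLin, map_mul]
  simp only [smul_eq_mul]
  ring

theorem pderiv_C_mul_mul_expLin' {τ A : Type*} [CommRing A] [Algebra ℚ A] {c : τ → A} {i : τ}
    (a : A) {b : A} (X : MvPowerSeries τ A) (hb : c i + b = 0) :
    pderiv A i (C a * X * expLin c) =
      C a * pderiv A i X * expLin c - C (a * b) * X * expLin c := by
  rw [pderiv_C_mul_mul_expLin, eq_neg_of_add_eq_zero_left hb, mul_neg, map_neg]
  ring

/-- `Res_λ λ^k X e^{ξ(t-t',λ)}`. -/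
def resExp (k : ℤ) (X : FnZ (ℕ ⊕ ℕ)) : Fn₂ :=
  resLam (C (lamPow k) * toFnL X * expXiDiff)

theorem resExp_add (k : ℤ) (X Y : FnZ (ℕ ⊕ ℕ)) : resExp k (X + Y) = resExp k X + resExp k Y := by
  rw [resExp, toFnL_add, mul_add, add_mul, resLam_add]; rfl

/-- `resExp` as an additive homomorphism. -/
def resExpHom (k : ℤ) : FnZ (ℕ ⊕ ℕ) →+ Fn₂ := AddMonoidHom.mk' (resExp k) (resExp_add k)

theorem resExp_sub (k : ℤ) (X Y : FnZ (ℕ ⊕ ℕ)) : resExp k (X - Y) = resExp k X - resExp k Y :=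
  map_sub (resExpHom k) X Y

theorem resExp_sum (k : ℤ) {ι : Type*} (S : Finset ι) (X : ι → FnZ (ℕ ⊕ ℕ)) :
    resExp k (∑ i ∈ S, X i) = ∑ i ∈ S, resExp k (X i) :=
  map_sum (resExpHom k) X S

theorem resExp_zvar_mul (k : ℤ) (X : FnZ (ℕ ⊕ ℕ)) :
    resExp k (zvar _ * X) = resExp (k - 1) X := by
  rw [resExp, resExp, toFnL_mul, toFnL_zvar, sub_eq_add_neg, lamPow_add, map_mul,
    ← mul_assoc (C (lamPow k))]

theorem resExp_zvar_pow_mul (k : ℤ) (l : ℕ) (X : FnZ (ℕ ⊕ ℕ)) :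
    resExp k (zvar _ ^ l * X) = resExp (k - l) X := by
  induction l generalizing k with
  | zero => simp
  | succ l ih =>
    rw [pow_succ', mul_assoc, resExp_zvar_mul, ih]
    congr 1
    push_cast
    ring

theorem resExp_of_zexp_C_mul (k : ℤ) {G : FnZ (ℕ ⊕ ℕ)} {g : Fn₂} (h : zexp _ G = PowerSeries.C g)
    (X : FnZ (ℕ ⊕ ℕ)) : resExp k (G * X) = g * resExp k X := by
  rw [resExp, resExp, toFnL_mul, toFnL_of_zexp_C h, ← resLam_constLam_mul]
  congr 1
  ring

theorem left_eq (f : Fn) : left f = emb Sum.inl f := rfl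

theorem right_eq (f : Fn) : right f = emb Sum.inr f := rfl

theorem resExp_left_mul (k : ℤ) (f : Fn) (X : FnZ (ℕ ⊕ ℕ)) :
    resExp k (shiftBy Sum.inl 0 f * X) = left f * resExp k X :=
  resExp_of_zexp_C_mul k (zexp_shiftBy_zero _ Sum.inl_injective f) X

theorem resExp_right_mul (k : ℤ) (f : Fn) (X : FnZ (ℕ ⊕ ℕ)) :
    resExp k (shiftBy Sum.inr 0 f * X) = right f * resExp k X :=
  resExp_of_zexp_C_mul k (zexp_shiftBy_zero _ Sum.inr_injective f) X

theorem pderiv_inl_resExp (k : ℤ) (n : ℕ) (X : FnZ (ℕ ⊕ ℕ)) :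
    pderiv ℂ (Sum.inl n) (resExp k X) =
      resExp k (pderiv ℂ (Sum.inl (Sum.inl n)) X) + resExp (k + (2 * n + 1)) X := by
  rw [resExp, pderiv_resLam, expXiDiff, pderiv_C_mul_mul_expLin, ← expXiDiff, resLam_add,
    pderiv_toFnL, Sum.elim_inl, ← lamPow_add]
  rfl

theorem pderiv_inr_resExp (k : ℤ) (n : ℕ) (X : FnZ (ℕ ⊕ ℕ)) :
    pderiv ℂ (Sum.inr n) (resExp k X) =
      resExp k (pderiv ℂ (Sum.inl (Sum.inr n)) X) - resExp (k + (2 * n + 1)) X := by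
  have h : (Sum.elim (fun n : ℕ => lamPow (2 * n + 1)) (fun n : ℕ => -lamPow (2 * n + 1)))
      (Sum.inr n) + lamPow (2 * n + 1) = 0 := neg_add_cancel (lamPow (2 * n + 1))
  rw [resExp, pderiv_resLam, expXiDiff, pderiv_C_mul_mul_expLin' _ _ h, ← expXiDiff, ← lamPow_add,
    pderiv_toFnL]
  exact map_sub resLamHom _ _

theorem constantCoeff_resExp (k : ℤ) (X : FnZ (ℕ ⊕ ℕ)) : constantCoeff (resExp k X) =
    if 0 ≤ k + 1 then constantCoeff (zcoeff (k + 1).toNat X) else 0 := by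
  have h1 : constantCoeff (resExp k X) =
      (constantCoeff (C (lamPow k) * toFnL X * expXiDiff)).coeff 1 := rfl
  rw [h1, map_mul, map_mul, expXiDiff, constantCoeff_expLin, constantCoeff_C, mul_one, lamPow,
    ← coeff_zero_eq_constantCoeff_apply, toFnL_apply]
  have h2 := HahnSeries.coeff_single_mul_add (r := (1 : ℂ)) (a := k + 1) (b := -k)
    (x := HahnSeries.ofPowerSeries ℤ ℂ (PowerSeries.mk fun w => coeff 0 (zcoeff w X)))
  rw [show k + 1 + -k = 1 by ring, one_mul] at h2
  rw [h2]
  split_ifs with hk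
  · obtain ⟨w, hw⟩ := Int.eq_ofNat_of_zero_le hk
    rw [hw]
    have := HahnSeries.ofPowerSeries_apply_coeff (Γ := ℤ)
      (PowerSeries.mk fun w => coeff 0 (zcoeff w X)) w
    refine this.trans ?_
    rw [PowerSeries.coeff_mk]
    rfl
  · rw [HahnSeries.ofPowerSeries_apply]
    apply HahnSeries.embDomain_of_notMem_range
    rintro ⟨w, hw⟩
    have : ((w : ℕ) : ℤ) = k + 1 := hw
    omega

/-- A family of series with zero constant terms which is closed under derivatives is zero. -/
theorem eq_zero_of_pderiv {I τ : Type*} (H : I → MvPowerSeries τ ℂ)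
    (hc : ∀ i, constantCoeff (H i) = 0)
    (hd : ∀ i v β, (∀ j, coeff β (H j) = 0) → coeff β (pderiv ℂ v (H i)) = 0) (i : I) :
    H i = 0 := by
  classical
  have key : ∀ d : ℕ, ∀ β : τ →₀ ℕ, β.degree = d → ∀ i, coeff β (H i) = 0 := by
    intro d
    induction d with
    | zero =>
      intro β hβ i
      rw [(Finsupp.degree_eq_zero_iff β).mp hβ]
      exact hc i
    | succ d ih =>
      intro β hβ i
      have hne : β ≠ 0 := by
        rintro rfl
        simp at hβ
      obtain ⟨v, hv⟩ := Finsupp.ne_iff.mp hne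
      have hle : Finsupp.single v 1 ≤ β := by
        rw [Finsupp.single_le_iff]
        exact Nat.one_le_iff_ne_zero.mpr hv
      have hβ' : (β - Finsupp.single v 1) + Finsupp.single v 1 = β := tsub_add_cancel_of_le hle
      have hdeg : (β - Finsupp.single v 1).degree = d := by
        have := congrArg Finsupp.degree hβ'
        rw [map_add, hβ, Finsupp.degree_single] at this
        omega
      have h1 := hd i v _ (ih _ hdeg)
      rw [coeff_pderiv, hβ'] at h1
      refine (mul_eq_zero.mp h1).resolve_right ?_
      exact Nat.cast_add_one_ne_zero _
  ext β
  rw [map_zero]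
  exact key _ β rfl i

/-! ### Residues of resolvents -/

theorem pderiv_resolvent {σ : Type} (s : ℕ → σ) (hs : Function.Injective s) (ε : ℂ) (n : ℕ)
    (f : Fn) : pderiv ℂ (Sum.inl (s n)) (resolvent s ε f) = resolvent s ε (dt n f) := by
  rw [resolvent, Derivation.leibniz, pderiv_C, map_add, pderiv_inl_shiftBy s hs,
    pderiv_inl_shiftBy s hs, smul_zero, add_zero, smul_eq_mul, resolvent]

theorem pderiv_resolvent_of_ne {σ : Type} (s : ℕ → σ) (hs : Function.Injective s) (ε : ℂ) (v : σ)
    (hv : ∀ n, s n ≠ v) (f : Fn) : pderiv ℂ (Sum.inl v) (resolvent s ε f) = 0 := by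
  rw [resolvent, Derivation.leibniz, pderiv_C, map_add, pderiv_inl_shiftBy_of_ne s hs _ v hv,
    pderiv_inl_shiftBy_of_ne s hs _ v hv, add_zero, smul_zero, smul_zero, add_zero]

/-- The geometric expansion of the resolvent, with remainder. -/
theorem resolvent_expand {σ : Type} (s : ℕ → σ) (hs : Function.Injective s) {ε : ℂ}
    (hε : ε ^ 2 = 1) {f : Fn} (hf : IsEigen f) (n : ℕ) :
    resolvent s ε f = ∑ l ∈ Finset.range n, C ((-ε) ^ l) * (zvar σ ^ l * shiftBy s 0 (dx l f)) +
      C ((-ε) ^ n) * (zvar σ ^ n * resolvent s ε (dx n f)) := by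
  induction n with
  | zero => simp
  | succ n ih =>
    rw [Finset.sum_range_succ, add_assoc, ih]
    congr 1
    have h := resolvent_add_deriv s hs hε (hf.dx n)
    rw [pderiv_resolvent s hs, ← dx_succ] at h
    rw [pow_succ, map_mul, map_neg]
    linear_combination (C ((-ε) ^ n) * zvar σ ^ n) * h

theorem embHom_inl (f : Fn) : embHom Sum.inl Sum.inl_injective f = left f := embHom_apply _ _ f

theorem embHom_inr (f : Fn) : embHom Sum.inr Sum.inr_injective f = right f := embHom_apply _ _ f

theorem constantCoeff_emb {σ : Type} (s : ℕ → σ) (hs : Function.Injective s) (f : Fn) :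
    constantCoeff (emb s f) = constantCoeff f := by
  rw [← coeff_zero_zexp_shiftBy s hs 0 f, ← constantCoeff_shiftBy s hs 0 f,
    ← coeff_zero_eq_constantCoeff_apply, coeff_coeff_zexp, ← coeff_zero_eq_constantCoeff_apply]
  congr 2
  ext (i | i) <;> simp

/-- The exponential contains no negative powers of `λ`. -/
theorem resExp_one (k : ℕ) : resExp k 1 = 0 := by
  refine eq_zero_of_pderiv (fun k : ℕ => resExp k 1) (fun k => ?_) (fun k v β hβ => ?_) k
  · rw [constantCoeff_resExp, if_pos (by omega), zcoeff, map_one, PowerSeries.coeff_one,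
      if_neg (by omega), map_zero]
  · have h0 : ∀ j : ℤ, resExp j 0 = 0 := fun j => map_zero (resExpHom j)
    rcases v with n | n
    · rw [pderiv_inl_resExp, Derivation.map_one_eq_zero, h0, zero_add]
      exact_mod_cast hβ (k + (2 * n + 1))
    · rw [pderiv_inr_resExp, Derivation.map_one_eq_zero, h0, zero_sub, map_neg, neg_eq_zero]
      exact_mod_cast hβ (k + (2 * n + 1))

theorem one_sq_eq : (1 : ℂ) ^ 2 = 1 := one_pow 2

theorem neg_one_sq_eq : (-1 : ℂ) ^ 2 = 1 := neg_one_sq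

/-- Taylor's formula for an eigenfunction, expanded at `t'`. -/
theorem resExp_resolvent_inr (k : ℕ) {f : Fn} (hf : IsEigen f) :
    resExp (k - 1) (resolvent Sum.inr (-1) f) = left (dx k f) := by
  rw [← sub_eq_zero]
  refine eq_zero_of_pderiv (I := ℕ × {f : Fn // IsEigen f})
    (fun p => resExp (p.1 - 1) (resolvent Sum.inr (-1) p.2.1) - left (dx p.1 p.2.1)) ?_ ?_
    (k, ⟨f, hf⟩)
  · rintro ⟨k, f, hf⟩
    rw [map_sub, constantCoeff_resExp, sub_add_cancel, if_pos (by omega), Int.toNat_natCast,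
      zcoeff_resolvent _ Sum.inr_injective neg_one_sq_eq hf, neg_neg, one_pow, one_smul,
      constantCoeff_emb _ Sum.inr_injective, left_eq, constantCoeff_emb _ Sum.inl_injective,
      sub_self]
  · rintro ⟨k, f, hf⟩ (n | n) β hβ
    · have h1 := hβ (k + (2 * n + 1), ⟨f, hf⟩)
      rw [map_sub, pderiv_inl_resExp, pderiv_resolvent_of_ne _ Sum.inr_injective _ _ (by simp),
        show resExp ((k : ℤ) - 1) 0 = 0 from map_zero (resExpHom _), zero_add, left_eq,
        pderiv_emb _ Sum.inl_injective, dt_dx, hf n, dx_dx]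
      push_cast at h1
      rw [show (k : ℤ) - 1 + (2 * n + 1) = k + (2 * n + 1) - 1 by ring]
      exact h1
    · have h1 := hβ (k + (2 * n + 1), ⟨f, hf⟩)
      have h2 := hβ (k, ⟨dx (2 * n + 1) f, hf.dx _⟩)
      rw [map_sub, pderiv_inr_resExp, pderiv_resolvent _ Sum.inr_injective, hf n, left_eq,
        pderiv_emb_of_ne _ Sum.inl_injective _ (by simp)]
      have h3 := congrArg₂ (· - ·) h2 h1
      simp only [sub_self, ← map_sub, dx_dx] at h3
      rw [← h3]
      congr 1
      push_cast
      rw [show (k : ℤ) - 1 + (2 * n + 1) = k + (2 * n + 1) - 1 by ring]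
      ring

/-- Taylor's formula for an eigenfunction, expanded at `t`. -/
theorem resExp_resolvent_inl (k : ℕ) {f : Fn} (hf : IsEigen f) :
    resExp (k - 1) (resolvent Sum.inl 1 f) = (-1) ^ k * right (dx k f) := by
  rw [← sub_eq_zero]
  refine eq_zero_of_pderiv (I := ℕ × {f : Fn // IsEigen f})
    (fun p => resExp (p.1 - 1) (resolvent Sum.inl 1 p.2.1) - (-1) ^ p.1 * right (dx p.1 p.2.1))
    ?_ ?_ (k, ⟨f, hf⟩)
  · rintro ⟨k, f, hf⟩
    rw [map_sub, constantCoeff_resExp, sub_add_cancel, if_pos (by omega), Int.toNat_natCast,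
      zcoeff_resolvent _ Sum.inl_injective one_sq_eq hf, smul_eq_C_mul, map_mul, map_mul,
      constantCoeff_emb _ Sum.inl_injective, right_eq, constantCoeff_emb _ Sum.inr_injective]
    simp
  · have hD : ∀ (k : ℕ) (v : ℕ ⊕ ℕ) (g : Fn₂),
        pderiv ℂ v ((-1) ^ k * g) = (-1) ^ k * pderiv ℂ v g := by
      intro k v g
      rw [show ((-1 : Fn₂) ^ k) = C ((-1) ^ k) by simp, Derivation.leibniz, pderiv_C]
      simp
    rintro ⟨k, f, hf⟩ (n | n) β hβ
    · have h1 := hβ (k + (2 * n + 1), ⟨f, hf⟩)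
      have h2 := hβ (k, ⟨dx (2 * n + 1) f, hf.dx _⟩)
      rw [map_sub, pderiv_inl_resExp, pderiv_resolvent _ Sum.inl_injective, hf n, hD, right_eq,
        pderiv_emb_of_ne _ Sum.inr_injective _ (by simp)]
      have h3 := congrArg₂ (· + ·) h2 h1
      simp only [add_zero, ← map_add, dx_dx] at h3
      rw [← h3]
      congr 1
      push_cast
      rw [show (k : ℤ) - 1 + (2 * n + 1) = k + (2 * n + 1) - 1 by ring,
        pow_add (-1 : Fn₂) k (2 * n + 1), pow_succ, pow_mul, neg_one_sq, one_pow]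
      ring
    · have h1 := hβ (k + (2 * n + 1), ⟨f, hf⟩)
      rw [map_sub, pderiv_inr_resExp, pderiv_resolvent_of_ne _ Sum.inl_injective _ _ (by simp),
        show resExp ((k : ℤ) - 1) 0 = 0 from map_zero (resExpHom _), zero_sub, hD, right_eq,
        pderiv_emb _ Sum.inr_injective, dt_dx, hf n, dx_dx]
      rw [← neg_eq_zero, ← map_neg] at h1
      rw [← h1]
      congr 1
      push_cast
      rw [show (k : ℤ) - 1 + (2 * n + 1) = k + (2 * n + 1) - 1 by ring,
        pow_add (-1 : Fn₂) k (2 * n + 1), pow_succ, pow_mul, neg_one_sq, one_pow, ← right_eq]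
      ring

/-- The residue of a product of two resolvents is a difference of potentials. Both sides have the
same derivatives in `t` and in `t'`, and the normalization `hn` of the potentials makes them agree
at the base point. -/
theorem resExp_resolvent_mul (k : ℕ) {f g B B' : Fn} (hf : IsEigen f) (hg : IsEigen g)
    (hB : ∀ n, dt n B = sepRes (2 * n + 1) f (dx k g))
    (hB' : ∀ n, dt n B' = sepRes (2 * n + 1) (dx k f) g)
    (hn : B' - (-1 : ℤ) ^ k • B = sepRes k f g) :
    resExp (k - 2) (resolvent Sum.inl 1 f * resolvent Sum.inr (-1) g) =
      left B - (-1) ^ k * right B' := by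
  have hD : ∀ (v : ℕ ⊕ ℕ) (g : Fn₂), pderiv ℂ v ((-1) ^ k * g) = (-1) ^ k * pderiv ℂ v g := by
    intro v g
    rw [show ((-1 : Fn₂) ^ k) = C ((-1) ^ k) by simp, Derivation.leibniz, pderiv_C]
    simp
  have hpow : ∀ l n : ℕ, l ≤ 2 * n → (-1 : Fn) ^ (2 * n - l) = (-1) ^ l := by
    intro l n hl
    rw [neg_one_pow_eq_pow_mod_two, neg_one_pow_eq_pow_mod_two (n := l)]
    congr 1
    omega
  rw [← sub_eq_zero]
  refine eq_zero_of_pderiv (I := Unit) (fun _ => _ - _) (fun _ => ?_) (fun _ v β _ => ?_) ()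
  · rw [map_sub, map_sub, map_mul, left_eq, right_eq, constantCoeff_emb _ Sum.inl_injective,
      constantCoeff_emb _ Sum.inr_injective, sub_eq_zero]
    have hn' := congrArg constantCoeff hn
    rw [sepRes_eq, map_sub, map_sum, map_zsmul] at hn'
    simp only [zsmul_eq_mul, Int.cast_pow, Int.cast_neg, Int.cast_one] at hn'
    have hsq : ((-1 : ℂ) ^ k) * (-1) ^ k = 1 := by
      rw [← mul_pow]; norm_num
    have hrhs : constantCoeff B - constantCoeff ((-1 : Fn₂) ^ k) * constantCoeff B' =
        -(-1) ^ k * (constantCoeff B' - (-1) ^ k * constantCoeff B) := by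
      rw [map_pow, map_neg, map_one]
      linear_combination -constantCoeff B * hsq
    rw [hrhs, hn', constantCoeff_resExp]
    rcases k with _ | k
    · rw [if_neg (by norm_num)]; simp
    · rw [if_pos (by push_cast; omega),
        show ((k + 1 : ℕ) - 2 + 1 : ℤ).toNat = k by push_cast; omega,
        zcoeff, map_mul (zexp _), PowerSeries.coeff_mul, map_sum, Finset.mul_sum,
        Finset.Nat.sum_antidiagonal_eq_sum_range_succ_mk]
      refine Finset.sum_congr rfl fun l hl => ?_
      have hl' := Finset.mem_range.mp hl
      rw [show PowerSeries.coeff _ (zexp _ (resolvent Sum.inl 1 f)) = _ from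
        zcoeff_resolvent _ Sum.inl_injective one_sq_eq hf _,
        show PowerSeries.coeff _ (zexp _ (resolvent Sum.inr (-1) g)) = _ from
        zcoeff_resolvent _ Sum.inr_injective neg_one_sq_eq hg _, smul_eq_C_mul, smul_eq_C_mul]
      simp only [map_mul, map_pow, map_neg, map_one, neg_neg, one_pow, one_mul]
      rw [constantCoeff_emb _ Sum.inl_injective, constantCoeff_emb _ Sum.inr_injective,
        add_tsub_cancel_right, ← mul_assoc (-(-1 : ℂ) ^ (k + 1))]
      have : -(-1 : ℂ) ^ (k + 1) * (-1) ^ (k - l) = (-1) ^ l := by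
        rw [neg_mul, ← pow_add, neg_one_pow_eq_pow_mod_two, neg_one_pow_eq_pow_mod_two (n := l),
          show (k + 1 + (k - l)) % 2 = (l + 1) % 2 by omega, ← neg_one_pow_eq_pow_mod_two,
          ← neg_one_pow_eq_pow_mod_two]
        ring
      rw [this]
      ring
  · suffices h : pderiv ℂ v (resExp (k - 2) (resolvent Sum.inl 1 f * resolvent Sum.inr (-1) g) -
        (left B - (-1) ^ k * right B')) = 0 by rw [h, map_zero]
    rcases v with n | n
    · have hexp := resolvent_expand (Sum.inl : ℕ → ℕ ⊕ ℕ) Sum.inl_injective one_sq_eq hf (2 * n + 1)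
      have key : resExp (k - 2) (resolvent Sum.inl 1 (dx (2 * n + 1) f) * resolvent Sum.inr (-1) g)
          + resExp (k - 2 + (2 * n + 1)) (resolvent Sum.inl 1 f * resolvent Sum.inr (-1) g) =
          left (sepRes (2 * n + 1) f (dx k g)) := by
        have h1 : resolvent Sum.inl 1 f * resolvent Sum.inr (-1) g =
            (∑ l ∈ Finset.range (2 * n + 1), zvar _ ^ l * (shiftBy Sum.inl 0 ((-1) ^ l * dx l f) *
              resolvent Sum.inr (-1) g)) - zvar _ ^ (2 * n + 1) *
              (resolvent Sum.inl 1 (dx (2 * n + 1) f) * resolvent Sum.inr (-1) g) := by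
          rw [hexp, add_mul, Finset.sum_mul, sub_eq_add_neg]
          congr 1
          · refine Finset.sum_congr rfl fun l _ => ?_
            rw [← shiftHom_apply _ Sum.inl_injective 0 ((-1) ^ l * dx l f), map_mul,
              shiftHom_apply _ _ 0 (dx l f), map_pow, map_neg, map_one, map_pow, map_neg, map_one]
            ring
          · rw [pow_succ, pow_mul, neg_one_sq, one_pow, one_mul, map_neg, map_one]
            ring
        rw [h1, resExp_sub, resExp_zvar_pow_mul, resExp_sum]
        push_cast
        rw [add_sub_cancel_right, add_sub_cancel, sepRes_eq, ← embHom_inl, map_sum]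
        refine Finset.sum_congr rfl fun l hl => ?_
        have hl' := Finset.mem_range.mp hl
        rw [resExp_zvar_pow_mul, resExp_left_mul,
          show (k : ℤ) - 2 + (2 * n + 1) - l = ((2 * n - l + k : ℕ) : ℤ) - 1 by
            push_cast [show l ≤ 2 * n by omega]; ring, resExp_resolvent_inr _ hg, dx_dx,
          show 2 * n + 1 - 1 - l = 2 * n - l by omega, hpow l n (by omega), ← mul_assoc,
          map_mul (embHom Sum.inl Sum.inl_injective) _ (dx (2 * n - l + k) g), embHom_inl,
          embHom_inl]
      rw [map_sub, map_sub, pderiv_inl_resExp, Derivation.leibniz, hD, left_eq, right_eq,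
        pderiv_emb _ Sum.inl_injective, pderiv_emb_of_ne _ Sum.inr_injective _ (by simp),
        pderiv_resolvent _ Sum.inl_injective,
        pderiv_resolvent_of_ne _ Sum.inr_injective _ _ (by simp), hf n, hB, smul_zero, zero_add,
        smul_eq_mul, mul_comm (resolvent Sum.inr (-1) g), key, mul_zero, sub_zero, left_eq,
        sub_self]
    · have hexp := resolvent_expand (Sum.inr : ℕ → ℕ ⊕ ℕ) Sum.inr_injective neg_one_sq_eq hg
        (2 * n + 1)
      have key : resExp (k - 2) (resolvent Sum.inl 1 f * resolvent Sum.inr (-1) (dx (2 * n + 1) g))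
          - resExp (k - 2 + (2 * n + 1)) (resolvent Sum.inl 1 f * resolvent Sum.inr (-1) g) =
          -((-1) ^ k * right (sepRes (2 * n + 1) (dx k f) g)) := by
        have h1 : resolvent Sum.inl 1 f * resolvent Sum.inr (-1) g =
            (∑ l ∈ Finset.range (2 * n + 1), zvar _ ^ l * (shiftBy Sum.inr 0 (dx l g) *
              resolvent Sum.inl 1 f)) + zvar _ ^ (2 * n + 1) *
              (resolvent Sum.inl 1 f * resolvent Sum.inr (-1) (dx (2 * n + 1) g)) := by
          rw [hexp, mul_add, Finset.mul_sum]
          simp only [neg_neg, one_pow, map_one, one_mul]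
          congr 1
          · exact Finset.sum_congr rfl fun l _ => by ring
          · ring
        rw [h1, resExp_add, resExp_zvar_pow_mul, resExp_sum]
        push_cast
        rw [add_sub_cancel_right, sub_add_cancel_right, sepRes_eq, ← embHom_inr, map_sum,
          Finset.mul_sum, ← Finset.sum_range_reflect]
        congr 1
        refine Finset.sum_congr rfl fun l hl => ?_
        have hl' := Finset.mem_range.mp hl
        rw [resExp_zvar_pow_mul, resExp_right_mul, show 2 * n + 1 - 1 - l = 2 * n - l by omega,
          show (k : ℤ) - 2 + (2 * n + 1) - ((2 * n - l : ℕ) : ℤ) = ((l + k : ℕ) : ℤ) - 1 by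
            push_cast [show l ≤ 2 * n by omega]; ring, resExp_resolvent_inl _ hf, dx_dx,
          hpow l n (by omega)]
        simp only [map_mul, map_pow, map_neg, map_one, embHom_inr]
        ring
      rw [map_sub, map_sub, pderiv_inr_resExp, Derivation.leibniz, hD, left_eq, right_eq,
        pderiv_emb _ Sum.inr_injective, pderiv_emb_of_ne _ Sum.inl_injective _ (by simp),
        pderiv_resolvent _ Sum.inr_injective,
        pderiv_resolvent_of_ne _ Sum.inl_injective _ _ (by simp), hg n, hB', smul_zero, add_zero,
        smul_eq_mul, key, right_eq]
      ring

/-! ### The bilinear equations -/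

namespace IsGram

variable {ι : Type*} [Fintype ι] [DecidableEq ι] {H : ι → Fn} {G : Matrix ι ι Fn}

theorem wave_inl : wave (Sum.inl : ℕ → ℕ ⊕ ℕ) 1 H G =
    1 - zvar _ * ∑ i, shiftBy Sum.inl 0 (adjWave H G i) * resolvent Sum.inl 1 (H i) := by
  rw [wave, map_one, one_mul, dotProduct]
  simp only [Function.comp, mul_comm]

theorem wave_inr : wave (Sum.inr : ℕ → ℕ ⊕ ℕ) (-1) H G =
    1 + zvar _ * ∑ i, shiftBy Sum.inr 0 (adjWave H G i) * resolvent Sum.inr (-1) (H i) := by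
  rw [wave, map_neg, map_one, neg_mul, one_mul, neg_mul, sub_neg_eq_add, dotProduct]
  simp only [Function.comp, mul_comm]

theorem left_sum {κ : Type*} (S : Finset κ) (f : κ → Fn) :
    left (∑ i ∈ S, f i) = ∑ i ∈ S, left (f i) := by
  simp only [← embHom_inl, map_sum]

theorem right_sum {κ : Type*} (S : Finset κ) (f : κ → Fn) :
    right (∑ i ∈ S, f i) = ∑ i ∈ S, right (f i) := by
  simp only [← embHom_inr, map_sum]

theorem left_mul (f g : Fn) : left (f * g) = left f * left g := by
  simp only [← embHom_inl, map_mul]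

theorem right_mul (f g : Fn) : right (f * g) = right f * right g := by
  simp only [← embHom_inr, map_mul]

theorem left_sub (f g : Fn) : left (f - g) = left f - left g := by
  simp only [← embHom_inl, map_sub]

theorem right_sub (f g : Fn) : right (f - g) = right f - right g := by
  simp only [← embHom_inr, map_sub]

/-- `a G = H`, for `a = G⁻¹ H`. -/
theorem sum_adjWave_mul (hG : IsGram H G) (j : ι) : ∑ i, adjWave H G i * G i j = H j := by
  have h : adjWave H G ᵥ* G = H := by
    rw [adjWave, ← hG.inv_symm, mulVec_transpose, vecMul_vecMul, hG.inv_mul, vecMul_one]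
  exact congrFun h j

/-- The residue of the product of the wave functions at `(t, λ)` and `(t', -λ)`. -/
theorem resExp_wave_mul (hG : IsGram H G) (k : ℕ) {B : Matrix ι ι Fn}
    (hB : ∀ i j n, dt n (B i j) = sepRes (2 * n + 1) (H i) (dx k (H j)))
    (hB' : ∀ i j n, dt n (B i j) = sepRes (2 * n + 1) (dx k (H j)) (H i))
    (hn : ∀ i j, B j i - (-1 : ℤ) ^ k • B i j = sepRes k (H i) (H j)) :
    resExp k (wave Sum.inl 1 H G * wave Sum.inr (-1) H G) =
      ∑ m, (left (transform H G (dx k (H m)) fun i => B i m) * right (adjWave H G m) -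
        (-1) ^ k * left (adjWave H G m) * right (transform H G (dx k (H m)) fun i => B i m)) := by
  set a := adjWave H G
  have hX : ∑ i, resExp (k - 1) (shiftBy Sum.inl 0 (a i) * resolvent Sum.inl 1 (H i)) =
      ∑ i, (-1) ^ k * left (a i) * right (dx k (H i)) := by
    refine Finset.sum_congr rfl fun i _ => ?_
    rw [resExp_left_mul, resExp_resolvent_inl _ (hG.eigen i)]
    ring
  have hY : ∑ i, resExp (k - 1) (shiftBy Sum.inr 0 (a i) * resolvent Sum.inr (-1) (H i)) =
      ∑ i, left (dx k (H i)) * right (a i) := by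
    refine Finset.sum_congr rfl fun i _ => ?_
    rw [resExp_right_mul, resExp_resolvent_inr _ (hG.eigen i), mul_comm]
  have hXY : ∀ i j, resExp (k - 2) ((shiftBy Sum.inl 0 (a i) * resolvent Sum.inl 1 (H i)) *
        (shiftBy Sum.inr 0 (a j) * resolvent Sum.inr (-1) (H j))) =
      left (a i) * left (B i j) * right (a j) -
        (-1) ^ k * left (a i) * (right (a j) * right (B j i)) := by
    intro i j
    have : (shiftBy Sum.inl 0 (a i) * resolvent Sum.inl 1 (H i)) *
        (shiftBy Sum.inr 0 (a j) * resolvent Sum.inr (-1) (H j)) =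
        shiftBy Sum.inl 0 (a i) * (shiftBy Sum.inr 0 (a j) *
          (resolvent Sum.inl 1 (H i) * resolvent Sum.inr (-1) (H j))) := by ring
    rw [this, resExp_left_mul, resExp_right_mul, resExp_resolvent_mul k (hG.eigen i) (hG.eigen j)
      (hB i j) (hB' j i) (hn i j)]
    ring
  have hexp : wave Sum.inl 1 H G * wave Sum.inr (-1) H G = 1 -
      zvar _ * ∑ i, shiftBy Sum.inl 0 (a i) * resolvent Sum.inl 1 (H i) +
      zvar _ * ∑ i, shiftBy Sum.inr 0 (a i) * resolvent Sum.inr (-1) (H i) -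
      zvar _ ^ 2 * ∑ i, ∑ j, (shiftBy Sum.inl 0 (a i) * resolvent Sum.inl 1 (H i)) *
        (shiftBy Sum.inr 0 (a j) * resolvent Sum.inr (-1) (H j)) := by
    rw [wave_inl, wave_inr, ← Finset.sum_mul_sum]
    ring
  rw [hexp, resExp_sub, resExp_add, resExp_sub, resExp_one, resExp_zvar_mul, resExp_zvar_mul,
    resExp_zvar_pow_mul, resExp_sum, resExp_sum, resExp_sum, Nat.cast_ofNat, hX, hY]
  simp only [resExp_sum, hXY]
  have hl : ∀ m, left (transform H G (dx k (H m)) fun i => B i m) =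
      left (dx k (H m)) - ∑ i, left (a i) * left (B i m) := by
    intro m
    rw [transform, left_sub, dotProduct, left_sum]
    simp only [left_mul]
    rfl
  have hr : ∀ m, right (transform H G (dx k (H m)) fun i => B i m) =
      right (dx k (H m)) - ∑ i, right (a i) * right (B i m) := by
    intro m
    rw [transform, right_sub, dotProduct, right_sum]
    simp only [right_mul]
    rfl
  simp only [hl, hr, sub_mul, mul_sub, Finset.sum_sub_distrib, Finset.sum_mul, Finset.mul_sum]
  rw [Finset.sum_comm (f := fun i j => left (a i) * left (B i j) * right (a j))]
  ring

/-- The wave function reproduces `a = G⁻¹ h`. -/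
theorem resExp_wave_mul_adjResolvent (hG : IsGram H G) (p : ι) :
    resExp (-1) (wave Sum.inl 1 H G * adjResolvent Sum.inr (-1) H G p) =
      left (adjWave H G p) := by
  set a := adjWave H G with ha
  have h1 : ∀ j, resExp (-1) (resolvent Sum.inr (-1) (H j)) = left (H j) := by
    intro j
    have := resExp_resolvent_inr 0 (hG.eigen j)
    simpa using this
  have h2 : ∀ i j, resExp (-2) (resolvent Sum.inl 1 (H i) * resolvent Sum.inr (-1) (H j)) =
      left (G i j) - right (G i j) := by
    intro i j
    have := resExp_resolvent_mul 0 (B := G i j) (B' := G i j) (hG.eigen i) (hG.eigen j)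
      (hG.flow i j) (hG.flow i j) (by rw [sepRes_eq]; simp)
    simpa using this
  have hexp : wave Sum.inl 1 H G * adjResolvent Sum.inr (-1) H G p =
      ∑ j, shiftBy Sum.inr 0 (G⁻¹ p j) * (resolvent Sum.inr (-1) (H j) -
        zvar _ * ∑ i, shiftBy Sum.inl 0 (a i) *
          (resolvent Sum.inl 1 (H i) * resolvent Sum.inr (-1) (H j))) := by
    rw [wave_inl, adjResolvent, mulVec, dotProduct, Finset.mul_sum]
    refine Finset.sum_congr rfl fun j _ => ?_
    simp only [map_apply, Function.comp, ← mul_assoc, ← Finset.sum_mul]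
    ring
  rw [hexp, resExp_sum]
  simp only [resExp_right_mul, resExp_sub, resExp_zvar_mul, resExp_sum, resExp_left_mul, h1]
  norm_num
  simp only [h2]
  have h3 : ∀ j, ∑ i, left (a i) * left (G i j) = left (H j) := by
    intro j
    rw [← hG.sum_adjWave_mul j, left_sum]
    simp only [left_mul]
    rfl
  simp only [mul_sub, Finset.sum_sub_distrib, h3, sub_sub_cancel]
  have h4 : ∀ i, ∑ j, right (G⁻¹ p j) * right (G i j) = if p = i then 1 else 0 := by
    intro i
    have := congrArg right (congrFun (congrFun hG.inv_mul p) i)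
    rw [Matrix.mul_apply, right_sum, Matrix.one_apply] at this
    simp only [right_mul] at this
    have h5 : ∀ j, G i j = G j i := fun j => hG.symm.apply j i
    simp only [h5]
    rw [this]
    split_ifs
    · rw [← embHom_inr, map_one]
    · rw [← embHom_inr, map_zero]
  simp only [Finset.mul_sum]
  rw [Finset.sum_comm]
  have h5 : ∀ i, ∑ j, right (G⁻¹ p j) * (left (a i) * right (G i j)) =
      left (a i) * if p = i then 1 else 0 := by
    intro i
    rw [← h4, Finset.mul_sum]
    exact Finset.sum_congr rfl fun j _ => by ring
  simp [h5]

/-- The wave function reproduces the transform of an eigenfunction. -/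
theorem resExp_wave_mul_transform (hG : IsGram H G) {u : Fn} (hu : IsEigen u) {v : ι → Fn}
    (hv : ∀ i n, dt n (v i) = sepRes (2 * n + 1) (H i) u) :
    resExp (-1) (wave Sum.inl 1 H G *
        (resolvent Sum.inr (-1) u - adjResolvent Sum.inr (-1) H G ⬝ᵥ shiftBy Sum.inr 0 ∘ v)) =
      left (transform H G u v) := by
  set a := adjWave H G with ha
  have h1 : resExp (-1) (resolvent Sum.inr (-1) u) = left u := by
    have := resExp_resolvent_inr 0 hu
    simpa using this
  have h2 : ∀ i, resExp (-2) (resolvent Sum.inl 1 (H i) * resolvent Sum.inr (-1) u) =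
      left (v i) - right (v i) := by
    intro i
    have := resExp_resolvent_mul 0 (B := v i) (B' := v i) (hG.eigen i) hu
      (hv i) (hv i) (by rw [sepRes_eq]; simp)
    simpa using this
  have hexp : wave Sum.inl 1 H G *
        (resolvent Sum.inr (-1) u - adjResolvent Sum.inr (-1) H G ⬝ᵥ shiftBy Sum.inr 0 ∘ v) =
      resolvent Sum.inr (-1) u - zvar _ * ∑ i, shiftBy Sum.inl 0 (a i) *
          (resolvent Sum.inl 1 (H i) * resolvent Sum.inr (-1) u) -
      ∑ p, shiftBy Sum.inr 0 (v p) * (wave Sum.inl 1 H G * adjResolvent Sum.inr (-1) H G p) := by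
    have e1 : ∑ p, shiftBy Sum.inr 0 (v p) *
        (wave Sum.inl 1 H G * adjResolvent Sum.inr (-1) H G p) =
        wave Sum.inl 1 H G * (adjResolvent Sum.inr (-1) H G ⬝ᵥ shiftBy Sum.inr 0 ∘ v) := by
      rw [dotProduct, Finset.mul_sum]
      exact Finset.sum_congr rfl fun p _ => by simp only [Function.comp]; ring
    rw [e1, mul_sub]
    congr 1
    rw [wave_inl]
    simp only [← mul_assoc, ← Finset.sum_mul]
    ring
  rw [hexp, resExp_sub, resExp_sub, resExp_zvar_mul, resExp_sum, resExp_sum]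
  simp only [resExp_right_mul, resExp_left_mul, hG.resExp_wave_mul_adjResolvent, h1]
  norm_num
  simp only [h2]
  rw [transform, left_sub, dotProduct, left_sum]
  simp only [left_mul, mul_sub, Finset.sum_sub_distrib, ← ha]
  have : ∑ i, left (a i) * right (v i) = ∑ i, right (v i) * left (a i) :=
    Finset.sum_congr rfl fun i _ => mul_comm _ _
  rw [this]
  ring

variable {τ : Fn}

theorem fsqrt_phi_mul_shift (hG : IsGram H G) (hτ : τ ^ 2 = G.det) {σ : Type} {s : ℕ → σ}
    (hs : Function.Injective s) {ε : ℂ} (hε : ε ^ 2 = 1) :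
    fsqrt (phi s ε τ) * shiftBy s (-2 * ε) τ = wave s ε H G * shiftBy s 0 τ := by
  have h0 : constantCoeff (shiftBy s 0 τ) ≠ 0 := by
    rw [constantCoeff_shiftBy s hs]; exact hG.constantCoeff_tau hτ
  rw [← hG.fsqrt_phi_mul hs hε hτ, mul_assoc, mul_assoc, MvPowerSeries.inv_mul_cancel _ h0, mul_one]

/-- The first bilinear equation, with the sum over all seeds. -/
theorem bilinear_one (hG : IsGram H G) (hτ : τ ^ 2 = G.det) (k : ℕ) {B : Matrix ι ι Fn}
    (hB : ∀ i j n, dt n (B i j) = sepRes (2 * n + 1) (H i) (dx k (H j)))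
    (hB' : ∀ i j n, dt n (B i j) = sepRes (2 * n + 1) (dx k (H j)) (H i))
    (hn : ∀ i j, B j i - (-1 : ℤ) ^ k • B i j = sepRes k (H i) (H j)) :
    resLam (C (lamPow k) *
      toFnL (fsqrt (phi Sum.inl 1 τ * phi Sum.inr (-1) τ) *
        shiftBy Sum.inl (-2) τ * shiftBy Sum.inr 2 τ) * expXiDiff) =
      left τ * right τ *
      ∑ m, (left (transform H G (dx k (H m)) fun i => B i m) * right (adjWave H G m) -
        (-1) ^ k * left (adjWave H G m) * right (transform H G (dx k (H m)) fun i => B i m)) := by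
  have h1 := hG.fsqrt_phi_mul_shift hτ (Sum.inl_injective (α := ℕ) (β := ℕ)) one_sq_eq
  have h2 := hG.fsqrt_phi_mul_shift hτ (Sum.inr_injective (α := ℕ) (β := ℕ)) neg_one_sq_eq
  rw [show (-2 * 1 : ℂ) = -2 by norm_num] at h1
  rw [show (-2 * -1 : ℂ) = 2 by norm_num] at h2
  have h3 : fsqrt (phi Sum.inl 1 τ * phi Sum.inr (-1) τ) =
      fsqrt (phi (Sum.inl : ℕ → ℕ ⊕ ℕ) 1 τ) * fsqrt (phi Sum.inr (-1) τ) := by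
    apply fsqrt_eq
    · rw [mul_pow, fsqrt_sq _ (constantCoeff_phi τ), fsqrt_sq _ (constantCoeff_phi τ)]
    · rw [map_mul, constantCoeff_fsqrt (constantCoeff_phi τ),
        constantCoeff_fsqrt (constantCoeff_phi τ), one_mul]
  have h4 : fsqrt (phi Sum.inl 1 τ * phi Sum.inr (-1) τ) *
        shiftBy Sum.inl (-2) τ * shiftBy Sum.inr 2 τ =
      shiftBy Sum.inl 0 τ * (shiftBy Sum.inr 0 τ *
        (wave Sum.inl 1 H G * wave Sum.inr (-1) H G)) := by
    rw [h3]
    linear_combination (fsqrt (phi Sum.inr (-1) τ) * shiftBy Sum.inr 2 τ) * h1 +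
      (wave Sum.inl 1 H G * shiftBy Sum.inl 0 τ) * h2
  rw [h4, ← hG.resExp_wave_mul k hB hB' hn, mul_assoc (left τ), ← resExp_right_mul,
    ← resExp_left_mul]
  rfl

/-- The second bilinear equation, for `q` such that the sum of `q` and its shift is, up to the ratio
of determinants, the wave function times a series `2Q`, where the wave function at `t` reproduces
`q` from `Q`. -/
theorem bilinear_two (hG : IsGram H G) (hτ : τ ^ 2 = G.det) {q : Fn} {Q : FnZ (ℕ ⊕ ℕ)}
    (hQ : shiftRatio Sum.inr (-1) H G * (shiftBy Sum.inr (-2 * -1) q + shiftBy Sum.inr 0 q) =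
      2 * wave Sum.inr (-1) H G * Q)
    (hres : resExp (-1) (wave Sum.inl 1 H G * Q) = left q) : Bilinear₂ τ (q * τ) := by
  have h1 := hG.fsqrt_phi_mul_shift hτ (Sum.inl_injective (α := ℕ) (β := ℕ)) one_sq_eq
  have h2 := hG.tau_mul_shift_add (Sum.inr_injective (α := ℕ) (β := ℕ)) neg_one_sq_eq hτ hQ
  rw [show (-2 * 1 : ℂ) = -2 by norm_num] at h1
  rw [show (-2 * -1 : ℂ) = 2 by norm_num] at h2
  have hφ : fsqrt (phi (Sum.inr : ℕ → ℕ ⊕ ℕ) (-1) τ) * (fsqrt (phi Sum.inr (-1) τ))⁻¹ = 1 :=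
    MvPowerSeries.mul_inv_cancel _
      (by rw [constantCoeff_fsqrt (constantCoeff_phi τ)]; norm_num)
  have h3 : fsqrt (phi Sum.inl 1 τ * (phi Sum.inr (-1) τ)⁻¹) =
      fsqrt (phi (Sum.inl : ℕ → ℕ ⊕ ℕ) 1 τ) * (fsqrt (phi Sum.inr (-1) τ))⁻¹ := by
    apply fsqrt_eq
    · rw [mul_pow, fsqrt_sq _ (constantCoeff_phi τ)]
      congr 1
      rw [MvPowerSeries.eq_inv_iff_mul_eq_one (by rw [constantCoeff_phi τ]; norm_num)]
      have hsq := fsqrt_sq (phi (Sum.inr : ℕ → ℕ ⊕ ℕ) (-1) τ) (constantCoeff_phi τ)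
      linear_combination (fsqrt (phi Sum.inr (-1) τ) * (fsqrt (phi Sum.inr (-1) τ))⁻¹ + 1) * hφ -
        (fsqrt (phi Sum.inr (-1) τ))⁻¹ ^ 2 * hsq
    · rw [map_mul, constantCoeff_inv, constantCoeff_fsqrt (constantCoeff_phi τ),
        constantCoeff_fsqrt (constantCoeff_phi τ), inv_one, one_mul]
  have hmul : ∀ c : ℂ, shiftBy (Sum.inr : ℕ → ℕ ⊕ ℕ) c (q * τ) =
      shiftBy Sum.inr c q * shiftBy Sum.inr c τ := by
    intro c
    simp only [← shiftHom_apply _ Sum.inr_injective, map_mul]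
  have h4 : fsqrt (phi Sum.inl 1 τ * (phi Sum.inr (-1) τ)⁻¹) * shiftBy Sum.inl (-2) τ *
        (shiftBy Sum.inr 0 τ * shiftBy Sum.inr 2 (q * τ) +
          shiftBy Sum.inr 0 (q * τ) * shiftBy Sum.inr 2 τ) =
      shiftBy Sum.inl 0 τ * (shiftBy Sum.inr 0 τ * (shiftBy Sum.inr 0 τ *
        (wave Sum.inl 1 H G * Q + wave Sum.inl 1 H G * Q))) := by
    rw [h3, hmul, hmul]
    linear_combination ((fsqrt (phi Sum.inr (-1) τ))⁻¹ * shiftBy Sum.inr 0 τ *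
      shiftBy Sum.inr 2 τ * (shiftBy Sum.inr 2 q + shiftBy Sum.inr 0 q)) * h1 +
      (wave Sum.inl 1 H G * shiftBy Sum.inl 0 τ * shiftBy Sum.inr 0 τ) * h2
  have h5 : 2 * left (q * τ) * right τ ^ 2 = left τ * (right τ * (right τ *
      (resExp (-1) (wave Sum.inl 1 H G * Q) + resExp (-1) (wave Sum.inl 1 H G * Q)))) := by
    rw [hres, left_mul]
    ring
  rw [Bilinear₂, h5, ← resExp_add, ← resExp_right_mul, ← resExp_right_mul, ← resExp_left_mul, ← h4]
  exact congrArg resLam (mul_right_comm _ _ _)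

end IsGram

end

section

open MvPowerSeries

/-! ### The ring of pseudo-differential operators of bounded order -/

/-- Pseudo-differential operators of bounded order. On these the product `pmul` is a finite sum in
each coefficient. -/
def boundedPDO : AddSubgroup PDO where
  carrier := {a | ∃ A : ℤ, ∀ i, A < i → a i = 0}
  zero_mem' := ⟨0, fun _ _ => rfl⟩
  add_mem' := by
    rintro a b ⟨A, hA⟩ ⟨B, hB⟩
    refine ⟨max A B, fun i hi => ?_⟩
    rw [Pi.add_apply, hA i (lt_of_le_of_lt (le_max_left _ _) hi),
      hB i (lt_of_le_of_lt (le_max_right _ _) hi), add_zero]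
  neg_mem' := by
    rintro a ⟨A, hA⟩
    exact ⟨A, fun i hi => by rw [Pi.neg_apply, hA i hi, neg_zero]⟩

/-- The type of pseudo-differential operators of bounded order; it is a ring under `pmul`. -/
def Psd : Type := boundedPDO

namespace Psd

instance : AddCommGroup Psd := inferInstanceAs (AddCommGroup boundedPDO)

/-- The underlying family of coefficients. -/
def toPDO (a : Psd) : PDO := a.1

@[ext]
theorem ext {a b : Psd} (h : ∀ i, a.toPDO i = b.toPDO i) : a = b := Subtype.ext (funext h)

@[simp] theorem toPDO_add (a b : Psd) (i : ℤ) : (a + b).toPDO i = a.toPDO i + b.toPDO i := rfl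
@[simp] theorem toPDO_sub (a b : Psd) (i : ℤ) : (a - b).toPDO i = a.toPDO i - b.toPDO i := rfl
@[simp] theorem toPDO_neg (a : Psd) (i : ℤ) : (-a).toPDO i = -a.toPDO i := rfl
@[simp] theorem toPDO_zero (i : ℤ) : (0 : Psd).toPDO i = 0 := rfl

/-- The coefficient of `∂^i`. -/
def coeffHom (i : ℤ) : Psd →+ Fn := ⟨⟨fun a => a.toPDO i, rfl⟩, fun _ _ => rfl⟩

theorem toPDO_sum {κ : Type*} (S : Finset κ) (f : κ → Psd) (i : ℤ) :
    (∑ j ∈ S, f j).toPDO i = ∑ j ∈ S, (f j).toPDO i := map_sum (coeffHom i) f S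

/-- `a` has order at most `A`. -/
def OrdLE (a : Psd) (A : ℤ) : Prop := ∀ i, A < i → a.toPDO i = 0

theorem exists_ordLE (a : Psd) : ∃ A, a.OrdLE A := a.2

theorem OrdLE.mono {a : Psd} {A B : ℤ} (h : a.OrdLE A) (hAB : A ≤ B) : a.OrdLE B :=
  fun i hi => h i (hAB.trans_lt hi)

theorem OrdLE.add {a b : Psd} {A : ℤ} (h : a.OrdLE A) (h' : b.OrdLE A) : (a + b).OrdLE A :=
  fun i hi => by rw [toPDO_add, h i hi, h' i hi, add_zero]

theorem OrdLE.sub {a b : Psd} {A : ℤ} (h : a.OrdLE A) (h' : b.OrdLE A) : (a - b).OrdLE A :=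
  fun i hi => by rw [toPDO_sub, h i hi, h' i hi, sub_zero]

theorem pmul_eq_zero {a b : PDO} {A B : ℤ} (ha : ∀ i, A < i → a i = 0)
    (hb : ∀ i, B < i → b i = 0) (n : ℤ) (hn : A + B < n) : pmul a b n = 0 := by
  refine finsum_eq_zero_of_forall_eq_zero fun p => ?_
  by_cases h : A < p.1
  · rw [ha _ h, zero_mul, smul_zero]
  · rw [hb _ (by omega), dx_zero, mul_zero, smul_zero]

instance : Mul Psd := ⟨fun a b => ⟨pmul a.toPDO b.toPDO, by
  obtain ⟨A, hA⟩ := a.exists_ordLE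
  obtain ⟨B, hB⟩ := b.exists_ordLE
  exact ⟨A + B, pmul_eq_zero hA hB⟩⟩⟩

theorem toPDO_mul (a b : Psd) : (a * b).toPDO = pmul a.toPDO b.toPDO := rfl

theorem OrdLE.mul {a b : Psd} {A B : ℤ} (ha : a.OrdLE A) (hb : b.OrdLE B) :
    (a * b).OrdLE (A + B) := pmul_eq_zero ha hb

theorem mul_support_finite (a b : Psd) (n : ℤ) : (Function.support fun p : ℤ × ℕ =>
    Ring.choose p.1 p.2 • (a.toPDO p.1 * dx p.2 (b.toPDO (n - p.1 + p.2)))).Finite := by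
  obtain ⟨A, hA⟩ := a.exists_ordLE
  obtain ⟨B, hB⟩ := b.exists_ordLE
  exact pmul_finite _ _ A B hA hB n

theorem dx_add (l : ℕ) (f g : Fn) : dx l (f + g) = dx l f + dx l g := map_add (dxHom l) f g

theorem mul_add' (a b c : Psd) : a * (b + c) = a * b + a * c := by
  ext1 n
  rw [toPDO_add, toPDO_mul, toPDO_mul, toPDO_mul, pmul, pmul, pmul,
    ← finsum_add_distrib (mul_support_finite a b n) (mul_support_finite a c n)]
  refine finsum_congr fun p => ?_
  rw [toPDO_add, dx_add, mul_add, smul_add]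

theorem add_mul' (a b c : Psd) : (a + b) * c = a * c + b * c := by
  ext1 n
  rw [toPDO_add, toPDO_mul, toPDO_mul, toPDO_mul, pmul, pmul, pmul,
    ← finsum_add_distrib (mul_support_finite a c n) (mul_support_finite b c n)]
  refine finsum_congr fun p => ?_
  rw [toPDO_add, add_mul, smul_add]

instance : NonUnitalNonAssocRing Psd :=
  { (inferInstance : AddCommGroup Psd), (inferInstance : Mul Psd) with
    left_distrib := mul_add'
    right_distrib := add_mul'
    zero_mul := fun a => by
      have := add_mul' 0 0 a
      rw [add_zero] at this
      exact left_eq_add.mp this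
    mul_zero := fun a => by
      have := mul_add' a 0 0
      rw [add_zero] at this
      exact left_eq_add.mp this }

/-- The operator `f ∂^i`. -/
def mono (i : ℤ) (f : Fn) : Psd := ⟨Pi.single i f, i, fun j hj => by
  rw [Pi.single_eq_of_ne hj.ne']⟩

theorem toPDO_mono (i : ℤ) (f : Fn) : (mono i f).toPDO = Pi.single i f := rfl

theorem mono_ordLE (i : ℤ) (f : Fn) : (mono i f).OrdLE i := fun j hj => by
  rw [toPDO_mono, Pi.single_eq_of_ne hj.ne']

theorem mono_add (i : ℤ) (f g : Fn) : mono i (f + g) = mono i f + mono i g := by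
  ext1 j
  rw [toPDO_add, toPDO_mono, toPDO_mono, toPDO_mono, Pi.single_add, Pi.add_apply]

/-- An additive map that shifts the order by a bounded amount is determined by its values on the
operators `f ∂^i`. -/
theorem eq_zero_of_mono (L : Psd →+ Psd) (e : ℤ) (hL : ∀ a A, OrdLE a A → OrdLE (L a) (A + e))
    (h : ∀ i f, L (mono i f) = 0) (a : Psd) : L a = 0 := by
  obtain ⟨A, hA⟩ := a.exists_ordLE
  ext1 n
  set b : Psd := ∑ i ∈ Finset.Icc (n - e) A, mono i (a.toPDO i) with hb
  have hb0 : L b = 0 := by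
    rw [hb, map_sum]
    exact Finset.sum_eq_zero fun i _ => h _ _
  have hab : OrdLE (a - b) (n - e - 1) := by
    intro i hi
    rw [toPDO_sub, hb, toPDO_sum, sub_eq_zero]
    simp only [toPDO_mono, Pi.single_apply]
    rw [Finset.sum_ite_eq]
    split_ifs with hi'
    · rfl
    · apply hA
      rw [Finset.mem_Icc] at hi'
      omega
  have := hL _ _ hab n (by omega)
  rw [map_sub, hb0, sub_zero] at this
  exact this

theorem mono_mul_apply (i : ℤ) (f : Fn) (b : Psd) (n : ℤ) : (mono i f * b).toPDO n =
    ∑ᶠ l : ℕ, Ring.choose i l • (f * dx l (b.toPDO (n - i + l))) := by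
  have hz : ∀ p : ℤ × ℕ, p.1 ≠ i → Ring.choose p.1 p.2 •
      ((mono i f).toPDO p.1 * dx p.2 (b.toPDO (n - p.1 + p.2))) = 0 := by
    intro p hp
    rw [toPDO_mono, Pi.single_eq_of_ne hp, zero_mul, smul_zero]
  have hinj : Function.Injective (fun l : ℕ => ((i, l) : ℤ × ℕ)) := by
    intro x y hxy; exact (Prod.ext_iff.mp hxy).2
  rw [toPDO_mul, pmul, ← finsum_mem_univ, finsum_mem_inter_support_eq' _ Set.univ
    (Set.range fun l : ℕ => ((i, l) : ℤ × ℕ)), finsum_mem_range hinj]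
  · refine finsum_congr fun l => ?_
    simp [toPDO_mono]
  · intro p hp
    simp only [Set.mem_univ, true_iff, Set.mem_range]
    refine ⟨p.2, Prod.ext ?_ rfl⟩
    by_contra h
    exact hp (hz p (fun h' => h h'.symm))

theorem mul_mono_apply (a : Psd) (j : ℤ) (g : Fn) (n : ℤ) : (a * mono j g).toPDO n =
    ∑ᶠ l : ℕ, Ring.choose (n - j + l) l • (a.toPDO (n - j + l) * dx l g) := by
  have hz : ∀ p : ℤ × ℕ, p.1 ≠ n - j + p.2 → Ring.choose p.1 p.2 •
      (a.toPDO p.1 * dx p.2 ((mono j g).toPDO (n - p.1 + p.2))) = 0 := by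
    intro p hp
    rw [toPDO_mono, Pi.single_eq_of_ne (by omega), dx_zero, mul_zero, smul_zero]
  have hinj : Function.Injective (fun l : ℕ => ((n - j + l, l) : ℤ × ℕ)) := by
    intro x y hxy; exact (Prod.ext_iff.mp hxy).2
  rw [toPDO_mul, pmul, ← finsum_mem_univ, finsum_mem_inter_support_eq' _ Set.univ
    (Set.range fun l : ℕ => ((n - j + l, l) : ℤ × ℕ)), finsum_mem_range hinj]
  · refine finsum_congr fun l => ?_
    have : n - (n - j + (l : ℤ)) + l = j := by ring
    rw [this, toPDO_mono, Pi.single_eq_same]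
  · intro p hp
    simp only [Set.mem_univ, true_iff, Set.mem_range]
    refine ⟨p.2, Prod.ext ?_ rfl⟩
    by_contra h
    exact hp (hz p (fun h' => h h'.symm))

theorem mono_mul_mono_apply (i j : ℤ) (f g : Fn) (l : ℕ) :
    (mono i f * mono j g).toPDO (i + j - l) = Ring.choose i l • (f * dx l g) := by
  rw [mono_mul_apply, finsum_eq_single _ l]
  · rw [show i + j - l - i + (l : ℤ) = j by ring, toPDO_mono, Pi.single_eq_same]
  · intro l' hl'
    rw [toPDO_mono, Pi.single_eq_of_ne (by omega), dx_zero, mul_zero, smul_zero]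

/-- Leibniz' rule for `∂_x^l`. -/
theorem dx_mul (l : ℕ) (f g : Fn) : dx l (f * g) =
    ∑ u ∈ Finset.range (l + 1), (l.choose u) • (dx u f * dx (l - u) g) := by
  rw [← Finset.Nat.sum_antidiagonal_eq_sum_range_succ fun i j => (l.choose i) • (dx i f * dx j g)]
  induction l with
  | zero => simp
  | succ l ih =>
    rw [Finset.sum_antidiagonal_choose_succ_nsmul (M := Fn) (fun i j => dx i f * dx j g) l,
      dx_succ, ih, dt_sum, ← Finset.sum_add_distrib]
    refine Finset.sum_congr rfl fun p hp => ?_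
    have : ∀ (n : ℕ) (h : Fn), dt 0 (n • h) = n • dt 0 h := fun n h => map_nsmul (dtDer 0) n h
    rw [this, dt_mul, ← dx_succ, ← dx_succ, smul_add, add_comm]
    congr 2
    exact Nat.choose_symm_of_eq_add (Finset.HasAntidiagonal.mem_antidiagonal.mp hp).symm

/-- The binomial identity behind associativity; after cancelling a common factor it is the
Vandermonde convolution. -/
theorem choose_mul_choose_sum (i j : ℤ) (u K : ℕ) (hu : u ≤ K) :
    ∑ q ∈ Finset.range (K + 1), Ring.choose i q * Ring.choose j (K - q) * (q.choose u : ℤ) =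
      Ring.choose i u * Ring.choose (i + j - u) (K - u) := by
  have h1 := Ring.add_choose_eq (r := i - u) (s := j) (K - u) (Commute.all _ _)
  rw [show i + j - u = i - u + j by ring, h1, Finset.Nat.sum_antidiagonal_eq_sum_range_succ_mk,
    Finset.mul_sum, show K + 1 = u + (K - u + 1) by omega, Finset.sum_range_add,
    Finset.sum_eq_zero, zero_add]
  · refine Finset.sum_congr rfl fun q hq => ?_
    have hq' := Finset.mem_range.mp hq
    have h2 := Ring.choose_smul_choose i (Nat.le_add_right u q)
    rw [add_tsub_cancel_left, nsmul_eq_mul] at h2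
    rw [show K - (u + q) = K - u - q by omega]
    linear_combination Ring.choose j (K - u - q) * h2
  · intro q hq
    rw [Nat.choose_eq_zero_of_lt (Finset.mem_range.mp hq)]
    simp

theorem mono_mul_assoc (i j s : ℤ) (f g h : Fn) :
    mono i f * mono j g * mono s h = mono i f * (mono j g * mono s h) := by
  ext1 n
  by_cases hn : i + j + s < n
  · rw [((mono_ordLE i f).mul (mono_ordLE j g)).mul (mono_ordLE s h) n hn,
      (mono_ordLE i f).mul ((mono_ordLE j g).mul (mono_ordLE s h)) n (by omega)]
  · obtain ⟨K, hK⟩ := Int.eq_ofNat_of_zero_le (show 0 ≤ i + j + s - n by omega)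
    obtain rfl : n = i + j + s - K := by omega
    have hL : (mono i f * mono j g * mono s h).toPDO (i + j + s - K) =
        ∑ u ∈ Finset.range (K + 1), (Ring.choose i u * Ring.choose (i + j - u) (K - u)) •
          (f * (dx u g * dx (K - u) h)) := by
      rw [mul_mono_apply, finsum_eq_sum_of_support_subset (s := Finset.range (K + 1)),
        ← Finset.sum_range_reflect]
      · refine Finset.sum_congr rfl fun u hu => ?_
        have hu' := Finset.mem_range.mp hu
        rw [show i + j + s - K - s + ((K + 1 - 1 - u : ℕ) : ℤ) = i + j - u by omega,
          mono_mul_mono_apply, show K + 1 - 1 - u = K - u by omega, smul_mul_assoc, smul_smul,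
          mul_assoc, mul_comm (Ring.choose i u)]
      · intro l hl
        by_contra hl'
        apply hl
        simp only [Finset.coe_range, Set.mem_Iio, not_lt] at hl'
        beta_reduce
        rw [(mono_ordLE i f).mul (mono_ordLE j g) _ (by omega), zero_mul, smul_zero]
    have hR : (mono i f * (mono j g * mono s h)).toPDO (i + j + s - K) =
        ∑ q ∈ Finset.range (K + 1), ∑ u ∈ Finset.range (K + 1),
          (Ring.choose i q * Ring.choose j (K - q) * (q.choose u : ℤ)) •
          (f * (dx u g * dx (K - u) h)) := by
      rw [mono_mul_apply, finsum_eq_sum_of_support_subset (s := Finset.range (K + 1))]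
      · refine Finset.sum_congr rfl fun q hq => ?_
        have hq' := Finset.mem_range.mp hq
        rw [show i + j + s - K - i + (q : ℤ) = j + s - ((K - q : ℕ) : ℤ) by omega,
          mono_mul_mono_apply, show dx q (Ring.choose j (K - q) • (g * dx (K - q) h)) =
            Ring.choose j (K - q) • dx q (g * dx (K - q) h) from map_zsmul (dxHom q) _ _,
          dx_mul, mul_smul_comm, smul_smul, Finset.mul_sum, Finset.smul_sum]
        have hsub : Finset.range (q + 1) ⊆ Finset.range (K + 1) := by
          intro u hu; simp only [Finset.mem_range] at *; omega
        refine (Finset.sum_subset_zero_on_sdiff hsub ?_ ?_)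
        · intro u hu
          simp only [Finset.mem_sdiff, Finset.mem_range] at hu
          rw [Nat.choose_eq_zero_of_lt (by omega)]
          simp
        · intro u hu
          have hu' := Finset.mem_range.mp hu
          rw [mul_smul_comm, ← natCast_zsmul, smul_smul, dx_dx,
            show q - u + (K - q) = K - u by omega]
      · intro l hl
        by_contra hl'
        apply hl
        simp only [Finset.coe_range, Set.mem_Iio, not_lt] at hl'
        beta_reduce
        rw [(mono_ordLE j g).mul (mono_ordLE s h) _ (by omega), dx_zero, mul_zero, smul_zero]
    rw [hL, hR, Finset.sum_comm]
    refine Finset.sum_congr rfl fun u hu => ?_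
    rw [← Finset.sum_smul, choose_mul_choose_sum i j u K (by
      have := Finset.mem_range.mp hu; omega)]

theorem mul_assoc' (a b c : Psd) : a * b * c = a * (b * c) := by
  obtain ⟨A, hA⟩ := a.exists_ordLE
  obtain ⟨B, hB⟩ := b.exists_ordLE
  have h1 : ∀ i j f g (a : Psd), a * mono i f * mono j g = a * (mono i f * mono j g) := by
    intro i j f g a
    rw [← sub_eq_zero]
    refine eq_zero_of_mono (((AddMonoidHom.mulRight (mono j g)).comp
      (AddMonoidHom.mulRight (mono i f))) - AddMonoidHom.mulRight (mono i f * mono j g)) (i + j)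
      (fun a A ha => OrdLE.sub ?_ ?_) (fun k h => ?_) a
    · rw [← add_assoc]
      exact (ha.mul (mono_ordLE i f)).mul (mono_ordLE j g)
    · exact ha.mul ((mono_ordLE i f).mul (mono_ordLE j g))
    · exact sub_eq_zero.mpr (mono_mul_assoc _ _ _ _ _ _)
  have h2 : ∀ j g (b : Psd), a * b * mono j g = a * (b * mono j g) := by
    intro j g b
    rw [← sub_eq_zero]
    refine eq_zero_of_mono (((AddMonoidHom.mulRight (mono j g)).comp
      (AddMonoidHom.mulLeft a)) - (AddMonoidHom.mulLeft a).comp (AddMonoidHom.mulRight (mono j g)))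
      (A + j) (fun b B hb => OrdLE.sub ?_ ?_) (fun k h => ?_) b
    · exact ((hA.mul hb).mul (mono_ordLE j g)).mono (by omega)
    · exact (hA.mul (hb.mul (mono_ordLE j g))).mono (by omega)
    · exact sub_eq_zero.mpr (h1 _ _ _ _ _)
  rw [← sub_eq_zero]
  refine eq_zero_of_mono (AddMonoidHom.mulLeft (a * b) -
    (AddMonoidHom.mulLeft a).comp (AddMonoidHom.mulLeft b)) (A + B)
    (fun c C hc => OrdLE.sub ?_ ?_) (fun k h => ?_) c
  · exact ((hA.mul hB).mul hc).mono (by omega)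
  · exact (hA.mul (hB.mul hc)).mono (by omega)
  · exact sub_eq_zero.mpr (h2 _ _ _)

instance : One Psd := ⟨mono 0 1⟩

theorem one_eq : (1 : Psd) = mono 0 1 := rfl

theorem mono_zero_mul_apply (f : Fn) (b : Psd) (n : ℤ) :
    (mono 0 f * b).toPDO n = f * b.toPDO n := by
  rw [mono_mul_apply, finsum_eq_single _ 0]
  · simp
  · intro l hl
    rw [Ring.choose_zero_pos _ (Nat.pos_of_ne_zero hl), zero_smul]

theorem mul_mono_one_apply (a : Psd) (j n : ℤ) : (a * mono j 1).toPDO n = a.toPDO (n - j) :=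
  pmul_pd_right a.toPDO j n

instance : Ring Psd :=
  { (inferInstance : NonUnitalNonAssocRing Psd), (inferInstance : One Psd) with
    mul_assoc := mul_assoc'
    one_mul := fun a => by
      ext1 n
      rw [one_eq, mono_zero_mul_apply, one_mul]
    mul_one := fun a => by
      ext1 n
      rw [one_eq, mul_mono_one_apply, sub_zero] }

theorem toPDO_one : (1 : Psd).toPDO = pd 0 := rfl

theorem toPDO_pow (a : Psd) (n : ℕ) : (a ^ n).toPDO = ppow a.toPDO n := by
  induction n with
  | zero => rw [pow_zero]; rfl
  | succ n ih => rw [pow_succ, toPDO_mul, ih]; rfl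

end Psd

namespace Psd

/-! ### Functions and derivations as pseudo-differential operators -/

/-- The ring homomorphism taking `f` to the operator of multiplication by `f`. -/
def fn : Fn →+* Psd where
  toFun f := mono 0 f
  map_one' := rfl
  map_zero' := by ext1 n; rw [toPDO_mono, Pi.single_zero]; rfl
  map_add' := mono_add 0
  map_mul' f g := by
    ext1 n
    rw [mono_zero_mul_apply, toPDO_mono, toPDO_mono, Pi.single_apply, Pi.single_apply, mul_ite,
      mul_zero]

theorem fn_apply (f : Fn) : fn f = mono 0 f := rfl

theorem toPDO_fn (f : Fn) : (fn f).toPDO = pfn f := rfl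

/-- The operator `∂`. -/
def d : Psd := mono 1 1

/-- The operator `∂⁻¹`. -/
def D : Psd := mono (-1) 1

theorem mono_mul_mono_one (i j : ℤ) (f : Fn) : mono i f * mono j 1 = mono (i + j) f := by
  ext1 n
  rw [mul_mono_one_apply, toPDO_mono, toPDO_mono, Pi.single_apply, Pi.single_apply]
  exact if_congr (by omega) rfl rfl

theorem fn_mul_mono (i : ℤ) (f g : Fn) : fn f * mono i g = mono i (f * g) := by
  ext1 n
  rw [fn_apply, mono_zero_mul_apply, toPDO_mono, toPDO_mono, Pi.single_apply, Pi.single_apply,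
    mul_ite, mul_zero]

theorem mono_eq (i : ℤ) (f : Fn) : mono i f = fn f * mono i 1 := by
  rw [fn_mul_mono, mul_one]

theorem d_mul_D : d * D = 1 := mono_mul_mono_one 1 (-1) 1

theorem D_mul_d : D * d = 1 := mono_mul_mono_one (-1) 1 1

theorem d_pow (n : ℕ) : d ^ n = mono n 1 := by
  induction n with
  | zero => rfl
  | succ n ih => rw [pow_succ, ih, d, mono_mul_mono_one]; rfl

theorem fn_ordLE (f : Fn) : (fn f).OrdLE 0 := mono_ordLE 0 f

theorem d_mul_fn (f : Fn) : d * fn f = fn f * d + fn (dt 0 f) := by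
  ext1 n
  rw [fn_apply f, d, toPDO_add, mul_mono_one_apply]
  by_cases hn : 1 < n
  · rw [(mono_ordLE 1 (1 : Fn)).mul (mono_ordLE 0 f) n (by omega), mono_ordLE 0 f _ (by omega),
      fn_ordLE (dt 0 f) _ (by omega), add_zero]
  · obtain ⟨l, hl⟩ := Int.eq_ofNat_of_zero_le (show 0 ≤ 1 - n by omega)
    obtain rfl : n = 1 + 0 - l := by omega
    rw [mono_mul_mono_apply, one_mul, toPDO_mono, fn_apply, toPDO_mono, Pi.single_apply,
      Pi.single_apply]
    have h1 := Ring.choose_natCast (R := ℤ) 1 l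
    rw [Nat.cast_one] at h1
    rw [h1]
    obtain _ | _ | l := l
    · simp [dx_zero_left]
    · simp [dx_one_left]
    · rw [if_neg (by omega), if_neg (by omega), Nat.choose_eq_zero_of_lt (by omega)]
      simp

/-- Integration by parts. -/
theorem D_mul_fn_mul_D (f : Fn) : D * fn (dt 0 f) * D = fn f * D - D * fn f := by
  have h : fn (dt 0 f) = d * fn f - fn f * d := by rw [d_mul_fn]; abel
  rw [h, mul_sub, sub_mul, ← mul_assoc, D_mul_d, one_mul, mul_assoc D, mul_assoc (fn f), d_mul_D,
    mul_one]

theorem commute_D_of_dt_eq_zero {f : Fn} (h : dt 0 f = 0) : fn f * D = D * fn f := by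
  have := D_mul_fn_mul_D f
  rw [h, map_zero, mul_zero, zero_mul] at this
  exact sub_eq_zero.mp this.symm

/-! ### The formal adjoint -/

theorem adj_support_finite (a : Psd) (n : ℤ) : (Function.support fun l : ℕ =>
    (((n + l).negOnePow : ℤ) * Ring.choose (n + l) l) • dx l (a.toPDO (n + l))).Finite := by
  obtain ⟨A, hA⟩ := a.exists_ordLE
  refine (Set.finite_Iic (A - n).toNat).subset fun l hl => ?_
  by_contra h
  rw [Set.mem_Iic, not_le] at h
  exact hl (by beta_reduce; rw [hA _ (by omega), dx_zero, smul_zero])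

/-- The formal adjoint. -/
def adj : Psd →+ Psd where
  toFun a := ⟨padj a.toPDO, by
    obtain ⟨A, hA⟩ := a.exists_ordLE
    refine ⟨A, fun i hi => finsum_eq_zero_of_forall_eq_zero fun l => ?_⟩
    rw [hA _ (by omega), dx_zero, smul_zero]⟩
  map_zero' := by
    ext1 n
    refine finsum_eq_zero_of_forall_eq_zero fun l => ?_
    rw [toPDO_zero, dx_zero, smul_zero]
  map_add' a b := by
    ext1 n
    refine Eq.trans ?_ (finsum_add_distrib (adj_support_finite a n) (adj_support_finite b n))
    refine finsum_congr fun l => ?_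
    rw [toPDO_add, dx_add, smul_add]

theorem toPDO_adj (a : Psd) : (adj a).toPDO = padj a.toPDO := rfl

theorem OrdLE.adj {a : Psd} {A : ℤ} (h : a.OrdLE A) : (adj a).OrdLE A := fun i hi =>
  finsum_eq_zero_of_forall_eq_zero fun l => by rw [h _ (by omega), dx_zero, smul_zero]

theorem toPDO_zsmul (c : ℤ) (a : Psd) (i : ℤ) : (c • a).toPDO i = c • a.toPDO i :=
  map_zsmul (coeffHom i) c a

theorem adj_mono (i : ℤ) (f : Fn) :
    adj (mono i f) = (i.negOnePow : ℤ) • (mono i 1 * fn f) := by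
  ext1 n
  rw [toPDO_zsmul, toPDO_adj, fn_apply]
  by_cases hn : i < n
  · rw [← toPDO_adj, (mono_ordLE i f).adj n hn,
      (mono_ordLE i (1 : Fn)).mul (mono_ordLE 0 f) n (by omega), smul_zero]
  · obtain ⟨l, hl⟩ := Int.eq_ofNat_of_zero_le (show 0 ≤ i - n by omega)
    obtain rfl : n = i + 0 - l := by omega
    rw [mono_mul_mono_apply, padj, finsum_eq_single _ l]
    · rw [show i + 0 - (l : ℤ) + l = i by ring, toPDO_mono, Pi.single_eq_same, one_mul, smul_smul]
    · intro l' hl'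
      rw [toPDO_mono, Pi.single_eq_of_ne (by omega), dx_zero, smul_zero]

theorem adj_one : adj 1 = 1 := by
  rw [one_eq, adj_mono, ← one_eq, one_mul, map_one, Int.negOnePow_zero]
  exact one_smul _ _

theorem d_ordLE : d.OrdLE 1 := mono_ordLE 1 1

theorem D_ordLE : D.OrdLE (-1) := mono_ordLE (-1) 1

theorem adj_fn_mul (f : Fn) (a : Psd) : adj (fn f * a) = adj a * fn f := by
  rw [← sub_eq_zero]
  refine eq_zero_of_mono (adj.comp (AddMonoidHom.mulLeft (fn f)) -
    (AddMonoidHom.mulRight (fn f)).comp adj) 0 (fun a A ha => OrdLE.sub ?_ ?_) (fun i g => ?_) a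
  · exact (((fn_ordLE f).mul ha).adj).mono (by omega)
  · exact ha.adj.mul (fn_ordLE f)
  · refine sub_eq_zero.mpr ?_
    change adj (fn f * mono i g) = adj (mono i g) * fn f
    rw [fn_mul_mono, adj_mono, adj_mono, mul_comm f g, map_mul, smul_mul_assoc, mul_assoc]

theorem adj_d_mul (a : Psd) : adj (d * a) = -(adj a * d) := by
  rw [← sub_eq_zero]
  refine eq_zero_of_mono (adj.comp (AddMonoidHom.mulLeft d) -
    -((AddMonoidHom.mulRight d).comp adj)) 1 (fun a A ha => ?_) (fun i g => ?_) a
  · refine OrdLE.sub ((d_ordLE.mul ha).adj.mono (by omega)) fun j hj => ?_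
    have := ha.adj.mul d_ordLE j hj
    exact (toPDO_neg _ j).trans (by rw [← neg_zero]; exact congrArg _ this)
  · refine sub_eq_zero.mpr ?_
    change adj (d * mono i g) = -(adj (mono i g) * d)
    have h1 : d * mono i g = mono (i + 1) g + mono i (dt 0 g) := by
      rw [mono_eq i g, ← mul_assoc, d_mul_fn, add_mul, mul_assoc, ← mono_eq, mono_eq (i + 1), d,
        mono_mul_mono_one, add_comm 1 i]
    have h2 : mono (i + 1) (1 : Fn) = mono i 1 * d := by rw [d, mono_mul_mono_one]
    rw [h1, map_add, adj_mono, adj_mono, adj_mono, Int.negOnePow_succ, h2, mul_assoc, d_mul_fn]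
    rw [Units.val_neg, mul_add, smul_add, neg_smul, neg_smul, smul_mul_assoc, mul_assoc]
    abel

theorem adj_D_mul (a : Psd) : adj (D * a) = -(adj a * D) := by
  have h : adj a = -(adj (D * a) * d) := by rw [← adj_d_mul, ← mul_assoc, d_mul_D, one_mul]
  rw [h, neg_mul, mul_assoc, d_mul_D, mul_one, neg_neg]

/-! ### Derivatives with respect to the times -/

/-- The coefficientwise derivative `∂/∂t_{2n+1}`. -/
def dtp (n : ℕ) : Psd →+ Psd where
  toFun a := ⟨fun i => dt n (a.toPDO i), by
    obtain ⟨A, hA⟩ := a.exists_ordLE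
    exact ⟨A, fun i hi => (congrArg (dt n) (hA i hi)).trans (map_zero (dtDer n))⟩⟩
  map_zero' := ext fun _ => map_zero (dtDer n)
  map_add' _ _ := ext fun _ => dt_add n _ _

theorem toPDO_dtp (n : ℕ) (a : Psd) (i : ℤ) : (dtp n a).toPDO i = dt n (a.toPDO i) := rfl

theorem dtp_mul (n : ℕ) (a b : Psd) : dtp n (a * b) = dtp n a * b + a * dtp n b := by
  ext1 i
  rw [toPDO_dtp, toPDO_add, toPDO_mul, toPDO_mul, toPDO_mul, pmul, pmul, pmul,
    ← finsum_add_distrib (mul_support_finite (dtp n a) b i) (mul_support_finite a (dtp n b) i)]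
  refine ((dtDer n).toLinearMap.toAddMonoidHom.map_finsum (mul_support_finite a b i)).trans ?_
  refine finsum_congr fun p => ?_
  change dt n (_ • (_ * _)) = _
  have : ∀ (c : ℤ) (h : Fn), dt n (c • h) = c • dt n h := fun c h => map_zsmul (dtDer n) c h
  rw [this, dt_mul, dt_dx, smul_add, toPDO_dtp, toPDO_dtp]

theorem dtp_mono (n : ℕ) (i : ℤ) (f : Fn) : dtp n (mono i f) = mono i (dt n f) := by
  ext1 j
  rw [toPDO_dtp, toPDO_mono, toPDO_mono, Pi.single_apply, Pi.single_apply]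
  split_ifs
  · rfl
  · exact map_zero (dtDer n)

theorem dt_one (n : ℕ) : dt n (1 : Fn) = 0 := (dtDer n).map_one_eq_zero

theorem mono_zero (i : ℤ) : mono i (0 : Fn) = 0 := by ext1 n; rw [toPDO_mono, Pi.single_zero]; rfl

theorem dtp_fn (n : ℕ) (f : Fn) : dtp n (fn f) = fn (dt n f) := dtp_mono n 0 f

theorem dtp_d (n : ℕ) : dtp n d = 0 := by rw [d, dtp_mono, dt_one, mono_zero]

theorem dtp_D (n : ℕ) : dtp n D = 0 := by rw [D, dtp_mono, dt_one, mono_zero]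

theorem OrdLE.dtp {a : Psd} {A : ℤ} (h : a.OrdLE A) (n : ℕ) : (dtp n a).OrdLE A := fun i hi => by
  rw [toPDO_dtp, h i hi]; exact map_zero (dtDer n)

/-! ### Differential operators, integral operators and residues -/

/-- Differential operators: those without negative powers of `∂`. -/
def IsDiff (a : Psd) : Prop := ∀ i < 0, a.toPDO i = 0

theorem IsDiff.add {a b : Psd} (ha : a.IsDiff) (hb : b.IsDiff) : (a + b).IsDiff :=
  fun i hi => by rw [toPDO_add, ha i hi, hb i hi, add_zero]

theorem IsDiff.sub {a b : Psd} (ha : a.IsDiff) (hb : b.IsDiff) : (a - b).IsDiff :=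
  fun i hi => by rw [toPDO_sub, ha i hi, hb i hi, sub_zero]

theorem IsDiff.sum {κ : Type*} {S : Finset κ} {f : κ → Psd} (h : ∀ j ∈ S, (f j).IsDiff) :
    (∑ j ∈ S, f j).IsDiff :=
  fun i hi => by rw [toPDO_sum]; exact Finset.sum_eq_zero fun j hj => h j hj i hi

theorem IsDiff.mul {a b : Psd} (ha : a.IsDiff) (hb : b.IsDiff) : (a * b).IsDiff := by
  intro n hn
  rw [toPDO_mul]
  refine finsum_eq_zero_of_forall_eq_zero fun p => ?_
  by_cases h1 : p.1 < 0
  · rw [ha _ h1, zero_mul, smul_zero]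
  by_cases h2 : n - p.1 + p.2 < 0
  · rw [hb _ h2, dx_zero, mul_zero, smul_zero]
  obtain ⟨i, hi⟩ := Int.eq_ofNat_of_zero_le (not_lt.mp h1)
  have h3 := Ring.choose_natCast (R := ℤ) i p.2
  rw [hi, h3, Nat.choose_eq_zero_of_lt (by omega)]
  simp

theorem isDiff_mono {i : ℤ} (hi : 0 ≤ i) (f : Fn) : (mono i f).IsDiff := fun j hj => by
  rw [toPDO_mono, Pi.single_eq_of_ne (by omega)]

theorem isDiff_fn (f : Fn) : (fn f).IsDiff := isDiff_mono le_rfl f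

theorem isDiff_d : d.IsDiff := isDiff_mono zero_le_one 1

theorem isDiff_d_pow (n : ℕ) : (d ^ n).IsDiff := by
  rw [d_pow]; exact isDiff_mono (by omega) 1

/-- The residue, the coefficient of `∂⁻¹`. -/
def res : Psd →+ Fn := coeffHom (-1)

theorem res_apply (a : Psd) : res a = a.toPDO (-1) := rfl

theorem res_fn_mul (f : Fn) (a : Psd) : res (fn f * a) = f * res a := mono_zero_mul_apply f a _

theorem res_mul_fn (a : Psd) (f : Fn) : res (a * fn f) = res a * f := by
  rw [res_apply, toPDO_mul, toPDO_fn, pmul_pfn_right, finsum_eq_single _ 0]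
  · simp [dx_zero_left, res_apply]
  · intro l hl
    obtain ⟨l, rfl⟩ := Nat.exists_eq_succ_of_ne_zero hl
    have h3 := Ring.choose_natCast (R := ℤ) l (l + 1)
    rw [show (-1 : ℤ) + ((l + 1 : ℕ) : ℤ) = l by push_cast; ring]
    rw [Nat.succ_eq_add_one, h3, Nat.choose_eq_zero_of_lt (by omega)]
    simp

theorem res_mul_D (a : Psd) : res (a * D) = a.toPDO 0 := mul_mono_one_apply a (-1) (-1)

theorem OrdLE.res_eq_zero {a : Psd} (h : a.OrdLE (-2)) : res a = 0 := h (-1) (by norm_num)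

/-- The value of a differential operator on a function is the constant term of its product with
the function. -/
theorem pact_eq (a : Psd) (f : Fn) : pact a.toPDO f = (a * fn f).toPDO 0 := by
  rw [toPDO_mul, toPDO_fn, pmul_pfn_right, pact]
  refine finsum_congr fun l => ?_
  have h3 := Ring.choose_natCast (R := ℤ) l l
  rw [Nat.choose_self] at h3
  rw [zero_add, h3]
  simp

theorem toPDO_d_pow_mul_fn (n : ℕ) (f : Fn) : (d ^ n * fn f).toPDO 0 = dx n f := by
  rw [d_pow, fn_apply]
  have := mono_mul_mono_apply n 0 1 f n
  have h3 := Ring.choose_natCast (R := ℤ) n n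
  rw [Nat.choose_self] at h3
  rw [h3] at this
  simpa using this

theorem res_d_pow_mul_fn_mul_D (n : ℕ) (f : Fn) : res (d ^ n * fn f * D) = dx n f := by
  rw [res_mul_D, toPDO_d_pow_mul_fn]

theorem res_D_mul_D (n : ℕ) (f g : Fn) : res (D * fn g * d ^ n * fn f * D) = sepRes n f g := by
  rw [d_pow]; rfl

theorem res_D : res D = 1 := by rw [res_apply, D, toPDO_mono, Pi.single_eq_same]

theorem isDiff_mul_D_sub {a : Psd} (ha : a.IsDiff) : (a * D - fn (a.toPDO 0) * D).IsDiff := by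
  intro i hi
  rw [← sub_mul, D, mul_mono_one_apply, toPDO_sub, fn_apply, toPDO_mono, Pi.single_apply]
  split_ifs with h
  · rw [h, sub_self]
  · rw [ha _ (by omega), sub_zero]

/-- The integral part of `∂^n f ∂⁻¹` is `f^{(n)} ∂⁻¹`. -/
theorem isDiff_d_pow_fn_D (n : ℕ) (f : Fn) : (d ^ n * fn f * D - fn (dx n f) * D).IsDiff := by
  have := isDiff_mul_D_sub ((isDiff_d_pow n).mul (isDiff_fn f))
  rwa [toPDO_d_pow_mul_fn] at this

/-- The integral part of `∂⁻¹ g ∂^n` is `∂⁻¹ (-1)^n g^{(n)}`. -/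
theorem isDiff_D_fn_d_pow (n : ℕ) (g : Fn) :
    (D * fn g * d ^ n - D * fn ((-1) ^ n * dx n g)).IsDiff := by
  induction n with
  | zero => simp [dx_zero_left]; exact fun i hi => rfl
  | succ n ih =>
    have h1 : D * fn g * d ^ (n + 1) - D * fn ((-1) ^ (n + 1) * dx (n + 1) g) =
        (D * fn g * d ^ n - D * fn ((-1) ^ n * dx n g)) * d + fn ((-1) ^ n * dx n g) := by
      have h2 : dt 0 ((-1) ^ n * dx n g) = (-1) ^ n * dx (n + 1) g := by
        rw [dx_succ]
        obtain h | h := neg_one_pow_eq_or Fn n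
        · rw [h, one_mul, one_mul]
        · rw [h, neg_one_mul, neg_one_mul, dt_neg]
      have h3 : D * fn ((-1) ^ n * dx n g) * d =
          fn ((-1) ^ n * dx n g) - D * fn ((-1) ^ n * dx (n + 1) g) := by
        rw [eq_sub_iff_add_eq, ← h2, mul_assoc, ← mul_add, ← d_mul_fn, ← mul_assoc, D_mul_d,
          one_mul]
      rw [sub_mul, h3, pow_succ, ← mul_assoc, pow_succ, mul_neg_one, neg_mul, map_neg, mul_neg]
      abel
    rw [h1]
    exact (ih.mul isDiff_d).add (isDiff_fn _)

theorem dt_zero_sepRes (n : ℕ) (f g : Fn) :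
    dt 0 (sepRes n f g) = g * dx n f - (-1) ^ n * dx n g * f := by
  have h : dt 0 (sepRes n f g) = ∑ l ∈ Finset.range n,
      ((-1) ^ (n - (l + 1)) * (dx (l + 1) f * dx (n - (l + 1)) g) -
        (-1) ^ (n - l) * (dx l f * dx (n - l) g)) := by
    rw [sepRes_eq, dt_sum]
    refine Finset.sum_congr rfl fun l hl => ?_
    obtain ⟨e, rfl⟩ := Nat.exists_eq_add_of_lt (Finset.mem_range.mp hl)
    rw [show l + e + 1 - 1 - l = e by omega, show l + e + 1 - (l + 1) = e by omega,
      show l + e + 1 - l = e + 1 by omega, dt_mul, dt_mul, ← dx_succ, ← dx_succ]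
    have : dt 0 ((-1 : Fn) ^ e) = 0 := by
      obtain h | h := neg_one_pow_eq_or Fn e
      · rw [h, dt_one]
      · rw [h, dt_neg, dt_one, neg_zero]
    rw [this]
    ring
  rw [h, Finset.sum_range_sub (fun l => (-1) ^ (n - l) * (dx l f * dx (n - l) g))]
  simp only [Nat.sub_self, pow_zero, Nat.sub_zero, dx_zero_left]
  ring

/-- The integral part of `∂⁻¹ g ∂^n f ∂⁻¹` is `ω ∂⁻¹ - ∂⁻¹ (ω - Res)`, where `ω_x = g f^{(n)}` and
`Res` is its residue. -/
theorem isDiff_D_fn_d_pow_fn_D (n : ℕ) (f g ω : Fn) (hω : dt 0 ω = g * dx n f) :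
    (D * fn g * d ^ n * fn f * D - (fn ω * D - D * fn (ω - sepRes n f g))).IsDiff := by
  set p : Psd := D * fn g * d ^ n - D * fn ((-1) ^ n * dx n g) with hp
  have hpd : p.IsDiff := isDiff_D_fn_d_pow n g
  set s : Fn := (p * fn f).toPDO 0 with hs
  have h1 : dt 0 (ω - sepRes n f g) = (-1) ^ n * dx n g * f := by
    rw [dt_sub, hω, dt_zero_sepRes]; ring
  have h2 : D * fn g * d ^ n * fn f * D = p * fn f * D +
      (fn (ω - sepRes n f g) * D - D * fn (ω - sepRes n f g)) := by
    rw [← D_mul_fn_mul_D, h1, map_mul, hp, sub_mul, sub_mul]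
    simp only [mul_assoc]
    abel
  have h3 : s = sepRes n f g := by
    have := congrArg res h2
    rw [res_D_mul_D, map_add, map_sub, res_fn_mul, res_mul_fn, res_D, mul_one, one_mul, sub_self,
      add_zero, res_mul_D] at this
    exact this.symm
  have h4 := isDiff_mul_D_sub (hpd.mul (isDiff_fn f))
  rw [← hs, h3] at h4
  rw [h2]
  rw [map_sub, sub_mul (fn ω)]
  convert h4 using 1
  abel

/-- The differential part. -/
theorem ppos_eq {a b c : Psd} (h : a = b + c) (hb : b.IsDiff) (hc : c.OrdLE (-1)) :
    ppos a.toPDO = b.toPDO := by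
  ext1 i
  rw [ppos, h, toPDO_add]
  split_ifs with hi
  · rw [hc i (by omega), add_zero]
  · exact (hb i (by omega)).symm

theorem pneg_eq {a b c : Psd} (h : a = b + c) (hb : b.IsDiff) (hc : c.OrdLE (-1)) :
    pneg a.toPDO = c.toPDO := by
  ext1 i
  rw [pneg, h, toPDO_add]
  split_ifs with hi
  · rw [hb i hi, zero_add]
  · exact (hc i (by omega)).symm

end Psd

end

section

open MvPowerSeries Matrix Psd

namespace Psd

/-! ### Matrices of pseudo-differential operators -/

variable {p q s : Type*}

/-- A matrix of functions as a matrix of multiplication operators. -/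
def mfn (M : Matrix p q Fn) : Matrix p q Psd := M.map fn

theorem mfn_apply (M : Matrix p q Fn) (i : p) (j : q) : mfn M i j = fn (M i j) := rfl

theorem mfn_mul [Fintype q] (M : Matrix p q Fn) (N : Matrix q s Fn) : mfn (M * N) = mfn M * mfn N :=
  Matrix.map_mul

theorem mfn_add (M N : Matrix p q Fn) : mfn (M + N) = mfn M + mfn N :=
  Matrix.map_add fn (map_add fn) M N

theorem mfn_sub (M N : Matrix p q Fn) : mfn (M - N) = mfn M - mfn N :=
  Matrix.map_sub fn (map_sub fn) M N

theorem mfn_neg (M : Matrix p q Fn) : mfn (-M) = -mfn M := by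
  ext1 i j
  exact map_neg fn _

/-- Integration by parts: `∂⁻¹ M' ∂⁻¹ = M ∂⁻¹ - ∂⁻¹ M` if `M' = ∂_x M`. -/
theorem parts [Fintype p] [DecidableEq p] [Fintype q]
    [DecidableEq q] (M M' : Matrix p q Fn) (h : ∀ i j, dt 0 (M i j) = M' i j) :
    scalar p D * mfn M' * scalar q D = mfn M * scalar q D - scalar p D * mfn M := by
  ext1 i j
  simp only [scalar_apply, diagonal_mul, mul_diagonal, Matrix.sub_apply, mfn_apply]
  rw [← h, D_mul_fn_mul_D]

theorem commute_of_dt_eq_zero [Fintype p] [DecidableEq p] [Fintype q]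
    [DecidableEq q] (M : Matrix p q Fn) (h : ∀ i j, dt 0 (M i j) = 0) :
    mfn M * scalar q D = scalar p D * mfn M := by
  ext1 i j
  simp only [scalar_apply, diagonal_mul, mul_diagonal, mfn_apply]
  exact commute_D_of_dt_eq_zero (h i j)

/-- Matrices of differential operators. -/
def MDiff (M : Matrix p q Psd) : Prop := ∀ i j, (M i j).IsDiff

theorem MDiff.add {M N : Matrix p q Psd} (hM : MDiff M) (hN : MDiff N) : MDiff (M + N) :=
  fun i j => (hM i j).add (hN i j)

theorem MDiff.sub {M N : Matrix p q Psd} (hM : MDiff M) (hN : MDiff N) : MDiff (M - N) :=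
  fun i j => (hM i j).sub (hN i j)

theorem MDiff.mul [Fintype q] {M : Matrix p q Psd} {N : Matrix q s Psd} (hM : MDiff M)
    (hN : MDiff N) : MDiff (M * N) := fun i j => by
  rw [Matrix.mul_apply]
  exact IsDiff.sum fun l _ => (hM i l).mul (hN l j)

theorem mdiff_mfn (M : Matrix p q Fn) : MDiff (mfn M) := fun _ _ => isDiff_fn _

/-- Matrices of operators of order at most `A`. -/
def MOrdLE (M : Matrix p q Psd) (A : ℤ) : Prop := ∀ i j, (M i j).OrdLE A

theorem MOrdLE.add {M N : Matrix p q Psd} {A : ℤ} (hM : MOrdLE M A) (hN : MOrdLE N A) :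
    MOrdLE (M + N) A := fun i j => (hM i j).add (hN i j)

theorem MOrdLE.sub {M N : Matrix p q Psd} {A : ℤ} (hM : MOrdLE M A) (hN : MOrdLE N A) :
    MOrdLE (M - N) A := fun i j => (hM i j).sub (hN i j)

theorem MOrdLE.mul [Fintype q] {M : Matrix p q Psd} {N : Matrix q s Psd} {A B : ℤ} (hM : MOrdLE M A)
    (hN : MOrdLE N B) : MOrdLE (M * N) (A + B) := fun i j => by
  rw [Matrix.mul_apply]
  intro l hl
  rw [toPDO_sum]
  exact Finset.sum_eq_zero fun u _ => (hM i u).mul (hN u j) l hl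

theorem mordLE_mfn (M : Matrix p q Fn) : MOrdLE (mfn M) 0 := fun _ _ => fn_ordLE _

theorem mordLE_scalar [Fintype p] [DecidableEq p] {a : Psd} {A : ℤ} (h : a.OrdLE A) :
    MOrdLE (scalar p a) A := by
  intro i j
  rw [scalar_apply, diagonal_apply]
  split_ifs
  · exact h
  · exact fun _ _ => rfl

/-- The matrix of residues. -/
def mres (M : Matrix p q Psd) : Matrix p q Fn := M.map res

theorem mres_add (M N : Matrix p q Psd) : mres (M + N) = mres M + mres N :=
  Matrix.map_add res (map_add res) M N

theorem mres_sub (M N : Matrix p q Psd) : mres (M - N) = mres M - mres N :=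
  Matrix.map_sub res (map_sub res) M N

theorem mres_mfn_mul [Fintype q] (M : Matrix p q Fn) (N : Matrix q s Psd) :
    mres (mfn M * N) = M * mres N := by
  ext1 i j
  simp only [mres, map_apply, Matrix.mul_apply, map_sum, mfn_apply, res_fn_mul]

theorem mres_mul_mfn [Fintype q] (M : Matrix p q Psd) (N : Matrix q s Fn) :
    mres (M * mfn N) = mres M * N := by
  ext1 i j
  simp only [mres, map_apply, Matrix.mul_apply, map_sum, mfn_apply, res_mul_fn]

theorem MOrdLE.mres_eq_zero {M : Matrix p q Psd} (h : MOrdLE M (-2)) : mres M = 0 :=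
  Matrix.ext fun i j => (h i j).res_eq_zero

end Psd

namespace IsGram

variable {ι : Type*} [Fintype ι] [DecidableEq ι] {H : ι → Fn} {G : Matrix ι ι Fn}

/-! ### The dressing operator -/

/-- The row with entries `f`. -/
abbrev row (f : ι → Fn) : Matrix Unit ι Fn := replicateRow Unit f

/-- The column with entries `f`. -/
abbrev col (f : ι → Fn) : Matrix ι Unit Fn := replicateCol Unit f

/-- The dressing operator `W = 1 - ∑ a_j ∂⁻¹ h_j`, where `a = G⁻¹ h`. -/
def dress (H : ι → Fn) (G : Matrix ι ι Fn) : Psd :=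
  1 - ∑ j, fn (adjWave H G j) * D * fn (H j)

/-- The inverse `V = 1 + ∑ h_j ∂⁻¹ a_j` of the dressing operator. -/
def undress (H : ι → Fn) (G : Matrix ι ι Fn) : Psd :=
  1 + ∑ j, fn (H j) * D * fn (adjWave H G j)

theorem mul_scalar_mul_unit (f g : ι → Fn) (i j : Unit) :
    (mfn (row f) * scalar ι D * mfn (col g)) i j = ∑ j, fn (f j) * D * fn (g j) := by
  rw [Matrix.mul_apply]
  simp only [scalar_apply, mul_diagonal, mfn_apply, replicateRow_apply, replicateCol_apply]

theorem scalar_dress : scalar Unit (dress H G) =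
    1 - mfn (row (adjWave H G)) * scalar ι D * mfn (col H) := by
  ext1 i j
  rw [Matrix.sub_apply, mul_scalar_mul_unit]
  simp [scalar_apply, dress]

theorem scalar_undress : scalar Unit (undress H G) =
    1 + mfn (row H) * scalar ι D * mfn (col (adjWave H G)) := by
  ext1 i j
  rw [Matrix.add_apply, mul_scalar_mul_unit]
  simp [scalar_apply, undress]

theorem row_mul_gram (hG : IsGram H G) : row (adjWave H G) * G = row H := by
  rw [row, ← replicateRow_vecMul, adjWave, ← vecMul_transpose, hG.inv_symm.eq, vecMul_vecMul,
    hG.inv_mul, vecMul_one]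

theorem row_mul_inv (hG : IsGram H G) : row H * G⁻¹ = row (adjWave H G) := by
  rw [row, ← replicateRow_vecMul, adjWave, ← vecMul_transpose, hG.inv_symm.eq]

theorem gram_mul_col (hG : IsGram H G) : G * col (adjWave H G) = col H := by
  rw [col, ← replicateCol_mulVec, adjWave, mulVec_mulVec, hG.mul_inv, one_mulVec]

theorem inv_mul_col (H : ι → Fn) (G : Matrix ι ι Fn) : G⁻¹ * col H = col (adjWave H G) := by
  rw [col, ← replicateCol_mulVec]; rfl

theorem parts_gram (hG : IsGram H G) :
    scalar ι D * mfn (col H) * mfn (row H) * scalar ι D =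
      mfn G * scalar ι D - scalar ι D * mfn G := by
  rw [Matrix.mul_assoc (scalar ι D), ← mfn_mul]
  refine parts _ _ fun i j => ?_
  rw [hG.flow, sepRes_one]
  simp [Matrix.mul_apply]

/-- Integration by parts for `G⁻¹`, whose `x`-derivative is `-a aᵀ`. -/
theorem parts_inv (hG : IsGram H G) :
    scalar ι D * mfn (col (adjWave H G)) * mfn (row (adjWave H G)) * scalar ι D =
      scalar ι D * mfn G⁻¹ - mfn G⁻¹ * scalar ι D := by
  have := parts (-G⁻¹) (col (adjWave H G) * row (adjWave H G)) fun i j => by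
    rw [neg_apply, dt_neg, hG.dt_zero_inv, neg_neg]
    simp [Matrix.mul_apply]
  rw [Matrix.mul_assoc (scalar ι D), ← mfn_mul, this, mfn_neg, Matrix.neg_mul, Matrix.mul_neg]
  abel

theorem dress_mul_row (hG : IsGram H G) :
    scalar Unit (dress H G) * mfn (row H) * scalar ι D =
      mfn (row (adjWave H G)) * scalar ι D * mfn G := by
  have h := congrArg (mfn (row (adjWave H G)) * ·) hG.parts_gram
  beta_reduce at h
  rw [Matrix.mul_sub, ← Matrix.mul_assoc (mfn (row _)) (mfn G), ← mfn_mul, hG.row_mul_gram] at h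
  rw [scalar_dress, Matrix.sub_mul, Matrix.sub_mul, Matrix.one_mul]
  simp only [Matrix.mul_assoc] at h ⊢
  rw [h]
  abel

theorem undress_mul_row (hG : IsGram H G) :
    scalar Unit (undress H G) * mfn (row (adjWave H G)) * scalar ι D =
      mfn (row H) * scalar ι D * mfn G⁻¹ := by
  have h := congrArg (mfn (row H) * ·) hG.parts_inv
  beta_reduce at h
  rw [Matrix.mul_sub, ← Matrix.mul_assoc (mfn (row H)) (mfn G⁻¹), ← mfn_mul, hG.row_mul_inv] at h
  rw [scalar_undress, Matrix.add_mul, Matrix.add_mul, Matrix.one_mul]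
  simp only [Matrix.mul_assoc] at h ⊢
  rw [h]
  abel

theorem col_mul_undress (hG : IsGram H G) :
    scalar ι D * mfn (col H) * scalar Unit (undress H G) =
      mfn G * scalar ι D * mfn (col (adjWave H G)) := by
  have h := congrArg (· * mfn (col (adjWave H G))) hG.parts_gram
  beta_reduce at h
  rw [Matrix.sub_mul, Matrix.mul_assoc (scalar ι D) (mfn G), ← mfn_mul, hG.gram_mul_col] at h
  rw [scalar_undress, Matrix.mul_add, Matrix.mul_one]
  simp only [Matrix.mul_assoc] at h ⊢
  rw [h]
  abel

theorem scalar_injective : Function.Injective (scalar Unit : Psd →+* Matrix Unit Unit Psd) :=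
  fun a b h => by simpa [scalar_apply] using congrFun (congrFun h ()) ()

theorem dress_mul_undress (hG : IsGram H G) : dress H G * undress H G = 1 := by
  apply scalar_injective
  rw [map_mul, map_one, scalar_undress, Matrix.mul_add, Matrix.mul_one, ← Matrix.mul_assoc,
    ← Matrix.mul_assoc, hG.dress_mul_row, Matrix.mul_assoc _ (mfn G), ← mfn_mul, hG.gram_mul_col,
    scalar_dress]
  abel

theorem undress_mul_dress (hG : IsGram H G) : undress H G * dress H G = 1 := by
  apply scalar_injective
  rw [map_mul, map_one, scalar_dress, Matrix.mul_sub, Matrix.mul_one, ← Matrix.mul_assoc,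
    ← Matrix.mul_assoc, hG.undress_mul_row, Matrix.mul_assoc _ (mfn G⁻¹), ← mfn_mul, inv_mul_col,
    scalar_undress]
  abel

theorem adj_dress_mul (a : Psd) : adj (dress H G * a) = adj a * undress H G := by
  rw [dress, undress, sub_mul, one_mul, map_sub, mul_add, mul_one, sub_eq_add_neg, Finset.sum_mul,
    map_sum, Finset.mul_sum, ← Finset.sum_neg_distrib]
  congr 1
  refine Finset.sum_congr rfl fun j _ => ?_
  rw [mul_assoc, mul_assoc, adj_fn_mul, adj_D_mul, adj_fn_mul, neg_mul, neg_neg]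
  simp only [mul_assoc]

theorem adj_undress_mul (a : Psd) : adj (undress H G * a) = adj a * dress H G := by
  rw [dress, undress, add_mul, one_mul, map_add, mul_sub, mul_one, sub_eq_add_neg, Finset.sum_mul,
    map_sum, Finset.mul_sum, ← Finset.sum_neg_distrib]
  congr 1
  refine Finset.sum_congr rfl fun j _ => ?_
  rw [mul_assoc, mul_assoc, adj_fn_mul, adj_D_mul, adj_fn_mul, neg_mul]
  simp only [mul_assoc]

theorem adj_dress : adj (dress H G) = undress H G := by
  rw [← mul_one (dress H G), adj_dress_mul, adj_one, one_mul]

theorem adj_undress : adj (undress H G) = dress H G := by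
  rw [← mul_one (undress H G), adj_undress_mul, adj_one, one_mul]

/-- The Lax operator `L = W ∂ W⁻¹`. -/
def laxOp (H : ι → Fn) (G : Matrix ι ι Fn) : Psd := dress H G * d * undress H G

theorem laxOp_pow (hG : IsGram H G) (n : ℕ) :
    laxOp H G ^ n = dress H G * d ^ n * undress H G := by
  induction n with
  | zero => rw [pow_zero, pow_zero, mul_one, hG.dress_mul_undress]
  | succ n ih =>
    rw [pow_succ, ih, laxOp]
    calc _ = dress H G * d ^ n * (undress H G * dress H G) * d * undress H G := by
          simp only [mul_assoc]
      _ = _ := by rw [hG.undress_mul_dress, mul_one, pow_succ]; simp only [mul_assoc]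

theorem adj_laxOp : adj (laxOp H G) = -laxOp H G := by
  rw [laxOp, mul_assoc, adj_dress_mul, adj_d_mul, adj_undress, neg_mul,
    mul_assoc]

theorem sum_ordLE {ι : Type*} [Fintype ι] (f g : ι → Fn) :
    (∑ j, fn (f j) * D * fn (g j)).OrdLE (-1) := fun i hi => by
  rw [toPDO_sum]
  exact Finset.sum_eq_zero fun j _ => ((fn_ordLE _).mul D_ordLE).mul (fn_ordLE _) i (by omega)

theorem laxOp_sub_d_ordLE : (laxOp H G - d).OrdLE 0 := by
  set x := ∑ j, fn (adjWave H G j) * D * fn (H j) with hx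
  set y := ∑ j, fn (H j) * D * fn (adjWave H G j) with hy
  have hxo : x.OrdLE (-1) := sum_ordLE _ _
  have hyo : y.OrdLE (-1) := sum_ordLE _ _
  have h : laxOp H G - d = d * y - (x * d + x * d * y) := by
    rw [laxOp, dress, undress, ← hx, ← hy]; noncomm_ring
  rw [h]
  exact ((d_ordLE.mul hyo).mono (by omega)).sub (((hxo.mul d_ordLE).mono (by omega)).add
    (((hxo.mul d_ordLE).mul hyo).mono (by omega)))

/-! ### The integral part of the powers of the Lax operator -/

/-- The integral part of `L^n`, in terms of a matrix `C` with `∂_x C_{ij} = h_i h_j^{(n)}`. -/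
def negMat (H : ι → Fn) (G : Matrix ι ι Fn) (n : ℕ) (C : Matrix ι ι Fn) : Matrix Unit Unit Psd :=
  mfn (row (fun j => dx n (H j)) - row (adjWave H G) * C) * scalar ι D *
      mfn (col (adjWave H G)) -
    mfn (row (adjWave H G)) * scalar ι D *
      mfn (col (fun j => (-1) ^ n * dx n (H j)) -
        (C - Matrix.of fun i j => sepRes n (H j) (H i)) * col (adjWave H G))

/-- `W ∂^n W⁻¹` is expanded into four terms, each of which is reduced to its integral part by
integration by parts. -/
theorem mdiff_sub_negMat (n : ℕ) (C : Matrix ι ι Fn)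
    (hC : ∀ i j, dt 0 (C i j) = H i * dx n (H j)) :
    MDiff (scalar Unit (dress H G * d ^ n * undress H G) - negMat H G n C) := by
  set r := row (adjWave H G)
  set a := col (adjWave H G)
  set S : Matrix ι ι Fn := Matrix.of fun i j => sepRes n (H j) (H i)
  have h1 : MDiff (scalar Unit (d ^ n) * mfn (row H) * scalar ι D -
      mfn (row (fun j => dx n (H j))) * scalar ι D) := fun i j => by
    simp only [scalar_apply, diagonal_mul, mul_diagonal, Matrix.sub_apply, mfn_apply]
    exact isDiff_d_pow_fn_D n (H j)
  have h2 : MDiff (scalar ι D * mfn (col H) * scalar Unit (d ^ n) -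
      scalar ι D * mfn (col (fun j => (-1) ^ n * dx n (H j)))) := fun i j => by
    simp only [scalar_apply, diagonal_mul, mul_diagonal, Matrix.sub_apply, mfn_apply]
    exact isDiff_D_fn_d_pow n (H i)
  have h3 : MDiff (scalar ι D * mfn (col H) * scalar Unit (d ^ n) * mfn (row H) * scalar ι D -
      (mfn C * scalar ι D - scalar ι D * mfn (C - S))) := fun i j => by
    simp only [scalar_apply, diagonal_mul, mul_diagonal, Matrix.sub_apply, mfn_apply]
    rw [Matrix.mul_apply]
    simp only [Finset.univ_unique, Finset.sum_singleton, diagonal_mul, mul_diagonal, mfn_apply]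
    exact isDiff_D_fn_d_pow_fn_D n (H j) (H i) (C i j) (hC i j)
  have h4 : MDiff (scalar Unit (d ^ n)) := fun i j => by
    simp only [scalar_apply, diagonal_apply_eq]; exact isDiff_d_pow n
  have h := ((h4.add (h1.mul (mdiff_mfn a))).sub ((mdiff_mfn r).mul h2)).sub
    (((mdiff_mfn r).mul h3).mul (mdiff_mfn a))
  convert h using 1
  rw [negMat, map_mul, map_mul, scalar_dress, scalar_undress]
  simp only [mfn_sub, mfn_mul, Matrix.sub_mul, Matrix.mul_sub, Matrix.mul_add,
    Matrix.mul_one, Matrix.one_mul, Matrix.mul_assoc]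
  abel

theorem negMat_ordLE (n : ℕ) (C : Matrix ι ι Fn) : MOrdLE (negMat H G n C) (-1) :=
  (((mordLE_mfn _).mul (mordLE_scalar D_ordLE)).mul (mordLE_mfn _)).sub
    (((mordLE_mfn _).mul (mordLE_scalar D_ordLE)).mul (mordLE_mfn _))

end IsGram

namespace IsGram

variable {ι : Type*} [Fintype ι] [DecidableEq ι] {H : ι → Fn} {G : Matrix ι ι Fn}

/-- The integral part of `L^n`. -/
def negLax (H : ι → Fn) (G : Matrix ι ι Fn) (n : ℕ) (C : Matrix ι ι Fn) : Psd :=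
  negMat H G n C () ()

theorem scalar_negLax (n : ℕ) (C : Matrix ι ι Fn) :
    scalar Unit (negLax H G n C) = negMat H G n C := by
  ext1 i j
  rw [scalar_apply, diagonal_apply_eq]
  rfl

theorem isDiff_laxOp_pow_sub (hG : IsGram H G) (n : ℕ) (C : Matrix ι ι Fn)
    (hC : ∀ i j, dt 0 (C i j) = H i * dx n (H j)) : (laxOp H G ^ n - negLax H G n C).IsDiff := by
  have := mdiff_sub_negMat (H := H) (G := G) n C hC () ()
  rw [← hG.laxOp_pow] at this
  exact this

theorem negLax_ordLE (n : ℕ) (C : Matrix ι ι Fn) : (negLax H G n C).OrdLE (-1) :=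
  negMat_ordLE n C () ()

theorem pneg_laxOp_pow (hG : IsGram H G) (n : ℕ) (C : Matrix ι ι Fn)
    (hC : ∀ i j, dt 0 (C i j) = H i * dx n (H j)) :
    pneg (ppow (laxOp H G).toPDO n) = (negLax H G n C).toPDO := by
  rw [← toPDO_pow]
  exact pneg_eq (sub_add_cancel _ _).symm (hG.isDiff_laxOp_pow_sub n C hC) (negLax_ordLE n C)

theorem ppos_laxOp_pow (hG : IsGram H G) (n : ℕ) (C : Matrix ι ι Fn)
    (hC : ∀ i j, dt 0 (C i j) = H i * dx n (H j)) :
    ppos (ppow (laxOp H G).toPDO n) = (laxOp H G ^ n - negLax H G n C).toPDO := by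
  rw [← toPDO_pow]
  exact ppos_eq (sub_add_cancel _ _).symm (hG.isDiff_laxOp_pow_sub n C hC) (negLax_ordLE n C)

/-- The normalization of the integration constants, in matrix form. -/
theorem normalized_sub {ι : Type*} {H : ι → Fn} (n : ℕ) (B : Matrix ι ι Fn)
    (hn : ∀ i j, B j i - (-1 : ℤ) ^ n • B i j = sepRes n (H i) (H j)) :
    B - Matrix.of (fun i j => sepRes n (H j) (H i)) = (-1 : ℤ) ^ n • Bᵀ := by
  ext1 i j
  rw [Matrix.sub_apply, of_apply, ← hn j i, Matrix.smul_apply, transpose_apply]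
  abel

/-- With normalized integration constants, the integral part of `L^k` is
`∑ Q_i ∂⁻¹ a_i - (-1)^k a_i ∂⁻¹ Q_i`, where `Q_i` is the transform of `h_i^{(k)}`. -/
theorem negLax_eq (k : ℕ) (B : Matrix ι ι Fn)
    (hn : ∀ i j, B j i - (-1 : ℤ) ^ k • B i j = sepRes k (H i) (H j)) :
    negLax H G k B = ∑ j, (fn (transform H G (dx k (H j)) fun i => B i j) * D * fn (adjWave H G j) -
      (-1 : ℤ) ^ k •
        (fn (adjWave H G j) * D * fn (transform H G (dx k (H j)) fun i => B i j))) := by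
  set Q : ι → Fn := fun j => transform H G (dx k (H j)) fun i => B i j with hQ
  have h1 : row (fun j => dx k (H j)) - row (adjWave H G) * B = row Q := by
    ext1 i j
    simp [Matrix.mul_apply, hQ, transform, dotProduct]
  have h2 : col (fun j => (-1) ^ k * dx k (H j)) - ((-1 : ℤ) ^ k • Bᵀ) * col (adjWave H G) =
      (-1 : ℤ) ^ k • col Q := by
    ext1 i j
    rw [Matrix.smul_mul, Matrix.sub_apply, Matrix.smul_apply, Matrix.smul_apply, Matrix.mul_apply]
    change (-1) ^ k * dx k (H i) - _ = _ • (dx k (H i) - ∑ x, adjWave H G x * B x i)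
    have h : ∑ x, Bᵀ i x * col (adjWave H G) x j = ∑ x, adjWave H G x * B x i :=
      Finset.sum_congr rfl fun _ _ => mul_comm _ _
    rw [h, zsmul_eq_mul, zsmul_eq_mul, Int.cast_pow, Int.cast_neg, Int.cast_one, mul_sub]
  have h3 : mfn ((-1 : ℤ) ^ k • col Q) = (-1 : ℤ) ^ k • mfn (col Q) := by
    ext1 i j
    change fn ((-1 : ℤ) ^ k • Q i) = (-1 : ℤ) ^ k • fn (Q i)
    generalize (-1 : ℤ) ^ k = c
    exact map_zsmul (fn : Fn →+ Psd) c (Q i)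
  rw [negLax, negMat, normalized_sub k B hn, h1, h2, h3, Matrix.mul_smul, Matrix.sub_apply,
    Matrix.smul_apply, mul_scalar_mul_unit, mul_scalar_mul_unit, Finset.sum_sub_distrib,
    Finset.smul_sum]

/-! ### The flows -/

theorem map_dt_mul {p q s : Type*} [Fintype q] (n : ℕ) (M : Matrix p q Fn) (N : Matrix q s Fn) :
    (M * N).map (dt n) = M.map (dt n) * N + M * N.map (dt n) := by
  ext1 i j
  simp only [map_apply, Matrix.mul_apply, Matrix.add_apply, dt_sum, dt_mul,
    Finset.sum_add_distrib]

/-- The flows of `a = G⁻¹ h`, from `aᵀ G = hᵀ`. -/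
theorem dt_row (hG : IsGram H G) (n : ℕ) :
    (row (adjWave H G)).map (dt n) =
      (row (fun j => dx (2 * n + 1) (H j)) - row (adjWave H G) * G.map (dt n)) * G⁻¹ := by
  have h2 : (row H).map (dt n) = row (fun j => dx (2 * n + 1) (H j)) := by
    ext1 i j
    exact hG.eigen j n
  have h1 := map_dt_mul n (row (adjWave H G)) G
  rw [hG.row_mul_gram, h2] at h1
  rw [h1, add_sub_cancel_right, Matrix.mul_assoc, hG.mul_inv, Matrix.mul_one]

theorem scalar_dtp_dress (hG : IsGram H G) (n : ℕ) :
    scalar Unit (dtp n (dress H G)) =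
      -(mfn ((row (adjWave H G)).map (dt n)) * scalar ι D * mfn (col H)) -
        mfn (row (adjWave H G)) * scalar ι D * mfn (col fun j => dx (2 * n + 1) (H j)) := by
  have h : dtp n (dress H G) = -∑ j, fn (dt n (adjWave H G j)) * D * fn (H j) -
      ∑ j, fn (adjWave H G j) * D * fn (dx (2 * n + 1) (H j)) := by
    rw [dress, map_sub, show dtp n 1 = 0 by rw [← map_one fn, dtp_fn, dt_one, map_zero], zero_sub,
      map_sum, ← neg_add', ← Finset.sum_add_distrib]
    refine congrArg _ (Finset.sum_congr rfl fun j _ => ?_)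
    rw [dtp_mul, dtp_mul, dtp_D, dtp_fn, dtp_fn, mul_zero, add_zero, hG.eigen j n]
  ext1 i j
  rw [Matrix.sub_apply, neg_apply, mul_scalar_mul_unit, h, scalar_apply, diagonal_apply_eq]
  change _ = -(mfn (row fun j => dt n (adjWave H G j)) * scalar ι D * mfn (col H)) i j - _
  rw [mul_scalar_mul_unit]

/-- The equation `W_{t_n} W⁻¹ = -(L^n)_{<0}`. -/
theorem dtp_dress_mul_undress (hG : IsGram H G) (n : ℕ) (C : Matrix ι ι Fn)
    (hC : ∀ i j, dt 0 (C i j) = H i * dx (2 * n + 1) (H j)) :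
    dtp n (dress H G) * undress H G = -negLax H G (2 * n + 1) C := by
  set r := row (adjWave H G) with hr
  set a := col (adjWave H G) with ha
  set hn := fun j => dx (2 * n + 1) (H j) with hhn
  set S : Matrix ι ι Fn := G.map (dt n) with hS
  -- `K` is constant in `x`, hence commutes with `∂⁻¹`
  set K : Matrix ι ι Fn := S - C - Cᵀ with hK
  have hSC : S = K + C + Cᵀ := by rw [hK]; abel
  have hK0 : mfn K * scalar ι D = scalar ι D * mfn K := by
    refine commute_of_dt_eq_zero K fun i j => ?_
    rw [hK, Matrix.sub_apply, Matrix.sub_apply, transpose_apply, dt_sub, dt_sub, hC, hC, hS,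
      map_apply, dt_comm, hG.flow, sepRes_one, dt_mul, hG.eigen, hG.eigen]
    ring
  have h1 : scalar ι D * mfn (col hn) * scalar Unit (undress H G) =
      scalar ι D * mfn (col hn) + (mfn Cᵀ * scalar ι D - scalar ι D * mfn Cᵀ) * mfn a := by
    have := parts Cᵀ (col hn * row H) fun i j => by
      rw [transpose_apply, hC]
      simp [Matrix.mul_apply, hhn, mul_comm]
    rw [mfn_mul] at this
    rw [← this, scalar_undress, Matrix.mul_add, Matrix.mul_one]
    simp only [Matrix.mul_assoc, ha]
  have h2 : mfn (r.map (dt n)) * mfn G = mfn (row hn) - mfn r * mfn S := by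
    rw [hr, hG.dt_row, ← mfn_mul, Matrix.mul_assoc, hG.inv_mul, Matrix.mul_one, mfn_sub, mfn_mul]
  have hCS : C - Matrix.of (fun i j => sepRes (2 * n + 1) (H j) (H i)) = -(K + Cᵀ) := by
    have : Matrix.of (fun i j => sepRes (2 * n + 1) (H j) (H i)) = S := by
      ext1 i j
      rw [of_apply, hS, map_apply, ← hG.symm.apply, hG.flow]
    rw [this, hSC]
    abel
  have hcol : col (fun j => (-1) ^ (2 * n + 1) * dx (2 * n + 1) (H j)) = -col hn := by
    ext1 i j
    change (-1) ^ (2 * n + 1) * dx (2 * n + 1) (H i) = -dx (2 * n + 1) (H i)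
    rw [Odd.neg_one_pow ⟨n, rfl⟩, neg_one_mul]
  apply scalar_injective
  rw [map_mul, map_neg, scalar_negLax, negMat, hCS, hcol, hG.scalar_dtp_dress, Matrix.sub_mul,
    Matrix.neg_mul, Matrix.mul_assoc (mfn r), Matrix.mul_assoc (mfn r), h1,
    Matrix.mul_assoc _ (scalar ι D), Matrix.mul_assoc _ _ (scalar Unit _), hG.col_mul_undress,
    ← Matrix.mul_assoc, ← Matrix.mul_assoc, h2, hSC, ← hr, ← ha, ← hhn]
  have hK1 : mfn r * (mfn K * (scalar ι D * mfn a)) = mfn r * (scalar ι D * (mfn K * mfn a)) := by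
    rw [← Matrix.mul_assoc (mfn K), hK0, Matrix.mul_assoc]
  simp only [mfn_sub, mfn_add, mfn_neg, mfn_mul, Matrix.sub_mul, Matrix.mul_sub, Matrix.mul_add,
    Matrix.add_mul, Matrix.neg_mul, Matrix.mul_neg, Matrix.mul_assoc, hK1]
  abel

/-- The hypothesis `hC` asks for antiderivatives in `x` of the products `h_i h_j^{(2n+1)}`; the
potentials `Ω(h_i, h_j^{(2n+1)})` serve. -/
theorem isDressing (hG : IsGram H G)
    (hC : ∀ n, ∃ C : Matrix ι ι Fn, ∀ i j, dt 0 (C i j) = H i * dx (2 * n + 1) (H j)) :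
    IsDressing (dress H G).toPDO (laxOp H G).toPDO where
  lead := by
    rw [dress, toPDO_sub, sum_ordLE (adjWave H G) H 0 (by norm_num), sub_zero, toPDO_one, pd,
      Pi.single_eq_same]
  order i hi := by
    rw [dress, toPDO_sub, sum_ordLE (adjWave H G) H i (by omega), sub_zero, toPDO_one, pd,
      Pi.single_eq_of_ne (by omega)]
  dress := by
    have : laxOp H G * dress H G = dress H G * d := by
      rw [laxOp, mul_assoc, hG.undress_mul_dress, mul_one]
    exact congrArg toPDO this
  adj_mul := by
    have : adj (dress H G) * dress H G = 1 := by rw [adj_dress, hG.undress_mul_dress]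
    exact congrArg toPDO this
  mul_adj := by
    have : dress H G * adj (dress H G) = 1 := by rw [adj_dress, hG.dress_mul_undress]
    exact congrArg toPDO this
  sato n := by
    obtain ⟨C, hC⟩ := hC n
    have h := congrArg (· * dress H G) (hG.dtp_dress_mul_undress n C hC)
    beta_reduce at h
    rw [mul_assoc, hG.undress_mul_dress, mul_one, neg_mul] at h
    rw [hG.pneg_laxOp_pow _ C hC]
    exact congrArg toPDO h

theorem isCKPLax (hG : IsGram H G)
    (hC : ∀ n, ∃ C : Matrix ι ι Fn, ∀ i j, dt 0 (C i j) = H i * dx (2 * n + 1) (H j)) :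
    IsCKPLax (laxOp H G).toPDO := by
  have hlead : (laxOp H G).toPDO 1 = 1 := by
    have := laxOp_sub_d_ordLE (H := H) (G := G) 1 one_pos
    rw [toPDO_sub, sub_eq_zero] at this
    rw [this, d, toPDO_mono, Pi.single_eq_same]
  have hord : ∀ i : ℤ, 1 < i → (laxOp H G).toPDO i = 0 := fun i hi => by
    have := laxOp_sub_d_ordLE (H := H) (G := G) i (by omega)
    rw [toPDO_sub, sub_eq_zero] at this
    rw [this, d, toPDO_mono, Pi.single_eq_of_ne (by omega)]
  have hadj : padj (laxOp H G).toPDO = -(laxOp H G).toPDO := congrArg toPDO adj_laxOp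
  refine ⟨hlead, ?_, hord, hadj, fun n => ?_⟩
  · -- the constant term of `L* = -L` is `L₀ - L₁' = -L₀`, and `L₁ = 1`
    have h := congrFun hadj 0
    rw [Pi.neg_apply, padj, finsum_eq_single _ 0] at h
    · have h' : (laxOp H G).toPDO 0 = -(laxOp H G).toPDO 0 := by simpa [dx_zero_left] using h
      ext β
      have h2 := congrArg (coeff β) h'
      rw [map_neg] at h2
      rw [map_zero]
      exact self_eq_neg.mp h2
    · intro l hl
      obtain ⟨l, rfl⟩ := Nat.exists_eq_succ_of_ne_zero hl
      obtain _ | l := l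
      · rw [show (0 : ℤ) + ((0 + 1 : ℕ) : ℤ) = 1 by norm_num, hlead, dx_one_left, dt_one,
          smul_zero]
      · rw [hord _ (by push_cast; omega), dx_zero, smul_zero]
  · obtain ⟨C, hC⟩ := hC n
    set N := negLax H G (2 * n + 1) C with hN
    set L := laxOp H G with hL
    have hW : dtp n (dress H G) = -N * dress H G := by
      rw [hN, ← hG.dtp_dress_mul_undress n C hC, mul_assoc, hG.undress_mul_dress, mul_one]
    have hV : dtp n (undress H G) = undress H G * N := by
      have h := congrArg (dtp n) hG.dress_mul_undress
      rw [dtp_mul, hW, show dtp n 1 = 0 by rw [← map_one fn, dtp_fn, dt_one, map_zero], mul_assoc,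
        hG.dress_mul_undress, mul_one, neg_add_eq_zero] at h
      rw [h, ← mul_assoc, hG.undress_mul_dress, one_mul]
    have h : dtp n L = (L ^ (2 * n + 1) - N) * L - L * (L ^ (2 * n + 1) - N) := by
      have h0 : dtp n L = L * N - N * L := by
        rw [hL, laxOp, dtp_mul, dtp_mul, dtp_d, mul_zero, add_zero, hW, hV]
        noncomm_ring
      rw [h0, sub_mul, mul_sub, ← pow_succ, ← pow_succ']
      abel
    rw [hG.ppos_laxOp_pow _ C hC]
    exact congrArg toPDO h

theorem mres_dress_mul {κ : Type*} [Fintype κ] [DecidableEq κ] (n : ℕ) (F : κ → Fn) :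
    mres (scalar Unit (dress H G) * scalar Unit (d ^ n) * (mfn (row F) * scalar κ D)) =
      row (fun j => dx n (F j)) -
        row (adjWave H G) * Matrix.of (fun i j => sepRes n (F j) (H i)) := by
  have e1 : mres (scalar Unit (d ^ n) * mfn (row F) * scalar κ D) =
      row (fun j => dx n (F j)) := by
    ext1 i j
    simp only [mres, map_apply, scalar_apply, diagonal_mul, mul_diagonal, mfn_apply]
    exact res_d_pow_mul_fn_mul_D _ _
  have e2 : mres (scalar ι D * mfn (col H) * scalar Unit (d ^ n) * mfn (row F) *
      scalar κ D) = Matrix.of (fun i j => sepRes n (F j) (H i)) := by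
    ext1 i j
    simp only [mres, map_apply, scalar_apply, mul_diagonal]
    rw [Matrix.mul_apply]
    simp only [Finset.univ_unique, Finset.sum_singleton, diagonal_mul, mul_diagonal, mfn_apply]
    exact res_D_mul_D _ _ _
  rw [← e1, ← e2, ← mres_mfn_mul, ← mres_sub, scalar_dress]
  simp only [Matrix.sub_mul, Matrix.one_mul, Matrix.mul_assoc]

/-- The action of `(L^n)_{≥0}` on a function `q` with
`q ∂⁻¹ = W (F ∂⁻¹ + ∑ h_i ∂⁻¹ u_i)`, in matrix form. -/
theorem pact_row {κ : Type*} [Fintype κ] [DecidableEq κ] (hG : IsGram H G) (n : ℕ)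
    (C : Matrix ι ι Fn) (hC : ∀ i j, dt 0 (C i j) = H i * dx (2 * n + 1) (H j))
    (q F : κ → Fn) (u : Matrix ι κ Fn)
    (hq : mfn (row q) * scalar κ D = scalar Unit (dress H G) *
      (mfn (row F) * scalar κ D + mfn (row H) * scalar ι D * mfn u)) :
    row (fun j => pact (ppos (ppow (laxOp H G).toPDO (2 * n + 1))) (q j)) =
      row (fun j => dx (2 * n + 1) (F j)) -
        row (adjWave H G) * Matrix.of (fun i j => sepRes (2 * n + 1) (F j) (H i)) +
      (row (fun j => dx (2 * n + 1) (H j)) - row (adjWave H G) * G.map (dt n)) * u := by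
  set B := laxOp H G ^ (2 * n + 1) - negLax H G (2 * n + 1) C with hB
  have h1 : row (fun j => pact (ppos (ppow (laxOp H G).toPDO (2 * n + 1))) (q j)) =
      mres (scalar Unit B * (mfn (row q) * scalar κ D)) := by
    ext1 i j
    rw [hG.ppos_laxOp_pow _ C hC, mres, map_apply, ← Matrix.mul_assoc]
    simp only [scalar_apply, diagonal_mul, mul_diagonal, mfn_apply]
    exact (pact_eq _ _).trans (res_mul_D _).symm
  have h2 : B * dress H G = dtp n (dress H G) + dress H G * d ^ (2 * n + 1) := by
    rw [hB, sub_eq_add_neg, ← hG.dtp_dress_mul_undress n C hC, hG.laxOp_pow, add_mul, mul_assoc,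
      hG.undress_mul_dress, mul_one, mul_assoc _ (undress H G), hG.undress_mul_dress, mul_one,
      add_comm]
  have h3 : MOrdLE (scalar Unit (dtp n (dress H G)) *
      (mfn (row F) * scalar κ D + mfn (row H) * scalar ι D * mfn u)) (-2) := by
    have hd : (dtp n (dress H G)).OrdLE (-1) := by
      have : dtp n (dress H G) = -dtp n (∑ j, fn (adjWave H G j) * D * fn (H j)) := by
        rw [dress, map_sub, show dtp n 1 = 0 by rw [← map_one fn, dtp_fn, dt_one, map_zero],
          zero_sub]
      intro i hi
      rw [this, toPDO_neg, (sum_ordLE _ _).dtp n i hi, neg_zero]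
    exact (mordLE_scalar hd).mul (((mordLE_mfn _).mul (mordLE_scalar D_ordLE)).add
      (((mordLE_mfn _).mul (mordLE_scalar D_ordLE)).mul (mordLE_mfn _)))
  have h5 : Matrix.of (fun i j => sepRes (2 * n + 1) (H j) (H i)) = G.map (dt n) := by
    ext1 i j
    rw [of_apply, map_apply, ← hG.symm.apply, hG.flow]
  rw [h1, hq, ← Matrix.mul_assoc, ← map_mul, h2, map_add, Matrix.add_mul, mres_add,
    h3.mres_eq_zero, zero_add, map_mul, Matrix.mul_add, mres_add, mres_dress_mul,
    ← Matrix.mul_assoc, mres_mul_mfn, mres_dress_mul, h5]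

/-- `a = G⁻¹ h` consists of eigenfunctions of `L`. -/
theorem dt_adjWave (hG : IsGram H G)
    (hC : ∀ n, ∃ C : Matrix ι ι Fn, ∀ i j, dt 0 (C i j) = H i * dx (2 * n + 1) (H j))
    (n : ℕ) (j : ι) : dt n (adjWave H G j) =
      pact (ppos (ppow (laxOp H G).toPDO (2 * n + 1))) (adjWave H G j) := by
  obtain ⟨C, hC⟩ := hC n
  have h := hG.pact_row n C hC (adjWave H G) (fun _ => 0) G⁻¹ (by
    have h0 : mfn (row fun _ : ι => (0 : Fn)) = 0 := by ext1 i j; exact map_zero fn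
    rw [h0, Matrix.zero_mul, zero_add, ← Matrix.mul_assoc, ← Matrix.mul_assoc, hG.dress_mul_row,
      Matrix.mul_assoc _ (mfn G), ← mfn_mul, hG.mul_inv]
    have : mfn (1 : Matrix ι ι Fn) = 1 := Matrix.map_one fn (map_zero _) (map_one _)
    rw [this, Matrix.mul_one])
  have h0 : Matrix.of (fun (i : ι) (_ : ι) => sepRes (2 * n + 1) 0 (H i)) = 0 := by
    ext1 i j
    rw [of_apply, sepRes_eq]
    simp [dx_zero]
  have h1 : row (fun _ : ι => dx (2 * n + 1) (0 : Fn)) = 0 := by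
    ext1 i j
    exact dx_zero _
  rw [h0, h1, Matrix.mul_zero, sub_zero, zero_add, ← hG.dt_row] at h
  exact (congrFun (congrFun h ()) j).symm

/-- The transform of an eigenfunction of `∂` is an eigenfunction of `L`. -/
theorem dt_transform (hG : IsGram H G)
    (hC : ∀ n, ∃ C : Matrix ι ι Fn, ∀ i j, dt 0 (C i j) = H i * dx (2 * n + 1) (H j))
    {F : Fn} (hF : IsEigen F) {v : ι → Fn} (hv : ∀ i n, dt n (v i) = sepRes (2 * n + 1) F (H i))
    (n : ℕ) : dt n (transform H G F v) =
      pact (ppos (ppow (laxOp H G).toPDO (2 * n + 1))) (transform H G F v) := by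
  obtain ⟨C, hC⟩ := hC n
  have hrow : row (fun _ : Unit => F) - row (adjWave H G) * col v =
      row fun _ : Unit => transform H G F v := by
    ext1 i j
    simp [Matrix.mul_apply, transform, dotProduct]
  have h := hG.pact_row n C hC (fun _ : Unit => transform H G F v) (fun _ => F) (-(G⁻¹ * col v)) (by
    have hp := parts (col v) (col H * row fun _ : Unit => F) fun i j => by
      refine (hv i 0).trans ?_
      rw [sepRes_one]
      simp [Matrix.mul_apply, mul_comm]
    rw [mfn_mul] at hp
    rw [← hrow, Matrix.mul_add, ← Matrix.mul_assoc _ _ (mfn (-(G⁻¹ * col v))),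
      ← Matrix.mul_assoc _ (mfn (row H)), hG.dress_mul_row, Matrix.mul_assoc _ (mfn G), ← mfn_mul,
      Matrix.mul_neg, ← Matrix.mul_assoc G, hG.mul_inv, Matrix.one_mul, scalar_dress]
    simp only [mfn_sub, mfn_mul, mfn_neg, Matrix.sub_mul, Matrix.one_mul, Matrix.mul_assoc,
      Matrix.mul_neg] at hp ⊢
    rw [hp, Matrix.mul_sub]
    abel)
  have h1 : (row fun _ : Unit => F).map (dt n) = row fun _ : Unit => dx (2 * n + 1) F :=
    Matrix.ext fun _ _ => hF n
  have h2 : (col v).map (dt n) = Matrix.of fun i (_ : Unit) => sepRes (2 * n + 1) F (H i) :=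
    Matrix.ext fun i _ => hv i n
  rw [Matrix.mul_neg, ← Matrix.mul_assoc, ← hG.dt_row, ← h1, ← h2] at h
  have h3 := congrArg (fun M : Matrix Unit Unit Fn => M.map (dt n)) hrow
  beta_reduce at h3
  rw [Matrix.map_sub (dt n) (dt_sub n), map_dt_mul] at h3
  have h4 : (row fun _ : Unit => transform H G F v).map (dt n) = _ :=
    (h3.symm.trans (by abel)).trans h.symm
  exact congrFun (congrFun h4 ()) ()

end IsGram

namespace IsGram

variable {ι : Type*} [Fintype ι] [DecidableEq ι] {H : ι → Fn} {G : Matrix ι ι Fn}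

/-! ### The tau function and the dressing operator -/

theorem zcoeff_zero_wave (H : ι → Fn) (G : Matrix ι ι Fn) :
    zcoeff 0 (wave (σ := ℕ) id 1 H G) = 1 := by
  rw [wave, zcoeff, map_sub, map_sub, map_one, map_mul (zexp ℕ), map_mul (zexp ℕ), zexp_zvar,
    zexp_C, mul_assoc, PowerSeries.coeff_C_mul, PowerSeries.coeff_zero_X_mul, mul_zero, sub_zero,
    PowerSeries.coeff_one, if_pos rfl]

theorem zcoeff_succ_wave (hG : IsGram H G) (w : ℕ) : zcoeff (w + 1) (wave (σ := ℕ) id 1 H G) =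
    -∑ j, (-1 : ℤ) ^ w • (adjWave H G j * dx w (H j)) := by
  rw [wave, zcoeff, map_sub, map_sub, map_one, map_mul (zexp ℕ), map_mul (zexp ℕ), zexp_zvar,
    zexp_C, map_one C, map_one PowerSeries.C, one_mul, PowerSeries.coeff_succ_X_mul,
    PowerSeries.coeff_one, if_neg w.succ_ne_zero, zero_sub, dotProduct, map_sum, map_sum]
  refine congrArg _ (Finset.sum_congr rfl fun j _ => ?_)
  rw [map_mul (zexp ℕ), Function.comp, Function.comp,
    zexp_shiftBy_zero id Function.injective_id, mul_comm, PowerSeries.coeff_C_mul, emb_id,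
    show PowerSeries.coeff w (zexp ℕ (resolvent id 1 (H j))) = _ from
      zcoeff_resolvent id Function.injective_id (by norm_num) (hG.eigen j) w, emb_id, mul_smul_comm]
  obtain h | h := Nat.even_or_odd w
  · rw [h.neg_one_pow, h.neg_one_pow, one_smul, one_smul]
  · rw [h.neg_one_pow, h.neg_one_pow, neg_one_smul, neg_one_smul]

theorem toPDO_dress (H : ι → Fn) (G : Matrix ι ι Fn) (w : ℕ) :
    (dress H G).toPDO (-((w + 1 : ℕ) : ℤ)) =
      -∑ j, (-1 : ℤ) ^ w • (adjWave H G j * dx w (H j)) := by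
  rw [dress, toPDO_sub, toPDO_one, pd, Pi.single_eq_of_ne (by omega), zero_sub, toPDO_sum]
  refine congrArg _ (Finset.sum_congr rfl fun j _ => ?_)
  have h := mono_mul_mono_apply (-1) 0 1 (H j) w
  have h2 := Ring.choose_natCast (R := ℤ) w w
  rw [mul_assoc, fn_apply, mono_zero_mul_apply,
    show -((w + 1 : ℕ) : ℤ) = -1 + 0 - w by push_cast; ring, D, fn_apply, h, Ring.choose_neg,
    show (1 : ℤ) + w - 1 = w by ring, h2, Nat.choose_self, one_mul, mul_smul_comm]
  congr 1
  simp [Int.negOnePow, Units.smul_def]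

/-- The operator read off from the wave function of `τ` is the dressing operator `1 - ∑ a_j ∂⁻¹
h_j`: the coefficient of `∂^{-w-1}` in `∂⁻¹ h` is `(-1)^w h^{(w)}`. -/
theorem dressing_eq (hG : IsGram H G) {τ : Fn} (hτ : τ ^ 2 = G.det) :
    dressing τ = (dress H G).toPDO := by
  have hw : waveSeries τ = wave id 1 H G := by
    rw [waveSeries, show (-2 : ℂ) = -2 * 1 by norm_num]
    exact hG.fsqrt_phi_mul Function.injective_id (by norm_num) hτ
  have h : ∀ w : ℕ, dressing τ (-(w : ℤ)) = zcoeff w (wave (σ := ℕ) id 1 H G) := by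
    intro w
    ext β
    have h1 : dressing τ (-(w : ℤ)) = fun β =>
        coeff (β.sumElim (Finsupp.single () (- -(w : ℤ)).toNat)) (waveSeries τ) :=
      if_pos (by omega)
    rw [zcoeff, coeff_coeff_zexp, h1, ← hw]
    change coeff (β.sumElim (Finsupp.single () (- -(w : ℤ)).toNat)) (waveSeries τ) = _
    rw [neg_neg, Int.toNat_natCast]
  funext n
  by_cases hn : n ≤ 0
  · obtain ⟨w, hw⟩ := Int.eq_ofNat_of_zero_le (show 0 ≤ -n by omega)
    obtain rfl : n = -(w : ℤ) := by omega
    rw [h]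
    cases w with
    | zero =>
      rw [zcoeff_zero_wave, dress, toPDO_sub, sum_ordLE (adjWave H G) H _ (by norm_num), sub_zero,
        toPDO_one, pd]
      simp
    | succ w => rw [hG.zcoeff_succ_wave, toPDO_dress]
  · have h1 : dressing τ n = 0 := if_neg hn
    rw [h1, dress, toPDO_sub, sum_ordLE (adjWave H G) H _ (by omega), sub_zero,
      toPDO_one, pd, Pi.single_eq_of_ne (by omega)]

/-! ### Generalized Wronskians -/

/-- Schur complement: the bordered determinant `|G v; Hᵀ u|` is `det G` times the transform of
`u`. -/
theorem det_bordered (hG : IsGram H G) (u : Fn) (v : ι → Fn) :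
    (fromBlocks G (replicateCol Unit v) (replicateRow Unit H) (Matrix.of fun _ _ : Unit => u)).det =
      G.det * transform H G u v := by
  let _ : Invertible G := invertibleOfIsUnitDet G hG.isUnit_det
  rw [det_fromBlocks₁₁, invOf_eq_nonsing_inv, hG.row_mul_inv]
  congr 1
  rw [det_unique]
  simp [transform, Matrix.mul_apply, dotProduct]

/-- Cramer's rule: replacing the row `p` of `G` by `H` gives the determinant `det G` times
`(G⁻¹ H)_p`. -/
theorem det_updateRow (hG : IsGram H G) (p : ι) :
    (G.updateRow p H).det = G.det * adjWave H G p := by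
  have h : adjWave H G p = Ring.inverse G.det * G.cramer H p := by
    rw [adjWave, Matrix.inv_def, smul_mulVec, Pi.smul_apply, cramer_eq_adjugate_mulVec, smul_eq_mul]
  rw [h, ← mul_assoc, Ring.mul_inverse_cancel _ hG.isUnit_det, one_mul, cramer_apply,
    ← det_transpose, ← updateCol_transpose, hG.symm.eq]

theorem transform_self (hG : IsGram H G) (p : ι) : transform H G (H p) (fun i => G i p) = 0 := by
  rw [transform, dotProduct, hG.sum_adjWave_mul, sub_self]

theorem transform_smul (c : ℂ) (u : Fn) (v : ι → Fn) :
    transform H G (c • u) (c • v) = c • transform H G u v := by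
  rw [transform, transform, dotProduct_smul, smul_sub]

end IsGram

theorem isEigen_expXi (t₀ : ℕ →₀ ℂ) (μ : ℂ) : IsEigen (expXi t₀ μ) ∧
    ∀ n, dx n (expXi t₀ μ) = μ ^ n • expXi t₀ μ := by
  have h : ∀ n, dt n (expXi t₀ μ) = μ ^ (2 * n + 1) • expXi t₀ μ := by
    intro n
    rw [expXi, dt_eq, ← smul_eq_C_mul, Derivation.map_smul]
    change _ • pderiv ℂ n (expLin _) = _
    rw [pderiv_expLin, ← smul_eq_C_mul, smul_comm]
  have h2 : ∀ n, dx n (expXi t₀ μ) = μ ^ n • expXi t₀ μ := by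
    intro n
    induction n with
    | zero => rw [dx_zero_left, pow_zero, one_smul]
    | succ n ih =>
      rw [dx_succ, ih, dt_eq, Derivation.map_smul, ← dt_eq, h, smul_smul, ← pow_add, mul_zero,
        zero_add]
  exact ⟨fun n => by rw [h, h2], h2⟩

/-! ### The generalized Wronskians of a list -/

/-- The Gram matrix `Ω(h_i, h_j)`. -/
def gram (Ω : Fn →ₗ[ℂ] Fn →ₗ[ℂ] Fn) (h : List Fn) : Matrix (Fin h.length) (Fin h.length) Fn :=
  Matrix.of fun i j => Ω (h.get i) (h.get j)

section

variable {Ω : Fn →ₗ[ℂ] Fn →ₗ[ℂ] Fn} {h : List Fn}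

theorem gram_isSymm (hΩ : IsSEP Ω) (hE : ∀ i, IsEigen (h.get i)) : (gram Ω h).IsSymm :=
  Matrix.ext fun i j => hΩ.symm _ _ (hE j) (hE i)

theorem IW_self (hΩ : IsSEP Ω) (hE : ∀ i, IsEigen (h.get i)) : IW Ω h h = (gram Ω h).det := by
  rw [IW]
  congr 1
  ext1 r c
  rw [of_apply, dif_pos r.2]
  exact hΩ.symm _ _ (hE c) (hE r)

theorem isGram (hΩ : IsSEP Ω) (hE : ∀ i, IsEigen (h.get i))
    (hne : constantCoeff (IW Ω h h) ≠ 0) : IsGram h.get (gram Ω h) where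
  eigen := hE
  flow i j n := hΩ.flow _ _ (hE i) (hE j) n
  symm := gram_isSymm hΩ hE
  unit := by rwa [← IW_self hΩ hE]

/-- Adding an eigenfunction to the second list gives a bordered Gram determinant. -/
theorem IW_append (hΩ : IsSEP Ω) (hE : ∀ i, IsEigen (h.get i)) {u : Fn} (hu : IsEigen u) :
    IW Ω h (h ++ [u]) = (fromBlocks (gram Ω h) (replicateCol Unit fun i => Ω (h.get i) u)
      (replicateRow Unit h.get) (Matrix.of fun _ _ : Unit => u)).det := by
  have hl : h.length + 1 = (h ++ [u]).length := by simp
  set e : Fin h.length ⊕ Unit ≃ Fin (h ++ [u]).length :=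
    ((Equiv.sumCongr (Equiv.refl _) finOneEquiv.symm).trans finSumFinEquiv).trans (finCongr hl)
  have e1 : ∀ i, (e (Sum.inl i) : ℕ) = i := fun i => rfl
  have e2 : ∀ i, (e (Sum.inr i) : ℕ) = h.length := fun i => by simp [e]
  have g1 : ∀ i, (h ++ [u]).get (e (Sum.inl i)) = h.get i := fun i => by
    rw [List.get_eq_getElem, List.get_eq_getElem]
    exact List.getElem_append_left i.2
  have g2 : ∀ i, (h ++ [u]).get (e (Sum.inr i)) = u := fun i => by
    rw [List.get_eq_getElem]
    simp [e2]
  rw [IW, ← det_submatrix_equiv_self e]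
  congr 1
  ext1 r c
  rw [submatrix_apply, of_apply]
  rcases r with r | r
  · rw [dif_pos (show (e (Sum.inl r) : ℕ) < h.length from r.2)]
    rcases c with c | c
    · rw [g1, fromBlocks_apply₁₁]
      exact hΩ.symm _ _ (hE c) (hE r)
    · rw [g2, fromBlocks_apply₁₂]
      exact hΩ.symm _ _ hu (hE r)
  · rw [dif_neg (by rw [e2]; omega), e2, Nat.sub_self, dx_zero_left]
    rcases c with c | c
    · rw [g1, fromBlocks_apply₂₁]; rfl
    · rw [g2, fromBlocks_apply₂₂]; rfl

/-- Moving a row of a determinant to the bottom. -/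
theorem det_updateRow_eq {R : Type*} [CommRing R] {M : ℕ} (A B : Matrix (Fin M) (Fin M) R)
    (p : Fin M) (F : Fin M → R)
    (h1 : ∀ r s : Fin M, (s : ℕ) = (if (r : ℕ) < p then (r : ℕ) else r + 1) → B r = A s)
    (h2 : ∀ r : Fin M, (r : ℕ) + 1 = M → B r = F) :
    (A.updateRow p F).det = (-1) ^ (M + (p + 1)) * B.det := by
  obtain _ | n := M
  · exact p.elim0
  rw [det_succ_row _ p, det_succ_row B (Fin.last n), Finset.mul_sum]
  refine Finset.sum_congr rfl fun c _ => ?_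
  have hsub : (A.updateRow p F).submatrix p.succAbove c.succAbove =
      B.submatrix (Fin.last n).succAbove c.succAbove := by
    ext1 r s
    rw [submatrix_apply, submatrix_apply, updateRow_ne (Fin.succAbove_ne p r), Fin.succAbove_last,
      h1 r.castSucc (p.succAbove r)]
    rw [Fin.succAbove]
    simp only [Fin.lt_def, Fin.val_castSucc]
    split_ifs <;> rfl
  rw [updateRow_self, hsub, h2 (Fin.last n) (by simp), Fin.val_last, ← mul_assoc, ← mul_assoc,
    ← pow_add]
  congr 2
  rw [show n + 1 + (p + 1) + (n + (c : ℕ)) = 2 * (n + 1) + (p + c) by omega,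
    pow_add _ (2 * (n + 1)), pow_mul, neg_one_sq, one_pow, one_mul]

/-- Omitting `h_p` from the first list replaces, up to a sign, the row `p` of the Gram matrix by
the row of the functions `h`. -/
theorem IW_eraseIdx (hΩ : IsSEP Ω) (hE : ∀ i, IsEigen (h.get i)) (p : Fin h.length) :
    (-1) ^ (h.length + (p + 1)) * IW Ω (h.eraseIdx p) h = ((gram Ω h).updateRow p h.get).det := by
  have hl : (h.eraseIdx p).length = h.length - 1 := List.length_eraseIdx_of_lt p.2
  have hp := p.2
  rw [IW, ← det_updateRow_eq (gram Ω h) _ p h.get]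
  · intro r s hs
    have hr : (r : ℕ) < (h.eraseIdx p).length := by
      have := s.2
      split_ifs at hs <;> omega
    ext1 c
    rw [of_apply, dif_pos hr, gram, of_apply, hΩ.symm _ _ (hE s) (hE c)]
    congr 1
    rw [List.get_eq_getElem, List.get_eq_getElem, List.getElem_eraseIdx]
    split_ifs at hs ⊢ <;> simp only [hs]
  · intro r hr
    ext1 c
    rw [of_apply, dif_neg (by omega), show (r : ℕ) - (h.eraseIdx p).length = 0 by omega]
    rfl

end

/-! ### The list of seed functions -/

theorem getElem?_flatten {α : Type*} (L : List (List α)) (i l : ℕ) (hi : i < L.length)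
    (hl : l < L[i].length) :
    L.flatten[((L.map List.length).take i).sum + l]? = some L[i][l] := by
  induction L generalizing i with
  | nil => exact absurd hi (Nat.not_lt_zero _)
  | cons a L ih =>
    obtain _ | i := i
    · simp only [List.getElem_cons_zero] at hl ⊢
      rw [List.flatten_cons, List.take_zero, List.sum_nil, zero_add, List.getElem?_append_left hl,
        List.getElem?_eq_getElem hl]
    · simp only [List.getElem_cons_succ] at hl ⊢
      rw [List.flatten_cons, List.map_cons, List.take_succ_cons, List.sum_cons, add_assoc,
        List.getElem?_append_right (Nat.le_add_right _ _), Nat.add_sub_cancel_left]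
      exact ih i (by simpa using hi) hl

/-- The positions of the functions `f_i^{(kl)}` and `φ_j` in the list of seed functions. -/
theorem exists_seeds_equiv (k : ℕ) {m P : ℕ} (N : Fin m → ℕ) (f : Fin m → Fn) (φ : Fin P → Fn) :
    ∃ e : ((i : Fin m) × Fin (N i + 1)) ⊕ Fin P ≃ Fin (seeds k N f φ).length,
      (∀ i l, (seeds k N f φ).get (e (Sum.inl ⟨i, l⟩)) = dx (k * l) (f i)) ∧
      (∀ j, (seeds k N f φ).get (e (Sum.inr j)) = φ j) ∧
      ∀ i, (e (Sum.inl ⟨i, Fin.last (N i)⟩) : ℕ) + 1 = pos N i := by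
  set L : List (List Fn) := List.ofFn fun i : Fin m =>
    List.ofFn fun l : Fin (N i + 1) => dx (k * (l : ℕ)) (f i) with hL
  have hmap : L.map List.length = List.ofFn fun i : Fin m => N i + 1 := by
    rw [hL, List.map_ofFn]
    congr 1
    funext i
    simp
  have hlenL : L.flatten.length = ∑ i, (N i + 1) := by
    rw [List.length_flatten, hmap, List.sum_ofFn]
  have hlen : ∑ i, (N i + 1) + P = (seeds k N f φ).length := by
    rw [seeds, List.length_append, ← hL, hlenL, List.length_ofFn]
  have hoff : ∀ i : Fin m, ∑ j : Fin i, (N (Fin.castLE i.2.le j) + 1) =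
      ((L.map List.length).take i).sum := by
    intro i
    rw [hmap, List.sum_take_ofFn]
    refine (Finset.sum_map Finset.univ (Fin.castLEEmb i.2.le) fun j => N j + 1).symm.trans ?_
    refine Finset.sum_congr (Finset.ext fun j => ?_) fun _ _ => rfl
    simp only [Finset.mem_map, Finset.mem_univ, true_and, Finset.mem_filter]
    exact ⟨by rintro ⟨a, rfl⟩; exact a.2, fun hj => ⟨⟨j, hj⟩, rfl⟩⟩
  have hpos : ∀ i : Fin m, ((L.map List.length).take i).sum + N i + 1 = pos N i := by
    intro i
    rw [hmap, List.sum_take_ofFn, pos, ← Finset.Iio_insert, Finset.sum_insert (by simp),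
      Finset.sum_add_distrib, Finset.sum_const, smul_eq_mul, mul_one]
    have h1 : (Finset.univ.filter fun j : Fin m => (j : ℕ) < i) = Finset.Iio i := by
      ext j; simp
    rw [h1, Fin.card_Iio]
    omega
  set e : ((i : Fin m) × Fin (N i + 1)) ⊕ Fin P ≃ Fin (seeds k N f φ).length :=
    ((Equiv.sumCongr finSigmaFinEquiv (Equiv.refl _)).trans finSumFinEquiv).trans (finCongr hlen)
    with he
  have e1 : ∀ i l, (e (Sum.inl ⟨i, l⟩) : ℕ) = ((L.map List.length).take i).sum + l := by
    intro i l
    rw [← hoff]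
    exact finSigmaFinEquiv_apply (n := fun i => N i + 1) ⟨i, l⟩
  have e2 : ∀ j, (e (Sum.inr j) : ℕ) = L.flatten.length + j := by
    intro j
    rw [hlenL]
    rfl
  refine ⟨e, fun i l => ?_, fun j => ?_, fun i => ?_⟩
  · have hiL : (i : ℕ) < L.length := by simp [hL]
    have hLi : L[(i : ℕ)] = List.ofFn fun l : Fin (N i + 1) => dx (k * (l : ℕ)) (f i) := by
      simp [hL]
    have hlL : (l : ℕ) < L[(i : ℕ)].length := by rw [hLi, List.length_ofFn]; exact l.2
    have h1 := getElem?_flatten L i l hiL hlL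
    have h2 : (seeds k N f φ)[(e (Sum.inl ⟨i, l⟩) : ℕ)]? = some L[(i : ℕ)][(l : ℕ)] := by
      rw [← h1, e1, seeds, ← hL]
      refine List.getElem?_append_left ?_
      exact (List.getElem?_eq_some_iff.mp h1).1
    rw [List.getElem?_eq_getElem (e _).2, Option.some_inj] at h2
    rw [List.get_eq_getElem, h2, List.getElem_of_eq hLi, List.getElem_ofFn]
  · rw [List.get_eq_getElem]
    have h2 : (seeds k N f φ)[(e (Sum.inr j) : ℕ)]? = some (φ j) := by
      rw [e2, seeds, ← hL, List.getElem?_append_right (Nat.le_add_right _ _),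
        Nat.add_sub_cancel_left]
      simp
    rwa [List.getElem?_eq_getElem (e _).2, Option.some_inj] at h2
  · rw [e1, Fin.val_last, hpos]

/-! ### The functions `q_{1,j}` and `q_{2,j}` -/

namespace IsGram

/-- `Q_j = h_j^{(k)} - ∑_i a_i Ω(h_i, h_j^{(k)})`. -/
def seedTransform (Ω : Fn →ₗ[ℂ] Fn →ₗ[ℂ] Fn) (k : ℕ) (h : List Fn) (j : Fin h.length) : Fn :=
  transform h.get (gram Ω h) (dx k (h.get j)) fun i => Ω (h.get i) (dx k (h.get j))

end IsGram

open IsGram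

section

variable {Ω : Fn →ₗ[ℂ] Fn →ₗ[ℂ] Fn} {k m P : ℕ} {N : Fin m → ℕ} {f : Fin m → Fn} {t₀ : ℕ →₀ ℂ}
  {lam : Fin P → ℂ} {h : List Fn}

theorem left_zero : left 0 = 0 :=
  (congrArg left (sub_self (0 : Fn))).symm.trans ((left_sub 0 0).trans (sub_self _))

theorem right_zero : right 0 = 0 :=
  (congrArg right (sub_self (0 : Fn))).symm.trans ((right_sub 0 0).trans (sub_self _))

theorem isEigen_seeds (hf : ∀ i, IsEigen (f i))
    (i : Fin (seeds k N f fun j => expXi t₀ (lam j)).length) :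
    IsEigen ((seeds k N f fun j => expXi t₀ (lam j)).get i) := by
  obtain ⟨e, he1, he2, -⟩ := exists_seeds_equiv k N f fun j => expXi t₀ (lam j)
  obtain ⟨x, rfl⟩ := e.surjective i
  rcases x with ⟨i, l⟩ | j
  · rw [he1]; exact (hf i).dx _
  · rw [he2]; exact (isEigen_expXi t₀ (lam j)).1

theorem seedTransform_eq_zero (hG : IsGram h.get (gram Ω h)) (c : ℂ) {j p : Fin h.length}
    (hj : dx k (h.get j) = c • h.get p) : seedTransform Ω k h j = 0 := by
  have h1 : (fun i => Ω (h.get i) (dx k (h.get j))) = c • fun i => gram Ω h i p := by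
    funext i
    rw [hj, map_smul]
    rfl
  rw [seedTransform, h1, hj, transform_smul, hG.transform_self, smul_zero]

/-- Only the last derivatives `f_i^{(kN_i)}` contribute: for the other seed functions `h_j`, the
function `h_j^{(k)}` is a multiple of a seed function, which is annihilated by the transform. -/
theorem sum_seeds {A : Type*} [AddCommMonoid A]
    (hG : IsGram (seeds k N f fun j => expXi t₀ (lam j)).get
      (gram Ω (seeds k N f fun j => expXi t₀ (lam j)))) (p : Fin m →
        Fin (seeds k N f fun j => expXi t₀ (lam j)).length) (hp : ∀ i, (p i : ℕ) + 1 = pos N i)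
    (F : Fin (seeds k N f fun j => expXi t₀ (lam j)).length → A)
    (hF : ∀ j, seedTransform Ω k (seeds k N f fun j => expXi t₀ (lam j)) j = 0 → F j = 0) :
    ∑ j, F j = ∑ i, F (p i) := by
  obtain ⟨e, he1, he2, he3⟩ := exists_seeds_equiv k N f fun j => expXi t₀ (lam j)
  have hpe : ∀ i, p i = e (Sum.inl ⟨i, Fin.last (N i)⟩) := fun i =>
    Fin.ext (by have := hp i; have := he3 i; omega)
  rw [← e.sum_comp, Fintype.sum_sum_type, Fintype.sum_sigma,
    Finset.sum_eq_zero (f := fun j => F (e (Sum.inr j))), add_zero]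
  · refine Finset.sum_congr rfl fun i _ => ?_
    rw [Fin.sum_univ_castSucc, Finset.sum_eq_zero, zero_add, hpe]
    intro l _
    refine hF _ (seedTransform_eq_zero hG 1 (p := e (Sum.inl ⟨i, l.succ⟩)) ?_)
    rw [he1, he1, one_smul, dx_dx, Fin.val_castSucc, Fin.val_succ, mul_add, mul_one, add_comm]
  · intro j _
    refine hF _ (seedTransform_eq_zero hG (lam j ^ k) (p := e (Sum.inr j)) ?_)
    rw [he2, (isEigen_expXi t₀ (lam j)).2]

/-- The position of `f_j^{(kN_j)}` as an index of the list of seed functions. -/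
theorem exists_pos (k : ℕ) (N : Fin m → ℕ) (f : Fin m → Fn) (φ : Fin P → Fn) :
    ∃ p : Fin m → Fin (seeds k N f φ).length, (∀ i, (p i : ℕ) + 1 = pos N i) ∧
      ∀ i, (seeds k N f φ).get (p i) = dx (k * N i) (f i) := by
  obtain ⟨e, he1, -, he3⟩ := exists_seeds_equiv k N f φ
  exact ⟨fun i => e (Sum.inl ⟨i, Fin.last (N i)⟩), he3, fun i => by rw [he1, Fin.val_last]⟩

theorem wronski₁_eq (hΩ : IsSEP Ω) (hE : ∀ i, IsEigen (h.get i))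
    (hG : IsGram h.get (gram Ω h)) {j : Fin m} {p : Fin h.length}
    (hp : h.get p = dx (k * N j) (f j)) :
    wronski₁ Ω k N f h j = IW Ω h h * seedTransform Ω k h p := by
  have hu : dx (k * N j + k) (f j) = dx k (h.get p) := by rw [hp, dx_dx, add_comm]
  rw [wronski₁, hu, IW_append hΩ hE ((hE p).dx k), hG.det_bordered, IW_self hΩ hE, seedTransform]

theorem wronski₂_eq (hΩ : IsSEP Ω) (hE : ∀ i, IsEigen (h.get i))
    (hG : IsGram h.get (gram Ω h)) {j : Fin m} {p : Fin h.length} (hp : (p : ℕ) + 1 = pos N j) :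
    wronski₂ Ω N h j = IW Ω h h * adjWave h.get (gram Ω h) p := by
  rw [wronski₂, ← hp, Nat.add_sub_cancel, IW_eraseIdx hΩ hE, hG.det_updateRow, IW_self hΩ hE]

end

end

end CKP

end

open CKP CKP.IsGram CKP.Psd in
theorem theorem2 (k m P : ℕ) (hk : 1 ≤ k) (N : Fin m → ℕ)
    (f : Fin m → CKP.Fn) (hf : ∀ i, CKP.IsEigen (f i))
    (t₀ : ℕ →₀ ℂ) (lam : Fin P → ℂ)
    (h : List CKP.Fn) (hh : h = CKP.seeds k N f fun j => CKP.expXi t₀ (lam j))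
    (Ω : CKP.Fn →ₗ[ℂ] CKP.Fn →ₗ[ℂ] CKP.Fn) (hΩ : CKP.IsSEP Ω)
    (hΩk : CKP.IsNormalized k Ω h)
    (hne : MvPowerSeries.constantCoeff (CKP.IW Ω h h) ≠ 0) :
    (∃ τ : CKP.Fn, τ ^ 2 = CKP.IW Ω h h) ∧
    ∀ τ : CKP.Fn, τ ^ 2 = CKP.IW Ω h h →
      (CKP.Bilinear₁ k τ
          (fun j => CKP.wronski₁ Ω k N f h j * τ⁻¹)
          (fun j => CKP.wronski₂ Ω N h j * τ⁻¹) ∧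
        (∀ j, CKP.Bilinear₂ τ (CKP.wronski₁ Ω k N f h j * τ⁻¹)) ∧
        (∀ j, CKP.Bilinear₂ τ (CKP.wronski₂ Ω N h j * τ⁻¹))) ∧
      ∃ L : CKP.PDO,
        CKP.IsDressing (CKP.dressing τ) L ∧
        CKP.IsConstrainedCKP k L
          (fun j => CKP.wronski₁ Ω k N f h j * (CKP.IW Ω h h)⁻¹)
          (fun j => CKP.wronski₂ Ω N h j * (CKP.IW Ω h h)⁻¹) := by
  refine ⟨exists_sq_eq hne, fun τ hτ => ?_⟩
  subst hh
  set h := seeds k N f fun j => expXi t₀ (lam j) with hh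
  have hE : ∀ i, IsEigen (h.get i) := isEigen_seeds hf
  have hG : IsGram h.get (gram Ω h) := isGram hΩ hE hne
  have hτG : τ ^ 2 = (gram Ω h).det := by rw [hτ, IW_self hΩ hE]
  obtain ⟨p, hp, hpf⟩ := exists_pos k N f fun j => expXi t₀ (lam j)
  set a := adjWave h.get (gram Ω h) with ha
  set Q := seedTransform Ω k h with hQ
  have hEk : ∀ j, IsEigen (dx k (h.get j)) := fun j => (hE j).dx k
  have hB' : ∀ i j n, dt n (Ω (h.get i) (dx k (h.get j))) =
      sepRes (2 * n + 1) (dx k (h.get j)) (h.get i) := fun i j n => by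
    rw [hΩ.symm _ _ (hE i) (hEk j), hΩ.flow _ _ (hEk j) (hE i)]
  have hn : ∀ i j, Ω (h.get j) (dx k (h.get i)) - (-1 : ℤ) ^ k • Ω (h.get i) (dx k (h.get j)) =
      sepRes k (h.get i) (h.get j) := fun i j => by
    rw [hΩ.symm _ _ (hE j) (hEk i)]
    exact hΩk _ (List.get_mem _ _) _ (List.get_mem _ _)
  have hC : ∀ n, ∃ C : Matrix (Fin h.length) (Fin h.length) Fn, ∀ i j,
      dt 0 (C i j) = h.get i * dx (2 * n + 1) (h.get j) := fun n =>
    ⟨Matrix.of fun i j => Ω (h.get i) (dx (2 * n + 1) (h.get j)), fun i j => by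
      rw [Matrix.of_apply, hΩ.flow _ _ (hE i) ((hE j).dx _), sepRes_one]⟩
  have hτ0 : MvPowerSeries.constantCoeff τ ≠ 0 := fun h0 => hne (by
    rw [← hτ, map_pow, h0, zero_pow two_ne_zero])
  have hρ : ∀ x, IW Ω h h * x * τ⁻¹ = x * τ := fun x => by
    rw [← hτ, show τ ^ 2 * x * τ⁻¹ = x * τ * (τ * τ⁻¹) by ring,
      MvPowerSeries.mul_inv_cancel _ hτ0, mul_one]
  have hq : ∀ x, IW Ω h h * x * (IW Ω h h)⁻¹ = x := fun x => by
    rw [mul_comm, ← mul_assoc, MvPowerSeries.inv_mul_cancel _ hne, one_mul]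
  have hw1 : ∀ j, wronski₁ Ω k N f h j = IW Ω h h * Q (p j) := fun j =>
    wronski₁_eq hΩ hE hG (hpf j)
  have hw2 : ∀ j, wronski₂ Ω N h j = IW Ω h h * a (p j) := fun j => wronski₂_eq hΩ hE hG (hp j)
  simp only [hw1, hw2, hρ, hq]
  refine ⟨⟨?_, fun j => ?_, fun j => ?_⟩, (laxOp h.get (gram Ω h)).toPDO, ?_, ?_⟩
  · have := hG.bilinear_one hτG k
      (B := Matrix.of fun i j => Ω (h.get i) (dx k (h.get j)))
      (fun i j n => hΩ.flow _ _ (hE i) (hEk j) n) hB' hn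
    rw [Bilinear₁, this]
    refine (congrArg _ (sum_seeds hG p hp _ fun j hj => ?_)).trans ?_
    · change left (Q j) * _ - _ * right (Q j) = 0
      have hj' : Q j = 0 := hj
      rw [hj', left_zero, right_zero, zero_mul, mul_zero, sub_zero]
    · rw [Finset.mul_sum]
      refine Finset.sum_congr rfl fun i _ => ?_
      change left τ * right τ * (left (Q (p i)) * right (a (p i)) -
        (-1) ^ k * left (a (p i)) * right (Q (p i))) = _
      rw [left_mul, left_mul, right_mul, right_mul]
      ring
  · exact hG.bilinear_two hτG
      (hG.shiftRatio_mul_transform Sum.inr_injective neg_one_sq_eq (hEk _)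
        fun i n => hΩ.flow _ _ (hE i) (hEk _) n)
      (hG.resExp_wave_mul_transform (hEk _) fun i n => hΩ.flow _ _ (hE i) (hEk _) n)
  · exact hG.bilinear_two hτG (hG.shiftRatio_mul_adjWave Sum.inr_injective neg_one_sq_eq _)
      (hG.resExp_wave_mul_adjResolvent _)
  · rw [hG.dressing_eq hτG]
    exact hG.isDressing hC
  · refine ⟨hG.isCKPLax hC, ?_, fun j n => ?_, fun j n => hG.dt_adjWave hC n _⟩
    · rw [hG.pneg_laxOp_pow k (Matrix.of fun i j => Ω (h.get i) (dx k (h.get j))) fun i j => by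
          rw [Matrix.of_apply, hΩ.flow _ _ (hE i) (hEk j), sepRes_one],
        negLax_eq k (Matrix.of fun i j => Ω (h.get i) (dx k (h.get j))) hn,
        sum_seeds hG p hp _ fun j hj => ?_]
      · funext i
        rw [toPDO_sum, Finset.sum_apply]
        refine Finset.sum_congr rfl fun j _ => ?_
        rw [toPDO_sub, toPDO_zsmul]
        rfl
      · have hj' : Q j = 0 := hj
        change fn (Q j) * _ * _ - _ • (_ * _ * fn (Q j)) = 0
        rw [hj', map_zero, zero_mul, zero_mul, mul_zero, smul_zero, sub_zero]
    · exact hG.dt_transform hC (hEk _) (fun i n => hB' i _ n) n
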